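/- Let $g\ge 3$. Let $N_g$ be the closed connected non-orientable smooth surface of genus $g$, let $\Sigma_{g-1}$ be the closed connected oriented smooth surface of genus $g-1$, and let $\widetilde J:\Sigma_{g-1}\to N_g$ be an orientation double covering map. (An orientation double covering map $\Theta:M\to N$ is a local diffeomorphism from an oriented manifold $M$ to a connected manifold $N$ such that every fibre has exactly two points and such that $(d\Theta_{p_2})^{-1}\circ d\Theta_{p_1}:T_{p_1}M\to T_{p_2}M$ reverses the orientation whenever $p_1\neq p_2$ lie in one fibre.) Let $\mathcal M(N_g)$ be the group of smooth isotopy classes of diffeomorphisms of $N_g$, and $\mathcal M(\Sigma_{g-1})$ the group of smooth isotopy classes of orientation preserving diffeomorphisms of $\Sigma_{g-1}$, with the product $[\omega][\omega']=[\omega\circ\omega']$. A Lefschetz fibration is a smooth map $f:X\to\Sigma$ from a compact connected smooth 4-manifold to a compact connected orientable smooth surface (both possibly with boundary) such that $\partial X=f^{-1}(\partial\Sigma)$, the set $\mathrm{Crit}(f)$ of critical points lies in the interior of $X$, and near every critical point $x$ there are complex charts about $x$ and $f(x)$ in which $f$ is $(z,w)\mapsto zw$. Put $\Delta_f=f(\mathrm{Crit}(f))$.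 Given $y\in\Sigma-\Delta_f$ and a diffeomorphism $\Xi$ from $f^{-1}(y)$ onto a closed surface $S$, the monodromy representation $\rho_f:\pi_1(\Sigma-\Delta_f,y)\to\mathcal M(S)$ is defined by $\rho_f([a])=[\Xi\circ\Phi_1]$, where $a$ is a smooth loop in $\Sigma-\Delta_f$ based at $y$ and $\Phi:[0,1]\times S\to a^*X=\{(t,x): f(x)=a(t)\}$, $\Phi(t,p)=(t,\Phi_t(p))$, is a smooth trivialization with $\Phi_0=\Xi^{-1}$. (In $\pi_1$, $[a][b]$ is the class of the loop that first runs along $b$ and then along $a$.) Let $f:X\to\Sigma$ be a Lefschetz fibration with $X$ non-orientable, let $y\in\Sigma-\Delta_f$, let $\Xi:f^{-1}(y)\to N_g$ be a diffeomorphism, and let $\pi:\widetilde X\to X$ be an orientation double covering map (for instance the standard one, formed by the pairs of a point of $X$ and a local orientation there). Then the following hold. 1. $\Delta_{f\circ\pi}=\Delta_f$, and there is a diffeomorphism $\widetilde\Xi:(f\circ\pi)^{-1}(y)\to\Sigma_{g-1}$ that lifts $\Xi$, that is, $\widetilde J\circ\widetilde\Xi=\Xi\circ\pi$ on $(f\circ\pi)^{-1}(y)$.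 2. Every diffeomorphism $\omega$ of $N_g$ has exactly one orientation preserving lift $\widetilde\omega$, that is, an orientation preserving diffeomorphism of $\Sigma_{g-1}$ with $\widetilde J\circ\widetilde\omega=\omega\circ\widetilde J$, and $\eta([\omega])=[\widetilde\omega]$ defines a homomorphism $\eta:\mathcal M(N_g)\to\mathcal M(\Sigma_{g-1})$. 3. The monodromy representation $\rho_f:\pi_1(\Sigma-\Delta_f,y)\to\mathcal M(N_g)$ with respect to $\Xi$ and, for every lift $\widetilde\Xi$ of $\Xi$, the monodromy representation $\rho_{f\circ\pi}:\pi_1(\Sigma-\Delta_f,y)\to\mathcal M(\Sigma_{g-1})$ with respect to $\widetilde\Xi$ are well-defined homomorphisms, and $$\rho_{f\circ\pi}=\eta\circ\rho_f .$$ -/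

import Mathlib

open Set Topology
open scoped Manifold ContDiff

noncomputable section

/-! ### Orientations of smooth manifolds (possibly with boundary) -/

section Orientations

/-- The linear map `L : V → W` is an isomorphism carrying the orientation `o` to `o'`. -/
def MapsOrientation {n : ℕ} {V W : Type*} [AddCommGroup V] [Module ℝ V] [TopologicalSpace V]
    [AddCommGroup W] [Module ℝ W] [TopologicalSpace W]
    (L : V →L[ℝ] W) (o : Orientation ℝ V (Fin n)) (o' : Orientation ℝ W (Fin n)) : Prop :=
  ∃ e : V ≃ₗ[ℝ] W, (∀ v, e v = L v) ∧ Orientation.map (Fin n) e o = o'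

theorem MapsOrientation.comp {n : ℕ} {V W Z : Type*}
    [AddCommGroup V] [Module ℝ V] [TopologicalSpace V]
    [AddCommGroup W] [Module ℝ W] [TopologicalSpace W]
    [AddCommGroup Z] [Module ℝ Z] [TopologicalSpace Z]
    {K : W →L[ℝ] Z} {L : V →L[ℝ] W}
    {o : Orientation ℝ V (Fin n)} {o' : Orientation ℝ W (Fin n)} {o'' : Orientation ℝ Z (Fin n)}
    (hK : MapsOrientation K o' o'') (hL : MapsOrientation L o o') :
    MapsOrientation (K.comp L) o o'' := by
  obtain ⟨e, he, rfl⟩ := hL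
  obtain ⟨e', he', rfl⟩ := hK
  refine ⟨e.trans e', fun v => by simp [he, he'], ?_⟩
  induction o using Module.Ray.ind with
  | h v hv =>
    simp only [Orientation.map_apply]
    rfl

variable {n : ℕ} {H : Type*} [TopologicalSpace H]

/-- An orientation of an `n`-dimensional smooth manifold `M` (with or without boundary): an
orientation of every tangent space which, read in any of the preferred charts of `M`, is constant
near the centre of the chart. -/
structure ManifoldOrientation (I : ModelWithCorners ℝ (EuclideanSpace ℝ (Fin n)) H)
    (M : Type*) [TopologicalSpace M] [ChartedSpace H M] where
  /-- the orientation of the tangent space at a point -/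
  atPoint : ∀ p : M, Orientation ℝ (TangentSpace I p) (Fin n)
  locallyConstant : ∀ p₀ : M, ∃ oE : Orientation ℝ (EuclideanSpace ℝ (Fin n)) (Fin n),
    ∀ᶠ p in 𝓝 p₀, MapsOrientation
      (mfderiv I 𝓘(ℝ, EuclideanSpace ℝ (Fin n)) (extChartAt I p₀) p) (atPoint p) oE

/-- `M` is orientable. -/
def IsOrientableManifold (I : ModelWithCorners ℝ (EuclideanSpace ℝ (Fin n)) H)
    (M : Type*) [TopologicalSpace M] [ChartedSpace H M] : Prop :=
  Nonempty (ManifoldOrientation I M)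

/-- An orientation double covering map `Θ : M → N`, where `M` carries the orientation `o`:
`N` is connected, `Θ` is a local diffeomorphism all of whose fibres have exactly two points, and
for two points `p₁ ≠ p₂` of one fibre the isomorphism
`L = (dΘ_{p₂})⁻¹ ∘ dΘ_{p₁} : T_{p₁}M → T_{p₂}M` reverses the orientation. -/
structure IsOrientationDoubleCover {I : ModelWithCorners ℝ (EuclideanSpace ℝ (Fin n)) H}
    {M N : Type*} [TopologicalSpace M] [ChartedSpace H M] [TopologicalSpace N] [ChartedSpace H N]
    (o : ManifoldOrientation I M) (Θ : M → N) : Prop where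
  connected : ConnectedSpace N
  localDiffeo : IsLocalDiffeomorph I I ∞ Θ
  two_points : ∀ q : N, (Θ ⁻¹' {q}).ncard = 2
  reversing : ∀ p₁ p₂ : M, p₁ ≠ p₂ → Θ p₁ = Θ p₂ →
    ∀ L : TangentSpace I p₁ →L[ℝ] TangentSpace I p₂,
      (∀ v : TangentSpace I p₁, (mfderiv I I Θ p₂ (L v) : EuclideanSpace ℝ (Fin n))
        = (mfderiv I I Θ p₁ v : EuclideanSpace ℝ (Fin n))) →
      MapsOrientation L (o.atPoint p₁) (-(o.atPoint p₂))

end Orientations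

/-! ### Closed surfaces and their mapping class groups -/

section Surfaces

/-- A connected closed surface has genus `g` (in the orientable as well as in the non-orientable
sense) if `g` is the largest number of pairwise disjoint simple closed curves whose union does
not separate it. -/
def HasGenus (S : Type*) [TopologicalSpace S] (g : ℕ) : Prop :=
  IsGreatest {k : ℕ | ∃ c : Fin k → Circle → S,
    (∀ i, Continuous (c i) ∧ Function.Injective (c i)) ∧
    (∀ i j, i ≠ j → Disjoint (range (c i)) (range (c j))) ∧
    IsConnected (⋃ i, range (c i))ᶜ} g

variable (S : Type*) [TopologicalSpace S] [ChartedSpace (EuclideanSpace ℝ (Fin 2)) S]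

/-- Smooth auto-diffeomorphisms of a surface without boundary. -/
abbrev SurfaceDiffeo : Type _ := S ≃ₘ⟮𝓡 2, 𝓡 2⟯ S

variable {S}

/-- Auto-diffeomorphisms form a group under composition. -/
instance SurfaceDiffeo.instGroup : Group (SurfaceDiffeo S) where
  mul φ φ' := φ'.trans φ
  one := Diffeomorph.refl (𝓡 2) S ∞
  inv φ := φ.symm
  mul_assoc _ _ _ := rfl
  one_mul _ := rfl
  mul_one _ := rfl
  inv_mul_cancel φ := Diffeomorph.ext fun p => φ.symm_apply_apply p

@[simp] theorem SurfaceDiffeo.mul_apply (φ φ' : SurfaceDiffeo S) (p : S) :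
    (φ * φ') p = φ (φ' p) := rfl

@[simp] theorem SurfaceDiffeo.one_apply (p : S) : (1 : SurfaceDiffeo S) p = p := rfl

@[simp] theorem SurfaceDiffeo.inv_apply (φ : SurfaceDiffeo S) (p : S) : φ⁻¹ p = φ.symm p := rfl

@[simp] theorem SurfaceDiffeo.mul_symm_apply (φ φ' : SurfaceDiffeo S) (p : S) :
    (φ * φ').symm p = φ'.symm (φ.symm p) := rfl

@[simp] theorem SurfaceDiffeo.inv_symm_apply (φ : SurfaceDiffeo S) (p : S) :
    (φ⁻¹).symm p = φ p := rfl

/-- `h : [0,1] × S → S` is smooth. -/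
abbrev SmoothFamily (h : ℝ → S → S) : Prop :=
  ContMDiffOn (𝓘(ℝ, ℝ).prod (𝓡 2)) (𝓡 2) ∞ (fun q : ℝ × S => h q.1 q.2) (Icc 0 1 ×ˢ univ)

/-- `φ` and `φ'` are smoothly isotopic: they are joined by diffeomorphisms `h t`, `t ∈ [0,1]`,
such that `(t, p) ↦ h t p` is smooth. (The smoothness of `(t, p) ↦ (h t)⁻¹ p` is then automatic,
by the inverse function theorem.) -/
def SmoothlyIsotopic (φ φ' : SurfaceDiffeo S) : Prop :=
  ∃ h : ℝ → SurfaceDiffeo S, SmoothFamily (fun t p => h t p) ∧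
    SmoothFamily (fun t p => (h t).symm p) ∧ h 0 = φ ∧ h 1 = φ'

theorem SmoothFamily.comp {h k : ℝ → S → S} (hh : SmoothFamily h) (hk : SmoothFamily k) :
    SmoothFamily (fun t p => h t (k t p)) :=
  ContMDiffOn.comp (t := Icc 0 1 ×ˢ univ) hh (contMDiffOn_fst.prodMk hk)
    fun _ hq => ⟨hq.1, mem_univ _⟩

theorem SmoothFamily.const (φ : SurfaceDiffeo S) : SmoothFamily (fun _ p => φ p) :=
  (φ.contMDiff.comp contMDiff_snd).contMDiffOn

theorem SmoothlyIsotopic.mul {φ₁ φ₂ φ₁' φ₂' : SurfaceDiffeo S} (h₁ : SmoothlyIsotopic φ₁ φ₁')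
    (h₂ : SmoothlyIsotopic φ₂ φ₂') : SmoothlyIsotopic (φ₁ * φ₂) (φ₁' * φ₂') := by
  obtain ⟨h, h1, h2, h3, h4⟩ := h₁
  obtain ⟨k, k1, k2, k3, k4⟩ := h₂
  exact ⟨fun t => h t * k t, h1.comp k1, k2.comp h2, by simp [h3, k3], by simp [h4, k4]⟩

theorem SmoothlyIsotopic.refl (φ : SurfaceDiffeo S) : SmoothlyIsotopic φ φ :=
  ⟨fun _ => φ, .const φ, .const φ.symm, rfl, rfl⟩

theorem SmoothlyIsotopic.inv {φ φ' : SurfaceDiffeo S} (h₁ : SmoothlyIsotopic φ φ') :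
    SmoothlyIsotopic φ⁻¹ φ'⁻¹ := by
  obtain ⟨h, h1, h2, h3, h4⟩ := h₁
  exact ⟨fun t => (h t)⁻¹, h2, h1, by simp [h3], by simp [h4]⟩

variable (S) in
/-- The group of diffeomorphisms smoothly isotopic to the identity. -/
def isotopicToId : Subgroup (SurfaceDiffeo S) where
  carrier := {φ | SmoothlyIsotopic 1 φ}
  mul_mem' {_ _} h k := by simpa using SmoothlyIsotopic.mul h k
  one_mem' := .refl 1
  inv_mem' {_} h := by simpa using SmoothlyIsotopic.inv h

instance isotopicToId_normal : (isotopicToId S).Normal where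
  conj_mem φ h k := by
    simpa [isotopicToId] using ((SmoothlyIsotopic.refl k).mul h).mul (.refl k⁻¹)

/-- The group of isotopy classes of the diffeomorphisms of `S` that belong to the group `G`.
For `G = ⊤` this is the mapping class group of a non-orientable surface; for `G` the group of
orientation preserving diffeomorphisms it is the mapping class group of an oriented surface. -/
abbrev MappingClassGroup (G : Subgroup (SurfaceDiffeo S)) : Type _ :=
  G ⧸ (isotopicToId S).subgroupOf G

/-- The mapping class of `φ`. -/
abbrev mappingClass {G : Subgroup (SurfaceDiffeo S)} (φ : G) : MappingClassGroup G :=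
  QuotientGroup.mk φ

/-- Two diffeomorphisms have the same mapping class exactly if they are isotopic. -/
theorem mappingClass_eq_iff {G : Subgroup (SurfaceDiffeo S)} (φ φ' : G) :
    mappingClass φ = mappingClass φ' ↔ SmoothlyIsotopic (φ : SurfaceDiffeo S) φ' := by
  rw [QuotientGroup.eq, Subgroup.mem_subgroupOf]
  change SmoothlyIsotopic 1 _ ↔ _
  constructor
  · intro h
    simpa using (SmoothlyIsotopic.refl (φ : SurfaceDiffeo S)).mul h
  · intro h
    simpa using (SmoothlyIsotopic.refl (φ : SurfaceDiffeo S)⁻¹).mul h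

variable [IsManifold (𝓡 2) ∞ S]

/-- The group of orientation preserving diffeomorphisms of an oriented surface. -/
def orientationPreserving (o : ManifoldOrientation (𝓡 2) S) : Subgroup (SurfaceDiffeo S) where
  carrier := {φ | ∀ p : S, MapsOrientation (mfderiv (𝓡 2) (𝓡 2) φ p) (o.atPoint p)
    (o.atPoint (φ p))}
  mul_mem' {φ φ'} h h' p := by
    have e : mfderiv (𝓡 2) (𝓡 2) (φ * φ') p =
        (mfderiv (𝓡 2) (𝓡 2) φ (φ' p)).comp (mfderiv (𝓡 2) (𝓡 2) φ' p) :=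
      mfderiv_comp p (φ.mdifferentiable (by simp) _) (φ'.mdifferentiable (by simp) _)
    rw [e]
    exact (h (φ' p)).comp (h' p)
  one_mem' p := by
    refine ⟨LinearEquiv.refl ℝ _, fun v => ?_, ?_⟩
    · have h1 : mfderiv (𝓡 2) (𝓡 2) (1 : SurfaceDiffeo S) p = ContinuousLinearMap.id ℝ _ :=
        mfderiv_id
      rw [h1]
      rfl
    · exact congrFun (congrArg DFunLike.coe (Orientation.map_refl (R := ℝ)
        (M := TangentSpace (𝓡 2) p) (ι := Fin 2))) (o.atPoint p)
  inv_mem' {φ} h p := by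
    obtain ⟨q, hqp⟩ : ∃ q, φ q = p := φ.surjective p
    subst hqp
    obtain ⟨e, he, ho⟩ := h q
    have hq : (φ⁻¹ : SurfaceDiffeo S) (φ q) = q := φ.symm_apply_apply q
    have hc : (mfderiv (𝓡 2) (𝓡 2) (φ⁻¹ : SurfaceDiffeo S) (φ q)).comp
        (mfderiv (𝓡 2) (𝓡 2) φ q) = mfderiv (𝓡 2) (𝓡 2) (id : S → S) q := by
      rw [← mfderiv_comp q ((φ⁻¹ : SurfaceDiffeo S).mdifferentiable (by simp) _)
        (φ.mdifferentiable (by simp) _)]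
      congr 1
      funext x
      exact φ.symm_apply_apply x
    have ho' : ∀ r : S, r = q → (o.atPoint r : Orientation ℝ (EuclideanSpace ℝ (Fin 2)) (Fin 2))
        = o.atPoint q := by
      rintro r rfl
      rfl
    refine ⟨e.symm, fun v => ?_, ?_⟩
    · obtain ⟨u, rfl⟩ := e.surjective v
      have hu := congrArg (fun L => L u) hc
      rw [mfderiv_id] at hu
      rw [he]
      refine Eq.trans ?_ hu.symm
      rw [← he]
      exact e.symm_apply_apply u
    · refine Eq.trans ?_ (ho' _ hq).symm
      rw [← ho]
      exact (Orientation.map (Fin 2) e).symm_apply_apply (o.atPoint q)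

end Surfaces

/-! ### Lefschetz fibrations and their monodromy -/

section Lefschetz

variable {X B : Type*} [TopologicalSpace X] [ChartedSpace (EuclideanHalfSpace 4) X]
  [TopologicalSpace B] [ChartedSpace (EuclideanHalfSpace 2) B]

/-- The critical points of `f`. -/
def criticalPoints (f : X → B) : Set X :=
  {x | ¬ Function.Surjective (mfderiv (𝓡∂ 4) (𝓡∂ 2) f x)}

/-- The critical values of `f`. -/
def criticalValues (f : X → B) : Set B := f '' criticalPoints f

/-- A Lefschetz fibration `f : X → B` (for a compact connected 4-manifold `X` and a compact
connected orientable surface `B`, both possibly with boundary). Complex charts are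
diffeomorphisms of open sets of `X` and `B` onto open sets of `ℂ²` and `ℂ`; no compatibility with
orientations is required of them. -/
structure IsLefschetzFibration (f : X → B) : Prop where
  smooth : ContMDiff (𝓡∂ 4) (𝓡∂ 2) ∞ f
  boundary_eq : (𝓡∂ 4).boundary X = f ⁻¹' (𝓡∂ 2).boundary B
  crit_interior : criticalPoints f ⊆ (𝓡∂ 4).interior X
  local_model : ∀ x ∈ criticalPoints f,
    ∃ (φ : PartialDiffeomorph (𝓡∂ 4) 𝓘(ℝ, ℂ × ℂ) X (ℂ × ℂ) ∞)
      (ψ : PartialDiffeomorph (𝓡∂ 2) 𝓘(ℝ, ℂ) B ℂ ∞),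
      x ∈ φ.source ∧ φ.source ⊆ f ⁻¹' ψ.source ∧
      ∀ z ∈ φ.target, ψ (f (φ.symm z)) = z.1 * z.2

variable {S : Type*} [TopologicalSpace S] [ChartedSpace (EuclideanSpace ℝ (Fin 2)) S]

/-- `ι : S → X` is the inverse of a diffeomorphism `Ξ : f⁻¹(y) → S` from a regular fibre onto the
surface `S`, i.e. an injective immersion with image `f⁻¹(y)`. -/
structure IsFiberParam (f : X → B) (y : B) (ι : S → X) : Prop where
  smooth : ContMDiff (𝓡 2) (𝓡∂ 4) ∞ ι
  injective : Function.Injective ι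
  range_eq : range ι = f ⁻¹' {y}
  immersion : ∀ p : S, Function.Injective (mfderiv (𝓡 2) (𝓡∂ 4) ι p)

/-- The loop `a` in the complement of `D` is smooth as a map `[0,1] → B`. -/
def IsSmoothLoop {D : Set B} {y : {z : B // z ∉ D}} (a : Path y y) : Prop :=
  ContMDiffOn 𝓘(ℝ, ℝ) (𝓡∂ 2) ∞ (fun t : ℝ => (a.extend t : B)) (Icc 0 1)

/-- The map `(t, p) ↦ (t, F t p)` is a trivialization
`[0,1] × S → a^*X = {(t, x) | f x = a t}` of the pull-back of `f` along the loop `a`, which over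
`t = 0` is the given parametrization `ι = Ξ⁻¹` of the fibre over the base point. -/
structure IsTrivializationAlong (f : X → B) {D : Set B} {y : {z : B // z ∉ D}} (a : Path y y)
    (ι : S → X) (F : ℝ → S → X) : Prop where
  smooth : ContMDiffOn (𝓘(ℝ, ℝ).prod (𝓡 2)) (𝓡∂ 4) ∞ (fun q : ℝ × S => F q.1 q.2)
    (Icc 0 1 ×ˢ univ)
  fiber : ∀ t ∈ Icc (0 : ℝ) 1, IsFiberParam f (a.extend t : B) (F t)
  initial : F 0 = ι

/-- `ρ` is the monodromy representation of `f : X → B` over the complement of `D`, with respect to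
the base point `y` and the identification `Ξ = ι⁻¹` of the fibre over `y` with `S`, where mapping
classes are formed from the diffeomorphisms of `S` that belong to `G`. That is, for every smooth
loop `a` and every trivialization `Φ` along it that starts at `Ξ⁻¹`, `Ξ ∘ Φ₁` belongs to `G` and
`ρ [a] = [Ξ ∘ Φ₁]`. Trivializations along all smooth loops, and smooth loops in all homotopy
classes, have to exist, so that there is at most one such `ρ`. -/
structure IsMonodromyRepresentation (f : X → B) (D : Set B) (y : {z : B // z ∉ D}) (ι : S → X)
    (G : Subgroup (SurfaceDiffeo S))
    (ρ : FundamentalGroup {z : B // z ∉ D} y →* MappingClassGroup G) : Prop where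
  exists_loop : ∀ α : FundamentalGroup {z : B // z ∉ D} y, ∃ a : Path y y, IsSmoothLoop a ∧
    FundamentalGroup.fromPath (Path.Homotopic.Quotient.mk a) = α
  exists_trivialization : ∀ a : Path y y, IsSmoothLoop a →
    ∃ F : ℝ → S → X, IsTrivializationAlong f a ι F
  eq_class : ∀ a : Path y y, IsSmoothLoop a →
    ∀ F : ℝ → S → X, IsTrivializationAlong f a ι F →
      ∃ φ : G, (∀ p, ι ((φ : SurfaceDiffeo S) p) = F 1 p) ∧
        ρ (FundamentalGroup.fromPath (Path.Homotopic.Quotient.mk a)) = mappingClass φ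

end Lefschetz

/-! ### The lifting homomorphism -/

section Lifting

variable {N S : Type*} [TopologicalSpace N] [ChartedSpace (EuclideanSpace ℝ (Fin 2)) N]
  [TopologicalSpace S] [ChartedSpace (EuclideanSpace ℝ (Fin 2)) S] [IsManifold (𝓡 2) ∞ S]

/-- `η : M(N) → M(S)` sends the class of `φ` to the class of its orientation preserving lift
`φ'` along `J : S → N`; every diffeomorphism `φ` of `N` has exactly one such lift. -/
def IsLiftingHom (o : ManifoldOrientation (𝓡 2) S) (J : S → N)
    (η : MappingClassGroup (⊤ : Subgroup (SurfaceDiffeo N)) →*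
      MappingClassGroup (orientationPreserving o)) : Prop :=
  ∀ φ : (⊤ : Subgroup (SurfaceDiffeo N)),
    (∃! φ' : orientationPreserving o,
      ∀ p, J ((φ' : SurfaceDiffeo S) p) = (φ : SurfaceDiffeo N) (J p)) ∧
    ∀ φ' : orientationPreserving o,
      (∀ p, J ((φ' : SurfaceDiffeo S) p) = (φ : SurfaceDiffeo N) (J p)) →
        η (mappingClass φ) = mappingClass φ'

end Lifting

end

/-! The proof has two independent halves: monodromy exists, and everything lifts through orientation
signs.

Monodromy. A regular fibre has a neighbourhood with a smooth retraction `r` onto it, glued from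
local product charts, and `(f, r)` then identifies the part of `X` over a small open set of the base
with a product. This is Ehresmann's theorem in the form of a flat parallel transport
(`exists_fiberTransport`); it holds at the boundary as well, since `∂X = f⁻¹(∂B)` lets the inverse
function theorem work on half spaces. Transport gives trivializations along smooth paths
(`hasTrivializationOn_one`), and every homotopy class contains a smooth loop
(`exists_isSmoothLoop`). Two smooth families of parametrized fibres differ by a smooth family of
diffeomorphisms, so comparing the transported parametrizations gives a locally constant cocycle with
values in the mapping class group. The monodromy of the covering built from this cocycle is `ρ`
(`exists_hom_of_cocycle`, `exists_isMonodromyRepresentation`).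

Lifting. Orientations of `ℝⁿ` are encoded as signs. In an orientation double cover the two points of
a fibre carry opposite signs `coverSign`, so a point is determined by its image and its sign, and a
lift of a map is a choice of sign at each of its values; the lift of a smooth map is smooth if the
sign varies continuously (`IsSignAlong`, `contMDiff_lift`). A diffeomorphism of `N` carries signs
along by its Jacobian; this gives the unique orientation preserving lift, compatibly with products
and isotopies, and hence `η`. For a parametrized regular fibre `k : N → X`, the exact sequence `0 →
TN → TX → TB → 0` and an orientation of `B` turn an orientation of `TN` into one of `TX`. Thus a
point of `S` over `q` selects a point of `X'` over `k q`, and fibre parametrizations and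
trivializations lift, in families (`exists_lift_family`). By uniqueness, if a trivialization ends at
`ι ∘ φ`, then its lift ends at `ι'` composed with the orientation preserving lift of `φ`
(`inducedSign_comp`). This is the equality `ρ' = η ∘ ρ`. -/

noncomputable section
open Filter

/-! ### Smoothness of maps whose composition with an immersion is smooth -/

section ImmersionLifting

variable {P E F : Type*} [NormedAddCommGroup P] [NormedSpace ℝ P]
  [NormedAddCommGroup E] [NormedSpace ℝ E] [FiniteDimensional ℝ E]
  [NormedAddCommGroup F] [NormedSpace ℝ F] [FiniteDimensional ℝ F]

omit [FiniteDimensional ℝ E] in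
theorem ContinuousLinearMap.exists_leftInverse_of_injective (L : E →L[ℝ] F)
    (hL : Function.Injective L) : ∃ β : F →L[ℝ] E, β.comp L = ContinuousLinearMap.id ℝ E := by
  obtain ⟨b, hb⟩ := LinearMap.exists_leftInverse_of_injective (L : E →ₗ[ℝ] F)
    (LinearMap.ker_eq_bot.2 hL)
  refine ⟨LinearMap.toContinuousLinearMap b, ?_⟩
  ext v
  exact congrArg (fun l => l v) hb

/-- A map which is continuous, and whose composition with an immersion is of class `C^n`, is of
class `C^n`. -/
theorem contDiffWithinAt_nat_of_comp_immersion (n : ℕ) {G : E → F} {s : Set E} {g : P → E}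
    {A : Set P} {a : P} (ha : a ∈ A) (hg : ∀ᶠ b in 𝓝[A] a, ContinuousWithinAt g A b)
    (hmaps : MapsTo g A s) (hG : ContDiffWithinAt ℝ n G s (g a))
    (hu : UniqueDiffWithinAt ℝ s (g a)) (hinj : Function.Injective (fderivWithin ℝ G s (g a)))
    (hQ : ContDiffWithinAt ℝ n (G ∘ g) A a) : ContDiffWithinAt ℝ n g A a := by
  induction n with
  | zero =>
    rw [CharP.cast_eq_zero, contDiffWithinAt_zero ha]
    exact ⟨_, hg, fun b hb => hb.2.mono inter_subset_left⟩
  | succ n ih =>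
    have ih' := ih (hG.of_le (by exact_mod_cast Nat.le_succ n))
      (hQ.of_le (by exact_mod_cast Nat.le_succ n))
    push_cast at hG hQ ⊢
    rw [contDiffWithinAt_succ_iff_hasFDerivWithinAt' (by simp)] at hG hQ
    obtain ⟨u, hu', -, -, G', hG', hG'n⟩ := hG
    obtain ⟨v, hv', -, -, Q', hQ', hQ'n⟩ := hQ
    rw [insert_eq_of_mem (hmaps ha)] at hu'
    rw [insert_eq_of_mem ha] at hv'
    have hga : ContinuousWithinAt g A a := hg.self_of_nhdsWithin ha
    have htend : Tendsto g (𝓝[A] a) (𝓝[s] (g a)) := hga.tendsto_nhdsWithin hmaps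
    have e0 : fderivWithin ℝ G s (g a) = G' (g a) :=
      (hG' _ (mem_of_mem_nhdsWithin (hmaps ha) hu')).fderivWithin hu
    rw [e0] at hinj
    -- `β` is a left inverse only at `g a`, but `β ∘ G' (g b)` stays invertible for `b` near `a`.
    -- Solving the chain rule gives `g' = (β ∘ G' (g b))⁻¹ ∘ β ∘ Q' b`, which is of class `C^n` by
    -- the induction hypothesis on `g`.
    obtain ⟨β, hβ⟩ := (G' (g a)).exists_leftInverse_of_injective hinj
    have hMn : ContDiffWithinAt ℝ n (fun b => β.comp (G' (g b))) A a :=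
      contDiffWithinAt_const.clm_comp (hG'n.comp a ih' hmaps)
    have hMinv : ContDiffWithinAt ℝ n (fun b => ContinuousLinearMap.inverse (β.comp (G' (g b)))) A a := by
      have h1 : ContDiffAt ℝ n (ContinuousLinearMap.inverse : (E →L[ℝ] E) → _)
          (β.comp (G' (g a))) := by
        rw [hβ]
        exact contDiffAt_map_inverse (ContinuousLinearEquiv.refl ℝ E)
      exact h1.comp_contDiffWithinAt a hMn
    have hev : ∀ᶠ b in 𝓝[A] a, (β.comp (G' (g b))).IsInvertible := by
      have hopen : ∀ᶠ m in 𝓝 (β.comp (G' (g a))), m.IsInvertible := by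
        rw [hβ]
        exact (ContinuousLinearEquiv.refl ℝ E).nhds
      exact hMn.continuousWithinAt.eventually hopen
    rw [contDiffWithinAt_succ_iff_hasFDerivWithinAt' (by simp)]
    refine ⟨{b | b ∈ A ∧ b ∈ v ∧ g b ∈ u ∧ ContinuousWithinAt g A b ∧
      (β.comp (G' (g b))).IsInvertible}, ?_, fun b hb => by simp [hb.1], by simp,
      fun b => (ContinuousLinearMap.inverse (β.comp (G' (g b))) ∘L β) ∘L Q' b, ?_, ?_⟩
    · rw [insert_eq_of_mem ha]
      filter_upwards [self_mem_nhdsWithin, hv', htend.eventually hu', hg, hev] with b h1 h2 h3 h4 h5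
        using ⟨h1, h2, h3, h4, h5⟩
    · rintro b ⟨h1, h2, h3, h4, h5⟩
      refine HasFDerivWithinAt.of_comp_of_leftInverse (h4.tendsto_nhdsWithin hmaps) (hG' _ h3)
        (hQ' _ h2) EventuallyEq.rfl (fun w => ?_) h1
      obtain ⟨e, he⟩ := h5
      have : ContinuousLinearMap.inverse (β.comp (G' (g b))) ((β.comp (G' (g b))) w) = w := by
        rw [← he, ContinuousLinearMap.inverse_equiv]
        exact e.symm_apply_apply w
      exact this
    · exact (hMinv.clm_comp contDiffWithinAt_const).clm_comp hQ'n

theorem contDiffWithinAt_of_comp_immersion {G : E → F} {s : Set E} {g : P → E}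
    {A : Set P} {a : P} (ha : a ∈ A) (hg : ∀ᶠ b in 𝓝[A] a, ContinuousWithinAt g A b)
    (hmaps : MapsTo g A s) (hG : ContDiffWithinAt ℝ ∞ G s (g a))
    (hu : UniqueDiffWithinAt ℝ s (g a)) (hinj : Function.Injective (fderivWithin ℝ G s (g a)))
    (hQ : ContDiffWithinAt ℝ ∞ (G ∘ g) A a) : ContDiffWithinAt ℝ ∞ g A a := by
  rw [contDiffWithinAt_infty] at *
  exact fun n => contDiffWithinAt_nat_of_comp_immersion n ha hg hmaps (hG n) hu hinj (hQ n)

variable {H : Type*} [TopologicalSpace H] {I : ModelWithCorners ℝ E H}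
  {M : Type*} [TopologicalSpace M] [ChartedSpace H M]
  {H' : Type*} [TopologicalSpace H'] {I' : ModelWithCorners ℝ F H'}
  {M' : Type*} [TopologicalSpace M'] [ChartedSpace H' M']
  {K : Type*} [TopologicalSpace K] {J : ModelWithCorners ℝ P K}
  {T : Type*} [TopologicalSpace T] [ChartedSpace K T]

/-- A continuous map whose composition with a smooth immersion is smooth is smooth. -/
theorem ContMDiffAt.of_comp_immersion {G : M → M'} {g : T → M} {t : T}
    (hg : ∀ᶠ t' in 𝓝 t, ContinuousAt g t')
    (hG : ContMDiffAt I I' ∞ G (g t)) (hinj : Function.Injective (mfderiv I I' G (g t)))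
    (hQ : ContMDiffAt J I' ∞ (G ∘ g) t) : ContMDiffAt J I ∞ g t := by
  have hg0 : ContinuousAt g t := hg.self_of_nhds
  have hmd : MDifferentiableAt I I' G (g t) := hG.mdifferentiableAt (by simp)
  rw [hmd.mfderiv] at hinj
  rw [contMDiffAt_iff] at hG hQ ⊢
  refine ⟨hg0, ?_⟩
  obtain ⟨hGc, hG⟩ := hG
  obtain ⟨hQc, hQ⟩ := hQ
  -- the set on which the coordinate expressions compose
  set ψ := extChartAt J t
  set φ := extChartAt I (g t)
  set χ := extChartAt I' (G (g t))
  have h1 : ∀ᶠ t' in 𝓝 t, g t' ∈ φ.source := hg0.eventually (extChartAt_source_mem_nhds (g t))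
  obtain ⟨O, hO, hOo, htO⟩ := eventually_nhds_iff.1 (h1.and (hg.and (extChartAt_source_mem_nhds (I := J) t)))
  set A : Set P := ψ.target ∩ ψ.symm ⁻¹' O
  have hA : A ∈ 𝓝[range J] (ψ t) := by
    refine inter_mem (extChartAt_target_mem_nhdsWithin t) ?_
    exact nhdsWithin_le_nhds (extChartAt_preimage_mem_nhds (hOo.mem_nhds htO))
  have htA : ψ t ∈ A := ⟨mem_extChartAt_target t, by
    simpa [ψ] using htO⟩
  have key : ContDiffWithinAt ℝ ∞ (φ ∘ g ∘ ψ.symm) A (ψ t) := by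
    have e : (φ ∘ g ∘ ψ.symm) (ψ t) = φ (g t) := by simp [ψ]
    refine contDiffWithinAt_of_comp_immersion (s := range I) (G := χ ∘ G ∘ φ.symm) htA ?_ ?_ ?_ ?_ ?_ ?_
    · refine eventually_nhdsWithin_of_forall fun b hb => ?_
      have hc : ContinuousAt g (ψ.symm b) := (hO _ hb.2).2.1
      have hc2 : ContinuousAt φ (g (ψ.symm b)) := (continuousOn_extChartAt (g t)).continuousAt
        ((isOpen_extChartAt_source (g t)).mem_nhds (hO _ hb.2).1)
      have hc3 : ContinuousWithinAt ψ.symm A b :=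
        ((continuousOn_extChartAt_symm t) b hb.1).mono inter_subset_left
      exact (ContinuousAt.comp (f := g) hc2 hc).comp_continuousWithinAt hc3
    · intro b hb
      exact extChartAt_target_subset_range (g t) (φ.map_source (hO _ hb.2).1)
    · rw [e]; exact hG
    · rw [e]; exact I.uniqueDiffOn _ (extChartAt_target_subset_range (g t) (mem_extChartAt_target _))
    · rw [e]; exact hinj
    · refine (hQ.mono_of_mem_nhdsWithin (nhdsWithin_mono _ ?_ self_mem_nhdsWithin : range J ∈ 𝓝[A] _)).congr_of_mem ?_ htA
      · exact fun b hb => extChartAt_target_subset_range t hb.1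
      · intro b hb
        have := (hO _ hb.2).1
        simp only [Function.comp_apply]
        rw [φ.left_inv this]
  exact key.mono_of_mem_nhdsWithin hA

omit [FiniteDimensional ℝ E] [FiniteDimensional ℝ F] in
/-- The map `(t, p) ↦ (t, k t p)` is an immersion if every `k t` is one. -/
theorem mfderiv_prodMk_fst_injective {k : T × M → M'} {t : T} {p : M}
    (hk : ContMDiffAt (J.prod I) I' ∞ k (t, p))
    (himm : Function.Injective (mfderiv I I' (fun p => k (t, p)) p)) :
    Function.Injective (mfderiv (J.prod I) (J.prod I') (fun q : T × M => (q.1, k q)) (t, p)) := by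
  have hkd : MDifferentiableAt (J.prod I) I' k (t, p) := hk.mdifferentiableAt (by simp)
  have e1 : mfderiv (J.prod I) (J.prod I') (fun q : T × M => (q.1, k q)) (t, p) =
      (mfderiv (J.prod I) J (Prod.fst : T × M → T) (t, p)).prod (mfderiv (J.prod I) I' k (t, p)) :=
    mfderiv_prodMk mdifferentiableAt_fst hkd
  have e2 : mfderiv I I' (fun p => k (t, p)) p =
      (mfderiv (J.prod I) I' k (t, p)).comp (mfderiv I (J.prod I) (fun p : M => (t, p)) p) :=
    mfderiv_comp p hkd (mdifferentiableAt_const.prodMk mdifferentiableAt_id)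
  rw [mfderiv_prod_right] at e2
  rw [mfderiv_fst] at e1
  refine (injective_iff_map_eq_zero
    (mfderiv (J.prod I) (J.prod I') (fun q : T × M => (q.1, k q)) (t, p))).2 ?_
  intro v h
  have h' := (congrArg (fun L => L v) e1).symm.trans h
  obtain ⟨h1, h2⟩ := Prod.mk.inj h'
  have hv : v = ((0 : TangentSpace J t), v.2) := Prod.ext h1 rfl
  have hw : v.2 = 0 := by
    refine (injective_iff_map_eq_zero (mfderiv I I' (fun p => k (t, p)) p)).1 himm v.2 ?_
    refine (congrArg (fun L => L v.2) e2).trans ?_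
    refine Eq.trans ?_ h2
    exact congrArg (mfderiv (J.prod I) I' k (t, p)) hv.symm
  exact Prod.ext h1 hw

/-- Adding the parameter as a coordinate makes `(t, p) ↦ (t, k (t, p))` an injective immersion of a
compact space, hence a closed embedding. So the set-theoretic solution `h` is continuous, and then
smooth by `ContMDiffAt.of_comp_immersion`. -/
theorem exists_contMDiff_family_comp_eq [CompactSpace T] [T2Space T] [CompactSpace M] [T2Space M']
    [FiniteDimensional ℝ P]
    {k k' : T × M → M'} (hk : ContMDiff (J.prod I) I' ∞ k) (hk' : ContMDiff (J.prod I) I' ∞ k')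
    (hinj : ∀ t, Function.Injective fun p => k (t, p))
    (himm : ∀ t p, Function.Injective (mfderiv I I' (fun p => k (t, p)) p))
    (hrange : ∀ t p, k' (t, p) ∈ range fun p => k (t, p)) :
    ∃ h : T × M → M, ContMDiff (J.prod I) I ∞ h ∧ ∀ t p, k (t, h (t, p)) = k' (t, p) := by
  choose h hh using hrange
  refine ⟨fun q => h q.1 q.2, ?_, hh⟩
  have hGs : ContMDiff (J.prod I) (J.prod I') ∞ (fun q : T × M => (q.1, k q)) :=
    contMDiff_fst.prodMk hk
  have hemb : IsClosedEmbedding (fun q : T × M => (q.1, k q)) := by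
    refine Continuous.isClosedEmbedding hGs.continuous ?_
    rintro ⟨t, p⟩ ⟨t', p'⟩ e
    obtain ⟨e1, e2⟩ := Prod.mk.inj e
    dsimp only at e1
    subst e1
    exact Prod.ext rfl (hinj t e2)
  have hcomp : (fun q : T × M => (q.1, k q)) ∘ (fun q : T × M => (q.1, h q.1 q.2)) =
      fun q => (q.1, k' q) := by
    funext ⟨t, p⟩
    exact Prod.ext rfl (hh t p)
  have hQ : ContMDiff (J.prod I) (J.prod I') ∞ (fun q : T × M => (q.1, k' q)) :=
    contMDiff_fst.prodMk hk'
  have hcont : Continuous (fun q : T × M => (q.1, h q.1 q.2)) := by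
    rw [hemb.isInducing.continuous_iff, hcomp]
    exact hQ.continuous
  have : ContMDiff (J.prod I) (J.prod I) ∞ (fun q : T × M => (q.1, h q.1 q.2)) := by
    intro q
    refine ContMDiffAt.of_comp_immersion (I' := J.prod I') (Eventually.of_forall fun _ => hcont.continuousAt) (hGs _)
      (mfderiv_prodMk_fst_injective (hk _) (himm _ _)) ?_
    rw [hcomp]
    exact hQ q
  exact contMDiff_snd.comp this

end ImmersionLifting

/-! ### Smooth families of embeddings over the unit interval -/

section Families

variable {F : Type*} [NormedAddCommGroup F] [NormedSpace ℝ F]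
  {H' : Type*} [TopologicalSpace H'] {I' : ModelWithCorners ℝ F H'}
  {M' : Type*} [TopologicalSpace M'] [ChartedSpace H' M']
  {E : Type*} [NormedAddCommGroup E] [NormedSpace ℝ E]
  {H : Type*} [TopologicalSpace H] {I : ModelWithCorners ℝ E H}
  {M : Type*} [TopologicalSpace M] [ChartedSpace H M]

/-- Families indexed by `ℝ` are controlled only on `[0,1]`. This passes to the interval as a compact
manifold with boundary; `ContMDiff.comp_projIcc` goes back by clamping the time. -/
theorem ContMDiffOn.comp_subtypeVal_Icc {k : ℝ × M → M'}
    (hk : ContMDiffOn (𝓘(ℝ, ℝ).prod I) I' ∞ k (Icc 0 1 ×ˢ univ)) :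
    ContMDiff ((𝓡∂ 1).prod I) I' ∞ (fun q : Icc (0 : ℝ) 1 × M => k (q.1, q.2)) := by
  rw [← contMDiffOn_univ]
  exact hk.comp (((contMDiff_subtypeVal_Icc.comp contMDiff_fst).prodMk
    contMDiff_snd).contMDiffOn) fun q _ => ⟨q.1.2, mem_univ _⟩

theorem ContMDiff.comp_projIcc {k : Icc (0 : ℝ) 1 × M → M'}
    (hk : ContMDiff ((𝓡∂ 1).prod I) I' ∞ k) :
    ContMDiffOn (𝓘(ℝ, ℝ).prod I) I' ∞ (fun q : ℝ × M => k (projIcc 0 1 zero_le_one q.1, q.2))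
      (Icc 0 1 ×ˢ univ) :=
  hk.comp_contMDiffOn (((contMDiffOn_projIcc (x := (0 : ℝ)) (y := 1)).comp contMDiffOn_fst
    fun _ hq => hq.1).prodMk contMDiffOn_snd)

variable [FiniteDimensional ℝ F] {S : Type*} [TopologicalSpace S]
  [ChartedSpace (EuclideanSpace ℝ (Fin 2)) S]

/-- Two smooth families of embeddings with the same images differ by a smooth family of
diffeomorphisms. -/
theorem exists_diffeo_family_comp_eq [CompactSpace S] [T2Space M'] {k k' : ℝ → S → M'}
    (hk : ContMDiffOn (𝓘(ℝ, ℝ).prod (𝓡 2)) I' ∞ (fun q : ℝ × S => k q.1 q.2) (Icc 0 1 ×ˢ univ))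
    (hk' : ContMDiffOn (𝓘(ℝ, ℝ).prod (𝓡 2)) I' ∞ (fun q : ℝ × S => k' q.1 q.2) (Icc 0 1 ×ˢ univ))
    (hinj : ∀ t ∈ Icc (0 : ℝ) 1, Function.Injective (k t))
    (hinj' : ∀ t ∈ Icc (0 : ℝ) 1, Function.Injective (k' t))
    (himm : ∀ t ∈ Icc (0 : ℝ) 1, ∀ p, Function.Injective (mfderiv (𝓡 2) I' (k t) p))
    (himm' : ∀ t ∈ Icc (0 : ℝ) 1, ∀ p, Function.Injective (mfderiv (𝓡 2) I' (k' t) p))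
    (hrange : ∀ t ∈ Icc (0 : ℝ) 1, range (k t) = range (k' t)) :
    ∃ h : ℝ → SurfaceDiffeo S, SmoothFamily (fun t p => h t p) ∧
      SmoothFamily (fun t p => (h t).symm p) ∧ ∀ t ∈ Icc (0 : ℝ) 1, ∀ p, k t (h t p) = k' t p := by
  have hs := hk.comp_subtypeVal_Icc
  have hs' := hk'.comp_subtypeVal_Icc
  obtain ⟨h, hh, hhk⟩ := exists_contMDiff_family_comp_eq hs hs' (fun t => hinj t t.2)
    (fun t p => himm t t.2 p) (fun t p => by
      change k' t p ∈ range (k t)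
      rw [hrange t t.2]
      exact mem_range_self p)
  obtain ⟨h', hh', hhk'⟩ := exists_contMDiff_family_comp_eq hs' hs (fun t => hinj' t t.2)
    (fun t p => himm' t t.2 p) (fun t p => by
      change k t p ∈ range (k' t)
      rw [← hrange t t.2]
      exact mem_range_self p)
  refine ⟨fun t => ⟨⟨fun p => h (projIcc 0 1 zero_le_one t, p),
    fun p => h' (projIcc 0 1 zero_le_one t, p), fun p => ?_, fun p => ?_⟩, ?_, ?_⟩, ?_, ?_, ?_⟩
  · exact hinj' _ (Subtype.coe_prop _) ((hhk' _ _).trans (hhk _ _))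
  · exact hinj _ (Subtype.coe_prop _) ((hhk _ _).trans (hhk' _ _))
  · exact hh.comp (contMDiff_const.prodMk contMDiff_id)
  · exact hh'.comp (contMDiff_const.prodMk contMDiff_id)
  · exact hh.comp_projIcc
  · exact hh'.comp_projIcc
  · intro t ht p
    change k t (h (projIcc 0 1 zero_le_one t, p)) = _
    rw [projIcc_of_mem zero_le_one ht]
    exact hhk ⟨t, ht⟩ p

end Families

end

noncomputable section
open Filter

/-! ### Inverse functions on convex sets and half spaces -/

section ConvexInverse

variable {E F : Type*} [NormedAddCommGroup E] [NormedSpace ℝ E] [CompleteSpace E]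
  [NormedAddCommGroup F] [NormedSpace ℝ F]

/-- Inverse function theorem for a map which is continuously differentiable on a convex set `C` that
is a `1`-Lipschitz retract of the ambient space. -/
theorem exists_openPartialHomeomorph_eqOn_convex {G : E → F} {D : E → E →L[ℝ] F} {G' : E ≃L[ℝ] F}
    {C : Set E} (hC : Convex ℝ C) {R : E → E} (hR : LipschitzWith 1 R) (hRC : ∀ x, R x ∈ C)
    (hRid : ∀ x ∈ C, R x = x) {x₀ : E} (hx₀ : x₀ ∈ C)
    (hD : ∀ᶠ x in 𝓝[C] x₀, HasFDerivWithinAt G (D x) C x) (hDc : ContinuousWithinAt D C x₀)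
    (hD0 : D x₀ = G') {u : Set E} (hu : u ∈ 𝓝 x₀) :
    ∃ r > 0, Metric.ball x₀ r ⊆ u ∧ ∃ e : OpenPartialHomeomorph E F,
      e.source = Metric.ball x₀ r ∧ ∀ x ∈ C ∩ Metric.ball x₀ r, e x = G x := by
  obtain ⟨c, hc0, hc⟩ : ∃ c : NNReal, 0 < c ∧
      (Subsingleton E ∨ c < ‖(G'.symm : F →L[ℝ] E)‖₊⁻¹) := by
    rcases G'.subsingleton_or_nnnorm_symm_pos with h | h
    · exact ⟨1, one_pos, Or.inl h⟩
    · exact ⟨_, half_pos (inv_pos.2 h), Or.inr (half_lt_self (inv_pos.2 h))⟩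
  have hclose : ∀ᶠ x in 𝓝[C] x₀, ‖D x - G'‖ ≤ c := by
    have := hDc.eventually (Metric.closedBall_mem_nhds (D x₀) (NNReal.coe_pos.2 hc0))
    filter_upwards [this] with x hx
    rw [← hD0, ← dist_eq_norm]
    exact hx
  obtain ⟨r, hr, hball⟩ := Metric.mem_nhds_iff.1
    (inter_mem hu (mem_nhdsWithin_iff_eventually.1 (hD.and hclose)))
  have hball' : ∀ x ∈ C ∩ Metric.ball x₀ r, HasFDerivWithinAt G (D x) C x ∧ ‖D x - G'‖ ≤ c :=
    fun x hx => (hball hx.2).2 hx.1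
  have hest : ∀ x ∈ C ∩ Metric.ball x₀ r, ∀ y ∈ C ∩ Metric.ball x₀ r,
      ‖G y - G x - (G' : E →L[ℝ] F) (y - x)‖ ≤ c * ‖y - x‖ := by
    intro x hx y hy
    exact (hC.inter (convex_ball _ _)).norm_image_sub_le_of_norm_hasFDerivWithin_le'
      (fun z hz => (hball' z hz).1.mono inter_subset_left) (fun z hz => (hball' z hz).2) hx hy
  have hRb : ∀ x ∈ Metric.ball x₀ r, R x ∈ C ∩ Metric.ball x₀ r := fun x hx => by
    refine ⟨hRC x, ?_⟩
    have := hR.dist_le_mul x x₀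
    rw [hRid x₀ hx₀] at this
    simp only [NNReal.coe_one, one_mul] at this
    exact lt_of_le_of_lt this hx
  -- Outside `C` the map `G` is replaced by `G' x + (G - G') (R x)`, which is `G` on `C`. As `R` is
  -- 1-Lipschitz and preserves the ball, the perturbation of `G'` keeps the Lipschitz constant `c`
  -- that it has on `C`.
  have happ : ApproximatesLinearOn (fun x => G' x + (G (R x) - G' (R x))) (G' : E →L[ℝ] F)
      (Metric.ball x₀ r) c := by
    intro x hx y hy
    have h1 := hest _ (hRb y hy) _ (hRb x hx)
    have h2 := hR.dist_le_mul x y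
    simp only [NNReal.coe_one, one_mul, dist_eq_norm] at h2
    refine le_trans (le_of_eq ?_) (h1.trans (mul_le_mul_of_nonneg_left h2 c.2))
    congr 1
    simp only [ContinuousLinearEquiv.coe_coe, map_sub]
    abel
  refine ⟨r, hr, fun x hx => (hball hx).1, happ.toOpenPartialHomeomorph _ _ hc Metric.isOpen_ball,
    rfl, ?_⟩
  intro x hx
  change G' x + (G (R x) - G' (R x)) = G x
  rw [hRid x hx.1]
  abel

omit [CompleteSpace E] in
theorem tendsto_add_smul_nhdsGT_zero (x v : E) :
    Tendsto (fun ε : ℝ => x + ε • v) (𝓝[>] 0) (𝓝 x) := by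
  have : Continuous fun ε : ℝ => x + ε • v := by fun_prop
  simpa using (this.tendsto 0).mono_left nhdsWithin_le_nhds

omit [CompleteSpace E] in
/-- A local homeomorphism that maps the boundary of the half space `0 ≤ α` to the boundary of the
half space `0 ≤ β` and its interior to the interior is locally onto the half space `0 ≤ β`. -/
theorem exists_isOpen_forall_symm_nonneg {α : E →L[ℝ] ℝ} {β : F →L[ℝ] ℝ} (hα : α ≠ 0) (hβ : β ≠ 0)
    (e : OpenPartialHomeomorph E F) {x₀ : E} (hx₀ : x₀ ∈ e.source) (hα0 : 0 ≤ α x₀)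
    (hpos : ∀ x ∈ e.source, 0 < α x → 0 < β (e x)) (hzero : ∀ x ∈ e.source, α x = 0 → β (e x) = 0) :
    ∃ W, IsOpen W ∧ e x₀ ∈ W ∧ W ⊆ e.target ∧ ∀ y ∈ W, 0 ≤ β y → 0 ≤ α (e.symm y) := by
  obtain ⟨δ, hδ, hball⟩ := Metric.mem_nhds_iff.1 (e.open_target.mem_nhds (e.map_source hx₀))
  refine ⟨Metric.ball (e x₀) δ, Metric.isOpen_ball, Metric.mem_ball_self hδ, hball, ?_⟩
  obtain ⟨v, hv⟩ : ∃ v, 0 < α v := by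
    obtain ⟨v, hv⟩ := DFunLike.ne_iff.1 hα
    rcases lt_or_gt_of_ne hv with h | h
    · exact ⟨-v, by simpa using h⟩
    · exact ⟨v, h⟩
  obtain ⟨w, hw⟩ : ∃ v, 0 < β v := by
    obtain ⟨v, hv⟩ := DFunLike.ne_iff.1 hβ
    rcases lt_or_gt_of_ne hv with h | h
    · exact ⟨-v, by simpa using h⟩
    · exact ⟨v, h⟩
  -- The open half ball is connected and `α ∘ e.symm` has no zero on it, so its sign there is
  -- constant. The sign is positive because `e` maps points `x₀ + ε • v` into the half ball.
  set C := Metric.ball (e x₀) δ ∩ {y | 0 < β y}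
  have hCconn : IsPreconnected C :=
    ((convex_ball _ _).inter (convex_halfSpace_gt β.isLinear 0)).isPreconnected
  have hcont : ContinuousOn (fun y => α (e.symm y)) (Metric.ball (e x₀) δ) :=
    α.continuous.comp_continuousOn (e.continuousOn_symm.mono hball)
  have hopen1 : IsOpen (Metric.ball (e x₀) δ ∩ (fun y => α (e.symm y)) ⁻¹' Ioi 0) :=
    hcont.isOpen_inter_preimage Metric.isOpen_ball isOpen_Ioi
  have hopen2 : IsOpen (Metric.ball (e x₀) δ ∩ (fun y => α (e.symm y)) ⁻¹' Iio 0) :=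
    hcont.isOpen_inter_preimage Metric.isOpen_ball isOpen_Iio
  have hsub : C ⊆ Metric.ball (e x₀) δ ∩ (fun y => α (e.symm y)) ⁻¹' Ioi 0 := by
    refine hCconn.subset_left_of_subset_union hopen1 hopen2 ?_ ?_ ?_
    · rw [Set.disjoint_left]
      rintro y ⟨-, h1⟩ ⟨-, h2⟩
      rw [mem_preimage, mem_Ioi] at h1
      rw [mem_preimage, mem_Iio] at h2
      exact lt_asymm h1 h2
    · rintro y ⟨hy, hy0⟩
      rcases lt_trichotomy (α (e.symm y)) 0 with h | h | h
      · exact Or.inr ⟨hy, h⟩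
      · have := hzero _ (e.map_target (hball hy)) h
        rw [e.right_inv (hball hy)] at this
        exact absurd this (ne_of_gt hy0)
      · exact Or.inl ⟨hy, h⟩
    · have h1 : ∀ᶠ x in 𝓝 x₀, x ∈ e.source ∧ e x ∈ Metric.ball (e x₀) δ :=
        (e.open_source.eventually_mem hx₀).and
          ((e.continuousAt hx₀).eventually (Metric.isOpen_ball.mem_nhds (Metric.mem_ball_self hδ)))
      obtain ⟨ε, ⟨h2, h3⟩, hε⟩ := (((tendsto_add_smul_nhdsGT_zero x₀ v).eventually h1).and self_mem_nhdsWithin).exists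
      have hε' : (0 : ℝ) < ε := hε
      have h4 : 0 < α (x₀ + ε • v) := by
        rw [map_add, map_smul, smul_eq_mul]
        positivity
      refine ⟨e (x₀ + ε • v), ⟨h3, hpos _ h2 h4⟩, h3, ?_⟩
      change 0 < α (e.symm (e _))
      rwa [e.left_inv h2]
  -- A point with `β y = 0` is the limit of the points `y + ε • w` in the open half ball, and the
  -- inequality passes to the limit.
  intro y hy hy0
  have hc : ContinuousAt (fun y => α (e.symm y)) y :=
    hcont.continuousAt (Metric.isOpen_ball.mem_nhds hy)
  refine ge_of_tendsto (hc.tendsto.comp (tendsto_add_smul_nhdsGT_zero y w)) ?_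
  filter_upwards [(tendsto_add_smul_nhdsGT_zero y w).eventually (Metric.isOpen_ball.mem_nhds hy), self_mem_nhdsWithin]
    with ε h1 h2
  have h2' : (0 : ℝ) < ε := h2
  refine le_of_lt (hsub ⟨h1, ?_⟩).2
  change 0 < β (y + ε • w)
  rw [map_add, map_smul, smul_eq_mul]
  positivity

end ConvexInverse

/-! ### The half space and the boundary in coordinates -/

section HalfSpace

/-- The retraction of Euclidean space onto a closed half space. -/
def halfSpaceRetraction (n : ℕ) [NeZero n] (x : EuclideanSpace ℝ (Fin n)) :
    EuclideanSpace ℝ (Fin n) :=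
  WithLp.toLp 2 (Function.update x.ofLp 0 (max (x 0) 0))

theorem halfSpaceRetraction_zero {n : ℕ} [NeZero n] (x : EuclideanSpace ℝ (Fin n)) :
    halfSpaceRetraction n x 0 = max (x 0) 0 := by
  simp [halfSpaceRetraction]

theorem halfSpaceRetraction_eq_self {n : ℕ} [NeZero n] {x : EuclideanSpace ℝ (Fin n)}
    (hx : 0 ≤ x 0) : halfSpaceRetraction n x = x := by
  ext i
  rcases eq_or_ne i 0 with rfl | hi
  · simp [halfSpaceRetraction, hx]
  · simp [halfSpaceRetraction, hi]

theorem lipschitzWith_halfSpaceRetraction (n : ℕ) [NeZero n] :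
    LipschitzWith 1 (halfSpaceRetraction n) := by
  refine LipschitzWith.of_dist_le_mul fun x y => ?_
  rw [NNReal.coe_one, one_mul, EuclideanSpace.dist_eq, EuclideanSpace.dist_eq]
  refine Real.sqrt_le_sqrt (Finset.sum_le_sum fun i _ => ?_)
  gcongr
  rcases eq_or_ne i 0 with rfl | hi
  · simp only [halfSpaceRetraction, Function.update_self, Real.dist_eq]
    exact abs_max_sub_max_le_abs _ _ _
  · simp [halfSpaceRetraction, hi]

variable {n : ℕ} [NeZero n] {M : Type*} [TopologicalSpace M] [ChartedSpace (EuclideanHalfSpace n) M]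
  [IsManifold (𝓡∂ n) ∞ M]

/-- Whether `q` is interior can be tested in the chart at `p`, by smooth invariance of the interior;
there, the interior of the half space is `0 < x 0`. -/
theorem mem_boundary_iff_extChartAt_zero {p q : M} (hq : q ∈ (extChartAt (𝓡∂ n) p).source) :
    q ∈ (𝓡∂ n).boundary M ↔ extChartAt (𝓡∂ n) p q 0 = 0 := by
  have hq' : q ∈ (chartAt (EuclideanHalfSpace n) p).source := by rwa [extChartAt_source] at hq
  have hr : extChartAt (𝓡∂ n) p q ∈ range (𝓡∂ n) :=
    extChartAt_target_subset_range p ((extChartAt (𝓡∂ n) p).map_source hq)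
  have h := (𝓡∂ n).isInteriorPoint_iff_of_mem_atlas (n := ∞) (by simp)
    (chart_mem_atlas (EuclideanHalfSpace n) p) hq'
  have h2 : q ∈ (𝓡∂ n).boundary M ↔ ¬ (𝓡∂ n).IsInteriorPoint q :=
    (𝓡∂ n).isBoundaryPoint_iff_not_isInteriorPoint q
  have h3 : extChartAt (𝓡∂ n) p q ∈ interior (extChartAt (𝓡∂ n) p).target ↔
      extChartAt (𝓡∂ n) p q ∈ interior (range (𝓡∂ n)) := by
    refine ⟨fun h => OpenPartialHomeomorph.interior_extend_target_subset_interior_range _ h,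
      fun h => ?_⟩
    exact (chartAt (EuclideanHalfSpace n) p).mem_interior_extend_target
      ((chartAt (EuclideanHalfSpace n) p).map_source hq') h
  rw [h2, h]
  change ¬ (extChartAt (𝓡∂ n) p q ∈ interior (extChartAt (𝓡∂ n) p).target) ↔ _
  rw [h3, interior_range_modelWithCornersEuclideanHalfSpace]
  rw [range_modelWithCornersEuclideanHalfSpace] at hr
  have hr' : 0 ≤ extChartAt (𝓡∂ n) p q 0 := hr
  simp only [mem_ofPred_eq, not_lt]
  exact ⟨fun h => le_antisymm h hr', fun h => h.le⟩

end HalfSpace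

/-! ### The inverse function theorem for `(f, l)`, including boundary points -/

section LocalProduct

variable {X B : Type*} [TopologicalSpace X] [ChartedSpace (EuclideanHalfSpace 4) X]
  [IsManifold (𝓡∂ 4) ∞ X]
  [TopologicalSpace B] [ChartedSpace (EuclideanHalfSpace 2) B] [IsManifold (𝓡∂ 2) ∞ B]

local notation "E2" => EuclideanSpace ℝ (Fin 2)
local notation "E4" => EuclideanSpace ℝ (Fin 4)

/-- Let `f : X → B` be smooth with `∂X = f⁻¹(∂B)`. If the differential of `(f, l) : X → B × ℝ²` is
injective at `x₀`, then `(f, l)` has a smooth inverse near `x₀`, even if `x₀` is a boundary point. -/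
theorem exists_localInverse_prodMk {f : X → B} (hf : ContMDiff (𝓡∂ 4) (𝓡∂ 2) ∞ f)
    (hbd : (𝓡∂ 4).boundary X = f ⁻¹' (𝓡∂ 2).boundary B) {x₀ : X} {l : X → E2} {O : Set X}
    (hO : O ∈ 𝓝 x₀) (hl : ContMDiffOn (𝓡∂ 4) (𝓡 2) ∞ l O)
    (hinj : ∀ v : TangentSpace (𝓡∂ 4) x₀, mfderiv (𝓡∂ 4) (𝓡∂ 2) f x₀ v = 0 →
      mfderiv (𝓡∂ 4) (𝓡 2) l x₀ v = 0 → v = 0) :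
    ∃ (U : Set X) (W : Set (B × E2)) (g : B × E2 → X), IsOpen U ∧ x₀ ∈ U ∧ U ⊆ O ∧ IsOpen W ∧
      (∀ x ∈ U, (f x, l x) ∈ W ∧ g (f x, l x) = x) ∧
      (∀ w ∈ W, g w ∈ U ∧ f (g w) = w.1 ∧ l (g w) = w.2) ∧
      ContMDiffOn ((𝓡∂ 2).prod (𝓡 2)) (𝓡∂ 4) ∞ g W := by
  have hlx : ContMDiffAt (𝓡∂ 4) (𝓡 2) ∞ l x₀ := hl.contMDiffAt hO
  set φ := extChartAt (𝓡∂ 4) x₀ with hφ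
  set ψ := extChartAt (𝓡∂ 2) (f x₀) with hψ
  set G : E4 → E2 × E2 := fun v => (ψ (f (φ.symm v)), l (φ.symm v)) with hG
  set C : Set E4 := range (𝓡∂ 4) with hCdef
  have hC : C = {x | 0 ≤ x 0} := range_modelWithCornersEuclideanHalfSpace 4
  have hG1 : ContDiffWithinAt ℝ ∞ (fun v => ψ (f (φ.symm v))) C (φ x₀) :=
    (contMDiffAt_iff.1 (hf x₀)).2
  have hG2 : ContDiffWithinAt ℝ ∞ (fun v => l (φ.symm v)) C (φ x₀) :=
    (contMDiffAt_iff.1 hlx).2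
  have hGs : ContDiffWithinAt ℝ ((0 : ℕ) + 1) G C (φ x₀) :=
    (hG1.prodMk hG2).of_le (by norm_cast)
  have hmem : φ x₀ ∈ C := extChartAt_target_subset_range x₀ (mem_extChartAt_target x₀)
  have huniq : UniqueDiffWithinAt ℝ C (φ x₀) := (𝓡∂ 4).uniqueDiffOn _ hmem
  obtain ⟨u, hu, -, -, D, hD, hDc⟩ :=
    (contDiffWithinAt_succ_iff_hasFDerivWithinAt' (by simp)).1 hGs
  rw [insert_eq_of_mem hmem] at hu
  have hDeq : D (φ x₀) = (fderivWithin ℝ (fun v => ψ (f (φ.symm v))) C (φ x₀)).prod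
      (fderivWithin ℝ (fun v => l (φ.symm v)) C (φ x₀)) := by
    refine huniq.eq (hD _ (mem_of_mem_nhdsWithin hmem hu)) ?_
    exact (hG1.differentiableWithinAt (by simp)).hasFDerivWithinAt.prodMk
      (hG2.differentiableWithinAt (by simp)).hasFDerivWithinAt
  have hDinj : Function.Injective (D (φ x₀)) := by
    rw [injective_iff_map_eq_zero]
    intro v hv
    rw [hDeq] at hv
    obtain ⟨h1, h2⟩ := Prod.mk.inj hv
    refine hinj v ?_ ?_
    · rw [((hf x₀).mdifferentiableAt (by simp)).mfderiv]
      exact h1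
    · rw [(hlx.mdifferentiableAt (by simp)).mfderiv]
      exact h2
  have hrank : Module.finrank ℝ E4 = Module.finrank ℝ (E2 × E2) := by simp
  let G' : E4 ≃L[ℝ] E2 × E2 :=
    (LinearEquiv.ofInjectiveOfFinrankEq (D (φ x₀) : E4 →ₗ[ℝ] E2 × E2) hDinj hrank).toContinuousLinearEquiv
  have hG' : D (φ x₀) = (G' : E4 →L[ℝ] E2 × E2) := by
    exact ContinuousLinearMap.ext fun v => rfl
  have hφc : ContinuousWithinAt φ.symm C (φ x₀) := (continuousAt_extChartAt_symm x₀).continuousWithinAt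
  have hsymm : φ.symm (φ x₀) = x₀ := extChartAt_to_inv x₀
  have hev : ∀ᶠ v in 𝓝[C] (φ x₀), v ∈ φ.target ∧ φ.symm v ∈ interior O ∧
      f (φ.symm v) ∈ ψ.source ∧ HasFDerivWithinAt G (D v) C v ∧ (D v).IsInvertible := by
    have h1 : ∀ᶠ v in 𝓝[C] (φ x₀), φ.symm v ∈ interior O :=
      hφc.eventually (by rw [hsymm]; exact isOpen_interior.mem_nhds (mem_interior_iff_mem_nhds.2 hO))
    have h2 : ∀ᶠ v in 𝓝[C] (φ x₀), f (φ.symm v) ∈ ψ.source :=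
      hφc.eventually (by
        rw [hsymm]
        exact hf.continuous.continuousAt.eventually (extChartAt_source_mem_nhds (I := 𝓡∂ 2) (f x₀)))
    have h3 : ∀ᶠ v in 𝓝[C] (φ x₀), (D v).IsInvertible :=
      hDc.continuousWithinAt.eventually (by rw [hG']; exact G'.nhds)
    filter_upwards [extChartAt_target_mem_nhdsWithin x₀, h1, h2, hu, h3] with v k1 k2 k3 k4 k5
      using ⟨k1, k2, k3, hD v k4, k5⟩
  obtain ⟨u', hu'o, hu'x, hu'⟩ := mem_nhdsWithin.1 hev
  -- Since `C` is a half space, possibly with `φ x₀` on its boundary, the inverse is sought for an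
  -- extension `e` of `G` beyond `C`; `e` is only a homeomorphism and equals `G` only on `C`.
  obtain ⟨r, hr, hball, e, hes, he⟩ := exists_openPartialHomeomorph_eqOn_convex (G := G) (D := D)
    (G' := G') (C := C) (by rw [hC]; exact convex_halfSpace_ge (EuclideanSpace.proj (𝕜 := ℝ) (0 : Fin 4)).isLinear 0)
    (lipschitzWith_halfSpaceRetraction 4)
    (fun x => by
      rw [hC, mem_ofPred_eq, halfSpaceRetraction_zero]
      exact le_max_right _ _)
    (fun x hx => by
      rw [hC] at hx
      exact halfSpaceRetraction_eq_self hx) hmem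
    (hev.mono fun v hv => hv.2.2.2.1) hDc.continuousWithinAt hG' (hu'o.mem_nhds hu'x)
  have hQ : ∀ v ∈ C ∩ Metric.ball (φ x₀) r, v ∈ φ.target ∧ φ.symm v ∈ interior O ∧
      f (φ.symm v) ∈ ψ.source ∧ HasFDerivWithinAt G (D v) C v ∧ (D v).IsInvertible :=
    fun v hv => hu' ⟨hball hv.2, hv.1⟩
  let α : E4 →L[ℝ] ℝ := EuclideanSpace.proj 0
  let β : E2 × E2 →L[ℝ] ℝ := (EuclideanSpace.proj 0).comp (ContinuousLinearMap.fst ℝ E2 E2)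
  have hα : ∀ x, α x = x 0 := fun _ => rfl
  have hβ : ∀ y, β y = y.1 0 := fun _ => rfl
  have hα0 : α ≠ 0 := fun h => by
    have := congrArg (fun L => L (EuclideanSpace.single 0 1)) h
    simp [α] at this
  have hβ0 : β ≠ 0 := fun h => by
    have := congrArg (fun L => L (EuclideanSpace.single 0 1, 0)) h
    simp [β] at this
  have hβnn : ∀ b ∈ ψ.source, 0 ≤ ψ b 0 := fun b hb => by
    have : ψ b ∈ range (𝓡∂ 2) := extChartAt_target_subset_range (f x₀) (ψ.map_source hb)
    rw [range_modelWithCornersEuclideanHalfSpace] at this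
    exact this
  -- This is the hypothesis `∂X = f⁻¹(∂B)` in coordinates.
  have hiff : ∀ v ∈ C ∩ Metric.ball (φ x₀) r, (β (e v) = 0 ↔ α v = 0) := by
    intro v hv
    obtain ⟨k1, k2, k3, -, -⟩ := hQ v hv
    have h1 := mem_boundary_iff_extChartAt_zero (p := x₀) (φ.map_target k1)
    have h2 := mem_boundary_iff_extChartAt_zero (p := f x₀) k3
    rw [← hφ, φ.right_inv k1] at h1
    rw [he v hv, hα, ← h1, hbd]
    exact h2.symm
  -- The inverse `e.symm` is meaningful only where it takes values in `C`; matching boundaries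
  -- ensure this on the half space `0 ≤ β` near `e (φ x₀)`.
  obtain ⟨W', hW'o, hW'x, hW't, hW'⟩ := exists_isOpen_forall_symm_nonneg hα0 hβ0 e (x₀ := φ x₀)
    (by rw [hes]; exact Metric.mem_ball_self hr) (by rw [hC] at hmem; exact hmem)
    (fun x hx hx0 => by
      rw [hes] at hx
      have hxC : x ∈ C := by rw [hC]; exact le_of_lt (show 0 < x 0 from hx0)
      refine lt_of_le_of_ne ?_ fun h0 => hx0.ne' ((hiff x ⟨hxC, hx⟩).1 h0.symm)
      rw [he x ⟨hxC, hx⟩]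
      exact hβnn _ (hQ x ⟨hxC, hx⟩).2.2.1)
    (fun x hx hx0 => by
      rw [hes] at hx
      have hxC : x ∈ C := by rw [hC]; exact le_of_eq (show 0 = x 0 from hx0.symm)
      exact (hiff x ⟨hxC, hx⟩).2 hx0)
  have hsymmC : ∀ y ∈ W', 0 ≤ β y → e.symm y ∈ C ∩ Metric.ball (φ x₀) r := by
    intro y hy hy0
    refine ⟨?_, ?_⟩
    · rw [hC]
      exact hW' y hy hy0
    · rw [← hes]
      exact e.map_target (hW't hy)
  have hGe : ∀ y ∈ W', 0 ≤ β y → G (e.symm y) = y := by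
    intro y hy hy0
    rw [← he _ (hsymmC y hy hy0), e.right_inv (hW't hy)]
  set W : Set (B × E2) := {w | w.1 ∈ ψ.source ∧ (ψ w.1, w.2) ∈ W'} with hWdef
  have hψc : ContinuousOn (fun w : B × E2 => (ψ w.1, w.2)) (ψ.source ×ˢ univ) :=
    ((continuousOn_extChartAt (f x₀)).comp continuousOn_fst fun w hw => hw.1).prodMk continuousOn_snd
  have hWo : IsOpen W := by
    have := hψc.isOpen_inter_preimage ((isOpen_extChartAt_source (f x₀)).prod isOpen_univ) hW'o
    convert this using 1
    ext w
    simp [hWdef, hψ]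
  have hlc : ContinuousOn (fun x => (f x, l x)) (interior O) :=
    hf.continuous.continuousOn.prodMk (hl.continuousOn.mono interior_subset)
  set U : Set X := (φ.source ∩ φ ⁻¹' Metric.ball (φ x₀) r) ∩
    (interior O ∩ (fun x => (f x, l x)) ⁻¹' W) with hUdef
  have hUo : IsOpen U :=
    ((continuousOn_extChartAt x₀).isOpen_inter_preimage (isOpen_extChartAt_source x₀)
      Metric.isOpen_ball).inter (hlc.isOpen_inter_preimage isOpen_interior hWo)
  have hφC : ∀ x ∈ φ.source, φ x ∈ C := fun x hx =>
    extChartAt_target_subset_range x₀ (φ.map_source hx)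
  have hx₀U : x₀ ∈ U := by
    refine ⟨⟨mem_extChartAt_source x₀, Metric.mem_ball_self hr⟩, mem_interior_iff_mem_nhds.2 hO,
      mem_extChartAt_source (f x₀), ?_⟩
    have := he (φ x₀) ⟨hmem, Metric.mem_ball_self hr⟩
    rw [this, hG] at hW'x
    simpa only [hsymm] using hW'x
  refine ⟨U, W, fun w => φ.symm (e.symm (ψ w.1, w.2)), hUo, hx₀U,
    fun x hx => interior_subset hx.2.1, hWo, ?_, ?_, ?_⟩
  · rintro x ⟨⟨h1, h2⟩, h3, h4⟩
    refine ⟨h4, ?_⟩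
    have hGx : e (φ x) = (ψ (f x), l x) := by
      rw [he _ ⟨hφC x h1, h2⟩, hG]
      simp only [φ.left_inv h1]
    change φ.symm (e.symm (ψ (f x), l x)) = x
    rw [← hGx, e.left_inv (by rw [hes]; exact h2), φ.left_inv h1]
  · rintro w ⟨h1, h2⟩
    have hnn : 0 ≤ β (ψ w.1, w.2) := hβnn _ h1
    have hv := hsymmC _ h2 hnn
    have hGv := hGe _ h2 hnn
    obtain ⟨k1, k2, k3, -, -⟩ := hQ _ hv
    obtain ⟨e1, e2⟩ := Prod.mk.inj hGv
    have e3 : f (φ.symm (e.symm (ψ w.1, w.2))) = w.1 := ψ.injOn k3 h1 e1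
    refine ⟨⟨⟨φ.map_target k1, ?_⟩, k2, ?_⟩, e3, e2⟩
    · rw [mem_preimage, φ.right_inv k1]
      exact hv.2
    · rw [mem_preimage, e3, e2]
      exact ⟨h1, h2⟩
  · have hGon : ContDiffOn ℝ ∞ G (C ∩ Metric.ball (φ x₀) r) := by
      rw [← contMDiffOn_iff_contDiffOn]
      have a1 : ContMDiffOn 𝓘(ℝ, E4) (𝓡∂ 4) ∞ φ.symm (C ∩ Metric.ball (φ x₀) r) :=
        (contMDiffOn_extChartAt_symm x₀).mono fun v hv => (hQ v hv).1
      have a2 := (contMDiffOn_extChartAt (I := 𝓡∂ 2) (n := ∞) (x := f x₀)).comp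
        (hf.comp_contMDiffOn a1) (fun v hv => by
          have := (hQ v hv).2.2.1
          rwa [hψ, extChartAt_source] at this)
      have a3 := (hl.mono interior_subset).comp a1 fun v hv => (hQ v hv).2.1
      exact a2.prodMk_space a3
    -- The extension yields no differentiability of `e.symm`. On the half space, however, `G ∘
    -- e.symm` is the identity and `G` is an immersion, so `e.symm` is smooth there.
    have hgv : ContDiffOn ℝ ∞ e.symm (W' ∩ {y | 0 ≤ β y}) := by
      intro y hy
      have hy' := hsymmC y hy.1 hy.2
      have hcont : ContinuousOn e.symm (W' ∩ {y | 0 ≤ β y}) :=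
        e.continuousOn_symm.mono fun z hz => hW't hz.1
      refine contDiffWithinAt_of_comp_immersion (G := G) (s := C) hy
        (eventually_nhdsWithin_of_forall hcont) (fun z hz => (hsymmC z hz.1 hz.2).1) ?_
        ((𝓡∂ 4).uniqueDiffOn _ hy'.1) ?_ ?_
      · exact (hGon _ hy').mono_of_mem_nhdsWithin
          (inter_mem self_mem_nhdsWithin (nhdsWithin_le_nhds (Metric.isOpen_ball.mem_nhds hy'.2)))
      · rw [((hQ _ hy').2.2.2.1).fderivWithin ((𝓡∂ 4).uniqueDiffOn _ hy'.1)]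
        exact (hQ _ hy').2.2.2.2.injective
      · exact contDiffWithinAt_id.congr_of_mem (fun z hz => hGe z hz.1 hz.2) hy
    have b1 : ContMDiffOn ((𝓡∂ 2).prod (𝓡 2)) 𝓘(ℝ, E2 × E2) ∞
        (fun w : B × E2 => (ψ w.1, w.2)) W := by
      refine ContMDiffOn.prodMk_space ?_ contMDiffOn_snd
      refine (contMDiffOn_extChartAt (I := 𝓡∂ 2) (n := ∞) (x := f x₀)).comp contMDiffOn_fst ?_
      intro w hw
      have := hw.1
      rwa [hψ, extChartAt_source] at this
    have b2 := (contMDiffOn_iff_contDiffOn.2 hgv).comp b1 fun w hw => ⟨hw.2, hβnn _ hw.1⟩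
    refine (contMDiffOn_extChartAt_symm x₀).comp b2 fun w hw => ?_
    exact (hQ _ (hsymmC _ hw.2 (hβnn _ hw.1))).1

end LocalProduct

end

noncomputable section
open Filter

/-! ### Charts in which the fibration is a projection -/

section FiberCharts

variable {X B : Type*} [TopologicalSpace X] [ChartedSpace (EuclideanHalfSpace 4) X]
  [TopologicalSpace B] [ChartedSpace (EuclideanHalfSpace 2) B]

local notation "E2" => EuclideanSpace ℝ (Fin 2)
local notation "E4" => EuclideanSpace ℝ (Fin 4)

/-- A chart of `X` in which `f : X → B` becomes the projection `B × ℝ² → B`. -/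
structure FiberChart (f : X → B) where
  source : Set X
  target : Set (B × E2)
  coord : X → E2
  inv : B × E2 → X
  isOpen_source : IsOpen source
  isOpen_target : IsOpen target
  smooth_coord : ContMDiffOn (𝓡∂ 4) (𝓡 2) ∞ coord source
  smooth_inv : ContMDiffOn ((𝓡∂ 2).prod (𝓡 2)) (𝓡∂ 4) ∞ inv target
  map_source : ∀ x ∈ source, (f x, coord x) ∈ target
  left_inv : ∀ x ∈ source, inv (f x, coord x) = x
  map_target : ∀ w ∈ target, inv w ∈ source
  apply_inv : ∀ w ∈ target, f (inv w) = w.1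
  coord_inv : ∀ w ∈ target, coord (inv w) = w.2

theorem FiberChart.eq_of_eq {f : X → B} (c : FiberChart f) {x x' : X} (hx : x ∈ c.source)
    (hx' : x' ∈ c.source) (h : f x = f x') (h' : c.coord x = c.coord x') : x = x' := by
  rw [← c.left_inv x hx, h, h', c.left_inv x' hx']

variable [IsManifold (𝓡∂ 4) ∞ X] [IsManifold (𝓡∂ 2) ∞ B]

theorem exists_fiberChart_of_injective {f : X → B} (hf : ContMDiff (𝓡∂ 4) (𝓡∂ 2) ∞ f)
    (hbd : (𝓡∂ 4).boundary X = f ⁻¹' (𝓡∂ 2).boundary B) {x₀ : X} {l : X → E2} {O : Set X}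
    (hO : O ∈ 𝓝 x₀) (hl : ContMDiffOn (𝓡∂ 4) (𝓡 2) ∞ l O)
    (hinj : ∀ v : TangentSpace (𝓡∂ 4) x₀, mfderiv (𝓡∂ 4) (𝓡∂ 2) f x₀ v = 0 →
      mfderiv (𝓡∂ 4) (𝓡 2) l x₀ v = 0 → v = 0) :
    ∃ c : FiberChart f, x₀ ∈ c.source ∧ c.source ⊆ O ∧ c.coord = l := by
  obtain ⟨U, W, g, h1, h2, h3, h4, h5, h6, h7⟩ := exists_localInverse_prodMk hf hbd hO hl hinj
  exact ⟨⟨U, W, l, g, h1, h4, hl.mono h3, h7, fun x hx => (h5 x hx).1, fun x hx => (h5 x hx).2,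
    fun w hw => (h6 w hw).1, fun w hw => (h6 w hw).2.1, fun w hw => (h6 w hw).2.2⟩, h2, h3, rfl⟩

omit [TopologicalSpace X] [ChartedSpace (EuclideanHalfSpace 4) X] [TopologicalSpace B]
  [ChartedSpace (EuclideanHalfSpace 2) B] [IsManifold (𝓡∂ 4) ∞ X] [IsManifold (𝓡∂ 2) ∞ B] in
-- `L` is a projection onto the two-dimensional kernel of `A`, followed by an isomorphism with `ℝ²`.
theorem exists_linearMap_injective_on_ker (A : E4 →L[ℝ] E2) (hA : Function.Surjective A) :
    ∃ L : E4 →L[ℝ] E2, ∀ v, A v = 0 → L v = 0 → v = 0 := by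
  have hrank : Module.finrank ℝ (LinearMap.ker (A : E4 →ₗ[ℝ] E2)) = Module.finrank ℝ E2 := by
    have h1 := LinearMap.finrank_range_add_finrank_ker (A : E4 →ₗ[ℝ] E2)
    rw [LinearMap.range_eq_top.2 hA, finrank_top] at h1
    simp only [finrank_euclideanSpace, Fintype.card_fin] at h1 ⊢
    omega
  obtain ⟨s, hs⟩ := LinearMap.exists_leftInverse_of_injective
    (LinearMap.ker (A : E4 →ₗ[ℝ] E2)).subtype (Submodule.ker_subtype _)
  refine ⟨LinearMap.toContinuousLinearMap
    ((LinearEquiv.ofFinrankEq _ _ hrank).toLinearMap ∘ₗ s), fun v hv hL => ?_⟩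
  have h1 : s v = 0 := (LinearEquiv.ofFinrankEq _ _ hrank).map_eq_zero_iff.1 hL
  have h2 : s v = ⟨v, hv⟩ := congrArg (fun l => l ⟨v, hv⟩) hs
  rw [h2] at h1
  exact congrArg Subtype.val h1

/-- A Lefschetz fibration is a product near every regular point. -/
theorem exists_fiberChart {f : X → B} (hf : ContMDiff (𝓡∂ 4) (𝓡∂ 2) ∞ f)
    (hbd : (𝓡∂ 4).boundary X = f ⁻¹' (𝓡∂ 2).boundary B) {x₀ : X}
    (hreg : Function.Surjective (mfderiv (𝓡∂ 4) (𝓡∂ 2) f x₀)) :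
    ∃ c : FiberChart f, x₀ ∈ c.source := by
  obtain ⟨L, hL⟩ := exists_linearMap_injective_on_ker (mfderiv (𝓡∂ 4) (𝓡∂ 2) f x₀) hreg
  have hA := isInvertible_mfderiv_extChartAt (I := 𝓡∂ 4) (mem_extChartAt_source x₀)
  set A : E4 →L[ℝ] E4 := mfderiv (𝓡∂ 4) 𝓘(ℝ, E4) (extChartAt (𝓡∂ 4) x₀) x₀ with hAdef
  have hL' : ContMDiff 𝓘(ℝ, E4) (𝓡 2) ∞ (L ∘L A.inverse) := ContinuousLinearMap.contMDiff _
  -- Composing with the inverse of the derivative `A` of the chart makes the derivative of this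
  -- function at `x₀` equal to `L`.
  have hl : ContMDiffOn (𝓡∂ 4) (𝓡 2) ∞ (fun x => (L ∘L A.inverse) (extChartAt (𝓡∂ 4) x₀ x))
      (chartAt (EuclideanHalfSpace 4) x₀).source :=
    hL'.comp_contMDiffOn contMDiffOn_extChartAt
  have hd : mfderiv (𝓡∂ 4) (𝓡 2) (fun x => (L ∘L A.inverse) (extChartAt (𝓡∂ 4) x₀ x)) x₀ = L := by
    have h1 : MDifferentiableAt (𝓡∂ 4) 𝓘(ℝ, E4) (extChartAt (𝓡∂ 4) x₀) x₀ :=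
      mdifferentiableAt_extChartAt (mem_chart_source _ x₀)
    have h2 := mfderiv_comp (I := 𝓡∂ 4) (I' := 𝓘(ℝ, E4)) (I'' := 𝓡 2) x₀
      (g := (L ∘L A.inverse)) (f := extChartAt (𝓡∂ 4) x₀)
      (hL'.mdifferentiableAt (by simp)) h1
    rw [ContinuousLinearMap.mfderiv_eq] at h2
    refine h2.trans ?_
    refine ContinuousLinearMap.ext fun v => ?_
    change L (A.inverse (A v)) = L v
    have hA' : A.IsInvertible := hA
    obtain ⟨e, he⟩ := hA'
    have : A.inverse (A v) = v := by
      rw [← he, ContinuousLinearMap.inverse_equiv]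
      exact e.symm_apply_apply v
    rw [this]
  obtain ⟨c, hc, -, -⟩ := exists_fiberChart_of_injective hf hbd (chart_source_mem_nhds _ x₀) hl
    (fun v hv hv' => hL v hv (by rw [hd] at hv'; exact hv'))
  exact ⟨c, hc⟩

end FiberCharts

/-! ### Smooth retractions onto a regular fibre -/

section Retraction

variable {X B : Type*} [TopologicalSpace X] [ChartedSpace (EuclideanHalfSpace 4) X]
  [TopologicalSpace B] [ChartedSpace (EuclideanHalfSpace 2) B]

local notation "E2" => EuclideanSpace ℝ (Fin 2)

/-- `r` is a smooth retraction of the open set `O` to the part of the fibre of `f` over `y₀`. -/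
structure IsFiberRetraction (f : X → B) (y₀ : B) (O : Set X) (r : X → X) : Prop where
  isOpen : IsOpen O
  smooth : ContMDiffOn (𝓡∂ 4) (𝓡∂ 4) ∞ r O
  apply_eq : ∀ x ∈ O, f (r x) = y₀
  eq_self : ∀ x ∈ O, f x = y₀ → r x = x

variable [IsManifold (𝓡∂ 4) ∞ X] [CompactSpace X] [T2Space X]

/-- A fibre retraction can be extended over a further piece of the fibre that lies in a chart. -/
theorem IsFiberRetraction.exists_extend {f : X → B} {y₀ : B} {O : Set X}
    {r : X → X} (hr : IsFiberRetraction f y₀ O r) (c : FiberChart f) {C C' : Set X}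
    (hC : IsClosed C) (hCO : C ⊆ O) (hC' : C' ⊆ c.source) (hC'y : ∀ x ∈ C', f x = y₀) :
    ∃ O' r', C ∪ C' ⊆ O' ∧ IsFiberRetraction f y₀ O' r' := by
  classical
  -- `χ` vanishes near the complement of `O` and is `1` near `C`. It blends the old retraction with
  -- the projection of the chart by interpolating the fibre coordinates, which live in `ℝ²`.
  obtain ⟨χ, h0, h1, -⟩ := exists_contMDiffMap_zero_one_nhds_of_isClosed (𝓡∂ 4) (n := ⊤)
    hr.isOpen.isClosed_compl hC (disjoint_left.2 fun x hx hx' => hx (hCO hx'))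
  rw [eventually_nhdsSet_iff_exists] at h0 h1
  obtain ⟨N0, hN0o, hN0, h0⟩ := h0
  obtain ⟨N1, hN1o, hN1, h1⟩ := h1
  set m : X → E2 := fun x => c.coord x + χ x • (c.coord (r x) - c.coord x) with hm
  set A := c.source ∩ (O ∩ r ⁻¹' c.source) with hA
  have hAo : IsOpen A :=
    c.isOpen_source.inter (hr.smooth.continuousOn.isOpen_inter_preimage hr.isOpen c.isOpen_source)
  have hms : ContMDiffOn (𝓡∂ 4) (𝓡 2) ∞ m A := by
    have k1 : ContMDiffOn (𝓡∂ 4) (𝓡 2) ∞ c.coord A := c.smooth_coord.mono fun x hx => hx.1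
    have k2 : ContMDiffOn (𝓡∂ 4) (𝓡 2) ∞ (fun x => c.coord (r x)) A :=
      c.smooth_coord.comp (hr.smooth.mono fun x hx => hx.2.1) fun x hx => hx.2.2
    exact k1.add (χ.contMDiff.contMDiffOn.smul (k2.sub k1))
  set Q2 := A ∩ (fun x => (y₀, m x)) ⁻¹' c.target with hQ2
  have hQ2o : IsOpen Q2 :=
    (continuousOn_const.prodMk hms.continuousOn).isOpen_inter_preimage hAo c.isOpen_target
  -- Three open pieces: on `N1 ∩ O` the old retraction is kept; on `Q1`, where `χ = 0`, only the
  -- chart is used, so `r` need not be defined; on `Q2`, both `x` and `r x` lie in the chart and the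
  -- interpolation makes sense.
  set Q1 := (c.source ∩ N0) ∩ (fun x => (y₀, c.coord x)) ⁻¹' c.target with hQ1
  have hQ1o : IsOpen Q1 :=
    (continuousOn_const.prodMk (c.smooth_coord.continuousOn.mono
      inter_subset_left)).isOpen_inter_preimage (c.isOpen_source.inter hN0o) c.isOpen_target
  set r' : X → X := fun x => if x ∈ N1 ∩ O then r x else c.inv (y₀, m x) with hr'
  have e0 : ∀ x ∈ N1 ∩ O, r' x = r x := fun x hx => if_pos hx
  have e1 : ∀ x ∈ Q1, r' x = c.inv (y₀, c.coord x) := by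
    intro x hx
    have hx0 := h0 x hx.1.2
    have hn : x ∉ N1 ∩ O := fun h => by
      have := h1 x h.1
      rw [hx0] at this
      exact zero_ne_one this
    simp only [hr', hm, if_neg hn, hx0, zero_smul, add_zero]
  have e2 : ∀ x ∈ Q2, r' x = c.inv (y₀, m x) := by
    intro x hx
    by_cases h : x ∈ N1 ∩ O
    · rw [e0 x h]
      have : m x = c.coord (r x) := by simp [hm, h1 x h.1]
      rw [this, ← hr.apply_eq x h.2, c.left_inv _ hx.1.2.2]
    · exact if_neg h
  have hN1Oo : IsOpen (N1 ∩ O) := hN1o.inter hr.isOpen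
  refine ⟨(N1 ∩ O) ∪ (Q1 ∪ Q2), r', ?_, (hN1Oo.union (hQ1o.union hQ2o)), ?_, ?_, ?_⟩
  · rintro x (hx | hx)
    · exact Or.inl ⟨hN1 hx, hCO hx⟩
    · refine Or.inr ?_
      have hxs := hC' hx
      have hxt : (y₀, c.coord x) ∈ c.target := by
        rw [← hC'y x hx]
        exact c.map_source x hxs
      by_cases hO : x ∈ O
      · have hrx := hr.eq_self x hO (hC'y x hx)
        refine Or.inr ⟨⟨hxs, hO, ?_⟩, ?_⟩
        · rw [mem_preimage, hrx]
          exact hxs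
        · have : m x = c.coord x := by simp [hm, hrx]
          rw [mem_preimage, this]
          exact hxt
      · exact Or.inl ⟨⟨hxs, hN0 hO⟩, hxt⟩
  · have s0 : ContMDiffOn (𝓡∂ 4) (𝓡∂ 4) ∞ r' (N1 ∩ O) :=
      (hr.smooth.mono inter_subset_right).congr e0
    have s1 : ContMDiffOn (𝓡∂ 4) (𝓡∂ 4) ∞ r' Q1 :=
      (c.smooth_inv.comp (contMDiffOn_const.prodMk (c.smooth_coord.mono fun x hx => hx.1.1))
        fun x hx => hx.2).congr e1
    have s2 : ContMDiffOn (𝓡∂ 4) (𝓡∂ 4) ∞ r' Q2 :=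
      (c.smooth_inv.comp (contMDiffOn_const.prodMk (hms.mono inter_subset_left))
        fun x hx => hx.2).congr e2
    exact s0.union_of_isOpen (s1.union_of_isOpen s2 hQ1o hQ2o) hN1Oo (hQ1o.union hQ2o)
  · rintro x (hx | hx | hx)
    · rw [e0 x hx]
      exact hr.apply_eq x hx.2
    · rw [e1 x hx]
      exact c.apply_inv _ hx.2
    · rw [e2 x hx]
      exact c.apply_inv _ hx.2
  · rintro x (hx | hx | hx) hxy
    · rw [e0 x hx]
      exact hr.eq_self x hx.2 hxy
    · rw [e1 x hx, ← hxy]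
      exact c.left_inv x hx.1.1
    · rw [e2 x hx]
      have : m x = c.coord x := by simp [hm, hr.eq_self x hx.1.2.1 hxy]
      rw [this, ← hxy]
      exact c.left_inv x hx.1.1

variable [IsManifold (𝓡∂ 2) ∞ B] [T2Space B]

/-- A regular fibre is a smooth retract of a neighbourhood. -/
theorem exists_isFiberRetraction {f : X → B} (hf : ContMDiff (𝓡∂ 4) (𝓡∂ 2) ∞ f)
    (hbd : (𝓡∂ 4).boundary X = f ⁻¹' (𝓡∂ 2).boundary B) {y₀ : B}
    (hreg : ∀ x, f x = y₀ → Function.Surjective (mfderiv (𝓡∂ 4) (𝓡∂ 2) f x)) :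
    ∃ O r, f ⁻¹' {y₀} ⊆ O ∧ IsFiberRetraction f y₀ O r := by
  classical
  have hK : IsClosed (f ⁻¹' {y₀}) := isClosed_singleton.preimage hf.continuous
  have hloc : ∀ x, ∃ D : Set X, f x = y₀ → IsCompact D ∧ x ∈ interior D ∧
      ∃ c : FiberChart f, D ⊆ c.source := by
    intro x
    by_cases hx : f x = y₀
    · obtain ⟨c, hc⟩ := exists_fiberChart hf hbd (hreg x hx)
      obtain ⟨D, hD, hxD, hDc⟩ := exists_compact_subset c.isOpen_source hc
      exact ⟨D, fun _ => ⟨hD, hxD, c, hDc⟩⟩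
    · exact ⟨∅, fun h => absurd h hx⟩
  choose D hD using hloc
  obtain ⟨t, htK, ht⟩ := hK.isCompact.elim_nhds_subcover (fun x => interior (D x))
    fun x hx => isOpen_interior.mem_nhds (hD x hx).2.1
  -- The fibre is covered one compact piece at a time, because each extension needs the part already
  -- covered to be closed.
  have key : ∀ s : Finset X, s ⊆ t → ∃ O r, (⋃ x ∈ s, D x ∩ f ⁻¹' {y₀}) ⊆ O ∧
      IsFiberRetraction f y₀ O r := by
    intro s
    induction s using Finset.induction_on with
    | empty =>
      intro _
      exact ⟨∅, id, by simp, isOpen_empty, contMDiffOn_id, fun x hx => hx.elim, fun x hx => hx.elim⟩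
    | insert a s ha ih =>
      intro hst
      obtain ⟨O, r, hO, hr⟩ := ih ((Finset.subset_insert a s).trans hst)
      have ha' := htK a (hst (Finset.mem_insert_self a s))
      obtain ⟨c, hc⟩ := (hD a ha').2.2
      have hclosed : IsClosed (⋃ x ∈ s, D x ∩ f ⁻¹' {y₀}) := by
        refine isClosed_biUnion_finset fun x hx => ?_
        exact (hD x (htK x (hst (Finset.mem_insert_of_mem hx)))).1.isClosed.inter hK
      obtain ⟨O', r', hO', hr'⟩ := hr.exists_extend c hclosed hO
        (C' := D a ∩ f ⁻¹' {y₀}) (inter_subset_left.trans hc) fun x hx => hx.2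
      refine ⟨O', r', ?_, hr'⟩
      rw [Finset.set_biUnion_insert, union_comm]
      exact hO'
  obtain ⟨O, r, hO, hr⟩ := key t subset_rfl
  refine ⟨O, r, fun x hx => hO ?_, hr⟩
  obtain ⟨i, hi, hxi⟩ := mem_iUnion₂.1 (ht hx)
  exact mem_iUnion₂.2 ⟨i, hi, interior_subset hxi, hx⟩

end Retraction

end

noncomputable section
open Filter

/-! ### Ehresmann's theorem near a regular value -/

section LocalTransport

variable {X B : Type*} [TopologicalSpace X] [ChartedSpace (EuclideanHalfSpace 4) X]
  [TopologicalSpace B] [ChartedSpace (EuclideanHalfSpace 2) B]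

local notation "E2" => EuclideanSpace ℝ (Fin 2)

/-- In a fibre chart, a vector killed by `df` is the image of its fibre coordinate `w` under the
inclusion of the fibre. Since `r` fixes the fibre, the derivative of `c.coord ∘ r` returns `w`. Thus
`(f, c.coord ∘ r)` satisfies the hypothesis of `exists_fiberChart_of_injective`. -/
theorem IsFiberRetraction.eq_zero_of_mfderiv_eq_zero {f : X → B}
    (hf : ContMDiff (𝓡∂ 4) (𝓡∂ 2) ∞ f) {O : Set X} {r : X → X} {x₀ : X}
    (hr : IsFiberRetraction f (f x₀) O r) (hx₀ : x₀ ∈ O) (c : FiberChart f) (hc : x₀ ∈ c.source)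
    (v : TangentSpace (𝓡∂ 4) x₀) (hv : mfderiv (𝓡∂ 4) (𝓡∂ 2) f x₀ v = 0)
    (hv' : mfderiv (𝓡∂ 4) (𝓡 2) (fun x => c.coord (r x)) x₀ v = 0) : v = 0 := by
  have hrx : r x₀ = x₀ := hr.eq_self x₀ hx₀ rfl
  have hinv : c.inv (f x₀, c.coord x₀) = x₀ := c.left_inv x₀ hc
  have hds : MDifferentiableAt (𝓡∂ 4) (𝓡 2) c.coord x₀ :=
    (c.smooth_coord.contMDiffAt (c.isOpen_source.mem_nhds hc)).mdifferentiableAt (by simp)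
  have hdf : MDifferentiableAt (𝓡∂ 4) (𝓡∂ 2) f x₀ := (hf x₀).mdifferentiableAt (by simp)
  have hdi : MDifferentiableAt ((𝓡∂ 2).prod (𝓡 2)) (𝓡∂ 4) c.inv (f x₀, c.coord x₀) :=
    (c.smooth_inv.contMDiffAt (c.isOpen_target.mem_nhds (c.map_source x₀ hc))).mdifferentiableAt
      (by simp)
  have hdj : MDifferentiableAt (𝓡 2) (𝓡∂ 4) (fun z => c.inv (f x₀, z)) (c.coord x₀) :=
    hdi.comp (c.coord x₀) (f := fun z => (f x₀, z)) (mdifferentiableAt_const.prodMk mdifferentiableAt_id)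
  have hdr : MDifferentiableAt (𝓡∂ 4) (𝓡∂ 4) r x₀ :=
    (hr.smooth.contMDiffAt (hr.isOpen.mem_nhds hx₀)).mdifferentiableAt (by simp)
  have hdsr : MDifferentiableAt (𝓡∂ 4) (𝓡 2) (fun x => c.coord (r x)) x₀ :=
    MDifferentiableAt.comp (I' := 𝓡∂ 4) x₀ (by rw [hrx]; exact hds) hdr
  set w : E2 := mfderiv (𝓡∂ 4) (𝓡 2) c.coord x₀ v with hw
  -- `v` is the image of `w`
  have e1 : mfderiv (𝓡 2) (𝓡∂ 4) (fun z => c.inv (f x₀, z)) (c.coord x₀) w = v := by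
    have a1 : mfderiv (𝓡∂ 4) (𝓡∂ 4) (fun x => c.inv (f x, c.coord x)) x₀ v = v := by
      have : (fun x => c.inv (f x, c.coord x)) =ᶠ[𝓝 x₀] id := by
        filter_upwards [c.isOpen_source.mem_nhds hc] with x hx using c.left_inv x hx
      rw [this.mfderiv_eq, mfderiv_id]
      rfl
    have a2 := mfderiv_comp (I := 𝓡∂ 4) (I' := (𝓡∂ 2).prod (𝓡 2)) (I'' := 𝓡∂ 4) x₀ (g := c.inv)
      (f := fun x => (f x, c.coord x)) hdi (hdf.prodMk hds)
    rw [mfderiv_prodMk hdf hds] at a2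
    have a3 := mfderiv_comp (I := 𝓡 2) (I' := (𝓡∂ 2).prod (𝓡 2)) (I'' := 𝓡∂ 4) (c.coord x₀)
      (g := c.inv) (f := fun z => (f x₀, z)) hdi (mdifferentiableAt_const.prodMk mdifferentiableAt_id)
    rw [mfderiv_prod_right] at a3
    refine (congrArg (fun L => L w) a3).trans ?_
    refine Eq.trans ?_ ((congrArg (fun L => L v) a2).symm.trans a1)
    change mfderiv ((𝓡∂ 2).prod (𝓡 2)) (𝓡∂ 4) c.inv (f x₀, c.coord x₀) (0, w) =
      mfderiv ((𝓡∂ 2).prod (𝓡 2)) (𝓡∂ 4) c.inv (f x₀, c.coord x₀)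
        (mfderiv (𝓡∂ 4) (𝓡∂ 2) f x₀ v, mfderiv (𝓡∂ 4) (𝓡 2) c.coord x₀ v)
    rw [hv]
    rfl
  have e2 : mfderiv (𝓡 2) (𝓡 2) (fun z => c.coord (r (c.inv (f x₀, z)))) (c.coord x₀) w = w := by
    have hcj : ContinuousAt (fun z => (f x₀, z)) (c.coord x₀) := by fun_prop
    have hj : Tendsto (fun z => c.inv (f x₀, z)) (𝓝 (c.coord x₀)) (𝓝 x₀) := by
      simpa only [hinv] using hdj.continuousAt.tendsto
    have : (fun z => c.coord (r (c.inv (f x₀, z)))) =ᶠ[𝓝 (c.coord x₀)] id := by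
      filter_upwards [hcj.eventually (c.isOpen_target.mem_nhds (c.map_source x₀ hc)),
        hj.eventually (hr.isOpen.mem_nhds hx₀)] with z h1 h2
      rw [hr.eq_self _ h2 (c.apply_inv _ h1), c.coord_inv _ h1]
      rfl
    rw [this.mfderiv_eq, mfderiv_id]
    rfl
  have e3 := mfderiv_comp (I := 𝓡 2) (I' := 𝓡∂ 4) (I'' := 𝓡 2) (c.coord x₀)
    (g := fun x => c.coord (r x)) (f := fun z => c.inv (f x₀, z)) (by rw [hinv]; exact hdsr) hdj
  have e4 : w = 0 := by
    refine e2.symm.trans ((congrArg (fun L => L w) e3).trans ?_)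
    change mfderiv (𝓡∂ 4) (𝓡 2) (fun x => c.coord (r x)) (c.inv (f x₀, c.coord x₀))
      (mfderiv (𝓡 2) (𝓡∂ 4) (fun z => c.inv (f x₀, z)) (c.coord x₀) w) = 0
    rw [e1]
    have : ∀ x, x = x₀ → (mfderiv (𝓡∂ 4) (𝓡 2) (fun x => c.coord (r x)) x : (EuclideanSpace ℝ (Fin 4)) →L[ℝ] E2) v = 0 := by
      rintro x rfl
      exact hv'
    exact this _ hinv
  rw [← e1, e4]
  exact map_zero _

/-- A flat smooth parallel transport between the fibres of `f` over the open set `base`. -/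
structure FiberTransport (f : X → B) where
  base : Set B
  map : B → X → X
  isOpen_base : IsOpen base
  smooth : ContMDiffOn ((𝓡∂ 2).prod (𝓡∂ 4)) (𝓡∂ 4) ∞ (fun q : B × X => map q.1 q.2)
    (base ×ˢ (f ⁻¹' base))
  apply_map : ∀ y ∈ base, ∀ x, f x ∈ base → f (map y x) = y
  map_apply : ∀ x, f x ∈ base → map (f x) x = x
  map_map : ∀ y ∈ base, ∀ y' ∈ base, ∀ x, f x ∈ base → map y (map y' x) = map y x

/-- The map `y ↦ P.map y x` is a local section of `f` through `x`. -/
theorem FiberTransport.surjective_mfderiv {f : X → B} (hf : ContMDiff (𝓡∂ 4) (𝓡∂ 2) ∞ f)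
    (P : FiberTransport f) {x : X} (hx : f x ∈ P.base) :
    Function.Surjective (mfderiv (𝓡∂ 4) (𝓡∂ 2) f x) := by
  have hP : MDifferentiableAt (𝓡∂ 2) (𝓡∂ 4) (fun y => P.map y x) (f x) := by
    have h1 : MDifferentiableAt ((𝓡∂ 2).prod (𝓡∂ 4)) (𝓡∂ 4) (fun q : B × X => P.map q.1 q.2)
        (f x, x) := (P.smooth.contMDiffAt ((P.isOpen_base.prod
          (P.isOpen_base.preimage hf.continuous)).mem_nhds (mk_mem_prod hx (mem_preimage.2 hx)))).mdifferentiableAt (by simp)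
    exact h1.comp (f x) (f := fun y => (y, x)) (mdifferentiableAt_id.prodMk mdifferentiableAt_const)
  have hfx : MDifferentiableAt (𝓡∂ 4) (𝓡∂ 2) f (P.map (f x) x) :=
    (hf _).mdifferentiableAt (by simp)
  have e := mfderiv_comp (I := 𝓡∂ 2) (I' := 𝓡∂ 4) (I'' := 𝓡∂ 2) (f x) (g := f)
    (f := fun y => P.map y x) hfx hP
  have e' : (f ∘ fun y => P.map y x) =ᶠ[𝓝 (f x)] id := by
    filter_upwards [P.isOpen_base.mem_nhds hx] with y hy using P.apply_map y hy x hx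
  rw [e'.mfderiv_eq, mfderiv_id] at e
  have key : ∀ x', x' = x → Function.Surjective (mfderiv (𝓡∂ 4) (𝓡∂ 2) f x' :
      EuclideanSpace ℝ (Fin 4) →L[ℝ] E2) → Function.Surjective (mfderiv (𝓡∂ 4) (𝓡∂ 2) f x) := by
    rintro x' rfl h
    exact h
  refine key _ (P.map_apply x hx) fun w => ⟨_, (congrArg (fun L => L w) e).symm⟩

variable [IsManifold (𝓡∂ 4) ∞ X] [CompactSpace X] [T2Space X] [IsManifold (𝓡∂ 2) ∞ B] [T2Space B]

/-- Ehresmann's theorem: near a regular value there is a flat parallel transport. -/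
theorem exists_fiberTransport {f : X → B} (hf : ContMDiff (𝓡∂ 4) (𝓡∂ 2) ∞ f)
    (hbd : (𝓡∂ 4).boundary X = f ⁻¹' (𝓡∂ 2).boundary B) {y₀ : B}
    (hreg : ∀ x, f x = y₀ → Function.Surjective (mfderiv (𝓡∂ 4) (𝓡∂ 2) f x)) :
    ∃ P : FiberTransport f, y₀ ∈ P.base := by
  classical
  obtain ⟨O, r, hO, hr⟩ := exists_isFiberRetraction hf hbd hreg
  set K := f ⁻¹' {y₀} with hK
  have hKc : IsCompact K := (isClosed_singleton.preimage hf.continuous).isCompact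
  have hrc : ∀ x ∈ O, ContinuousAt r x := fun x hx =>
    hr.smooth.continuousOn.continuousAt (hr.isOpen.mem_nhds hx)
  -- charts adapted to the retraction
  have hcharts : ∀ k ∈ K, ∃ c c' : FiberChart f, k ∈ c.source ∧ k ∈ c'.source ∧
      c'.source ⊆ O ∩ r ⁻¹' c.source ∧ c'.coord = fun x => c.coord (r x) := by
    intro k hk
    obtain ⟨c, hc⟩ := exists_fiberChart hf hbd (hreg k hk)
    have hko := hO hk
    have hk' : f k = y₀ := hk
    have hopen : IsOpen (O ∩ r ⁻¹' c.source) :=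
      hr.smooth.continuousOn.isOpen_inter_preimage hr.isOpen c.isOpen_source
    have hmem : k ∈ O ∩ r ⁻¹' c.source := ⟨hko, by rwa [mem_preimage, hr.eq_self k hko hk]⟩
    have hs : ContMDiffOn (𝓡∂ 4) (𝓡 2) ∞ (fun x => c.coord (r x)) (O ∩ r ⁻¹' c.source) :=
      c.smooth_coord.comp (hr.smooth.mono inter_subset_left) fun x hx => hx.2
    obtain ⟨c', h1, h2, h3⟩ := exists_fiberChart_of_injective hf hbd (hopen.mem_nhds hmem) hs
      (IsFiberRetraction.eq_zero_of_mfderiv_eq_zero hf (by rwa [hk']) hko c hc)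
    exact ⟨c, c', hc, h1, h2, h3⟩
  -- injectivity of `(f, r)` near `K`
  obtain ⟨O₁, O₂, hO₁, hO₂, hKO₁, hKO₂, hinj⟩ := generalized_tube_lemma hKc hKc
    (n := interior {q : X × X | f q.1 = f q.2 → r q.1 = r q.2 → q.1 = q.2}) isOpen_interior (by
      rintro ⟨a, b⟩ ⟨ha, hb⟩
      rw [mem_interior_iff_mem_nhds]
      -- Near the diagonal, a chart with fibre coordinate `c.coord ∘ r` separates points; away from
      -- it, `r` does so alone, because it fixes `a` and `b`.
      by_cases hab : a = b
      · subst hab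
        obtain ⟨c, c', -, hc', -, he⟩ := hcharts a ha
        refine mem_of_superset (prod_mem_nhds (c'.isOpen_source.mem_nhds hc')
          (c'.isOpen_source.mem_nhds hc')) ?_
        rintro ⟨x, x'⟩ ⟨hx, hx'⟩ h h'
        refine c'.eq_of_eq hx hx' h ?_
        rw [he]
        exact congrArg c.coord h'
      · have h1 : Tendsto (fun q : X × X => (r q.1, r q.2)) (𝓝 (a, b)) (𝓝 (r a, r b)) :=
          ((hrc a (hO ha)).comp continuousAt_fst).prodMk_nhds
            (ContinuousAt.comp (f := Prod.snd) (hrc b (hO hb)) continuousAt_snd)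
        have h2 : {q : X × X | q.1 ≠ q.2} ∈ 𝓝 (r a, r b) := by
          refine (isOpen_ne_fun continuous_fst continuous_snd).mem_nhds ?_
          change r a ≠ r b
          rwa [hr.eq_self a (hO ha) ha, hr.eq_self b (hO hb) hb]
        exact mem_of_superset (h1 h2) fun q hq _ h' => absurd h' hq)
  set O' := O ∩ (O₁ ∩ O₂) with hO'
  have hO'o : IsOpen O' := hr.isOpen.inter (hO₁.inter hO₂)
  have hKO' : K ⊆ O' := fun k hk => ⟨hO hk, hKO₁ hk, hKO₂ hk⟩
  have huniq : ∀ x ∈ O', ∀ x' ∈ O', f x = f x' → r x = r x' → x = x' := fun x hx x' hx' =>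
    interior_subset (hinj (show (x, x') ∈ O₁ ×ˢ O₂ from ⟨hx.2.1, hx'.2.2⟩))
  -- local smooth solutions
  obtain ⟨V₁, N, hV₁, hN, hyV₁, hKN, hsol⟩ := generalized_tube_lemma (isCompact_singleton (x := y₀))
    hKc (n := interior {q : B × X | ∃ (s : B × X → X) (Z : Set (B × X)), IsOpen Z ∧ q ∈ Z ∧
      ContMDiffOn ((𝓡∂ 2).prod (𝓡∂ 4)) (𝓡∂ 4) ∞ s Z ∧
      ∀ q' ∈ Z, q'.2 ∈ K → s q' ∈ O' ∧ f (s q') = q'.1 ∧ r (s q') = q'.2}) isOpen_interior (by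
    rintro ⟨y, k⟩ ⟨hy, hk⟩
    rw [mem_singleton_iff] at hy
    subst hy
    have hk' : f k = y := hk
    obtain ⟨c, c', hc, hc', hcc', he⟩ := hcharts k hk
    have hrk : r k = k := hr.eq_self k (hO hk) hk
    have hsm : ContMDiffOn ((𝓡∂ 2).prod (𝓡∂ 4)) ((𝓡∂ 2).prod (𝓡 2)) ∞
        (fun q : B × X => (q.1, c.coord q.2)) (univ ×ˢ c.source) :=
      contMDiffOn_fst.prodMk (c.smooth_coord.comp contMDiffOn_snd fun q hq => hq.2)
    have ho1 : IsOpen ((univ ×ˢ c.source) ∩ (fun q : B × X => (q.1, c.coord q.2)) ⁻¹' c'.target) :=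
      hsm.continuousOn.isOpen_inter_preimage (isOpen_univ.prod c.isOpen_source) c'.isOpen_target
    have hs : ContMDiffOn ((𝓡∂ 2).prod (𝓡∂ 4)) (𝓡∂ 4) ∞ (fun q : B × X => c'.inv (q.1, c.coord q.2))
        ((univ ×ˢ c.source) ∩ (fun q : B × X => (q.1, c.coord q.2)) ⁻¹' c'.target) :=
      c'.smooth_inv.comp (hsm.mono inter_subset_left) fun q hq => hq.2
    have hmem : (y, k) ∈ (univ ×ˢ c.source) ∩
        (fun q : B × X => (q.1, c.coord q.2)) ⁻¹' c'.target := by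
      refine ⟨⟨mem_univ _, hc⟩, ?_⟩
      have := c'.map_source k hc'
      rw [he, hk'] at this
      change (y, c.coord k) ∈ c'.target
      simpa only [hrk] using this
    have hval : c'.inv (y, c.coord k) = k := by
      have := c'.left_inv k hc'
      rw [he, hk'] at this
      simpa only [hrk] using this
    have hZ : IsOpen ((univ ×ˢ c.source) ∩ (fun q : B × X => (q.1, c.coord q.2)) ⁻¹' c'.target ∩
        (fun q : B × X => c'.inv (q.1, c.coord q.2)) ⁻¹' O') :=
      hs.continuousOn.isOpen_inter_preimage ho1 hO'o
    have hZm : (y, k) ∈ (univ ×ˢ c.source) ∩ (fun q : B × X => (q.1, c.coord q.2)) ⁻¹' c'.target ∩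
        (fun q : B × X => c'.inv (q.1, c.coord q.2)) ⁻¹' O' :=
      ⟨hmem, by rw [mem_preimage]; change c'.inv (y, c.coord k) ∈ O'; rw [hval]; exact hKO' hk⟩
    rw [mem_interior_iff_mem_nhds]
    refine mem_of_superset (hZ.mem_nhds hZm) fun q hq => ⟨_, _, hZ, hq, hs.mono inter_subset_left, ?_⟩
    rintro q' ⟨⟨⟨-, h1⟩, h2⟩, h3⟩ hq'
    have hms := c'.map_target _ h2
    refine ⟨h3, c'.apply_inv _ h2, ?_⟩
    refine c.eq_of_eq (hcc' hms).2 h1 ?_ ?_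
    · rw [hr.apply_eq _ (hcc' hms).1]
      exact hq'.symm
    · have := c'.coord_inv _ h2
      rw [he] at this
      exact this)
  have hyV₁ : y₀ ∈ V₁ := hyV₁ rfl
  -- Properness of `f`: by compactness of `X`, all of `f⁻¹(V)` lies in `O'` once `V` avoids this
  -- closed set.
  have hclosed : IsClosed (f '' O'ᶜ) :=
    (hO'o.isClosed_compl.isCompact.image hf.continuous).isClosed
  set V := V₁ ∩ (f '' O'ᶜ)ᶜ with hV
  have hVo : IsOpen V := hV₁.inter hclosed.isOpen_compl
  have hyV : y₀ ∈ V := by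
    refine ⟨hyV₁, ?_⟩
    rintro ⟨x, hx, hxy⟩
    exact hx (hKO' hxy)
  have hVO' : ∀ x, f x ∈ V → x ∈ O' := fun x hx => by
    by_contra h
    exact hx.2 ⟨x, h, rfl⟩
  have hrK : ∀ x, f x ∈ V → r x ∈ K := fun x hx => hr.apply_eq x (hVO' x hx).1
  have hex : ∀ y ∈ V, ∀ x, f x ∈ V → ∃ x' ∈ O', f x' = y ∧ r x' = r x := by
    intro y hy x hx
    obtain ⟨s, Z, -, hZ, -, hs⟩ := interior_subset
      (hsol (show (y, r x) ∈ V₁ ×ˢ N from ⟨hy.1, hKN (hrK x hx)⟩))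
    obtain ⟨h1, h2, h3⟩ := hs _ hZ (hrK x hx)
    exact ⟨_, h1, h2, h3⟩
  -- Transport keeps `r` fixed: `m y x` is the point of `O'` over `y` with the same retraction as
  -- `x`. It is unique, so the choice is smooth (it agrees with the local solutions) and flat. Off
  -- `V` the value `x` is a dummy.
  set m : B → X → X := fun y x => if h : ∃ x' ∈ O', f x' = y ∧ r x' = r x then h.choose else x
    with hm
  have hmspec : ∀ y ∈ V, ∀ x, f x ∈ V → m y x ∈ O' ∧ f (m y x) = y ∧ r (m y x) = r x := by
    intro y hy x hx
    have h := hex y hy x hx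
    have e : m y x = h.choose := dif_pos h
    rw [e]
    exact ⟨h.choose_spec.1, h.choose_spec.2.1, h.choose_spec.2.2⟩
  refine ⟨⟨V, m, hVo, ?_, fun y hy x hx => (hmspec y hy x hx).2.1, ?_, ?_⟩, hyV⟩
  · rintro ⟨y, x⟩ ⟨hy, hx⟩
    obtain ⟨s, Z, hZo, hZ, hsm, hs⟩ := interior_subset
      (hsol (show (y, r x) ∈ V₁ ×ˢ N from ⟨hy.1, hKN (hrK x hx)⟩))
    have hrs : ContMDiffOn ((𝓡∂ 2).prod (𝓡∂ 4)) ((𝓡∂ 2).prod (𝓡∂ 4)) ∞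
        (fun q : B × X => (q.1, r q.2)) (V ×ˢ (f ⁻¹' V)) :=
      contMDiffOn_fst.prodMk (hr.smooth.comp contMDiffOn_snd fun q hq => (hVO' _ hq.2).1)
    have hopen : IsOpen ((V ×ˢ (f ⁻¹' V)) ∩ (fun q : B × X => (q.1, r q.2)) ⁻¹' Z) :=
      hrs.continuousOn.isOpen_inter_preimage (hVo.prod (hVo.preimage hf.continuous)) hZo
    have h1 : ContMDiffOn ((𝓡∂ 2).prod (𝓡∂ 4)) (𝓡∂ 4) ∞ (fun q : B × X => m q.1 q.2)
        ((V ×ˢ (f ⁻¹' V)) ∩ (fun q : B × X => (q.1, r q.2)) ⁻¹' Z) := by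
      refine (hsm.comp (hrs.mono inter_subset_left) fun q hq => hq.2).congr ?_
      rintro ⟨y', x'⟩ ⟨⟨hy', hx'⟩, hZ'⟩
      obtain ⟨a1, a2, a3⟩ := hs _ hZ' (hrK x' hx')
      obtain ⟨b1, b2, b3⟩ := hmspec y' hy' x' hx'
      exact huniq _ b1 _ a1 (b2.trans a2.symm) (b3.trans a3.symm)
    exact (h1.contMDiffAt (hopen.mem_nhds ⟨⟨hy, hx⟩, hZ⟩)).contMDiffWithinAt
  · intro x hx
    obtain ⟨b1, b2, b3⟩ := hmspec _ hx x hx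
    exact huniq _ b1 _ (hVO' x hx) b2 b3
  · intro y hy y' hy' x hx
    obtain ⟨b1, b2, b3⟩ := hmspec y' hy' x hx
    obtain ⟨c1, c2, c3⟩ := hmspec y hy x hx
    obtain ⟨d1, d2, d3⟩ := hmspec y hy (m y' x) (by rw [b2]; exact hy')
    exact huniq _ d1 _ c1 (d2.trans c2.symm) (d3.trans (b3.trans c3.symm))

/-- The critical values of a Lefschetz fibration form a closed set. -/
theorem isClosed_criticalValues {f : X → B} (hf : IsLefschetzFibration f) :
    IsClosed (criticalValues f) := by
  rw [← isOpen_compl_iff, isOpen_iff_mem_nhds]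
  intro y hy
  obtain ⟨P, hP⟩ := exists_fiberTransport hf.smooth hf.boundary_eq (y₀ := y) fun x hx => by
    by_contra h
    exact hy ⟨x, h, hx⟩
  refine mem_of_superset (P.isOpen_base.mem_nhds hP) ?_
  rintro _ hz ⟨x, hx, rfl⟩
  exact hx (P.surjective_mfderiv hf.smooth hz)

end LocalTransport

end

noncomputable section
open Filter

/-! ### Trivializations along smooth paths -/

section PathTrivialization

variable {X B : Type*} [TopologicalSpace X] [ChartedSpace (EuclideanHalfSpace 4) X]
  [TopologicalSpace B] [ChartedSpace (EuclideanHalfSpace 2) B]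
  {S : Type*} [TopologicalSpace S] [ChartedSpace (EuclideanSpace ℝ (Fin 2)) S]

omit [TopologicalSpace B] [ChartedSpace (EuclideanHalfSpace 2) B] in
theorem IsFiberParam.apply_eq {f : X → B} {y : B} {k : S → X} (hk : IsFiberParam f y k) (p : S) :
    f (k p) = y := by
  have : k p ∈ f ⁻¹' {y} := hk.range_eq ▸ mem_range_self p
  exact this

theorem FiberTransport.contMDiff_map {f : X → B} (P : FiberTransport f) {y : B}
    (hy : y ∈ P.base) : ContMDiffOn (𝓡∂ 4) (𝓡∂ 4) ∞ (P.map y) (f ⁻¹' P.base) := by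
  have : ContMDiffOn (𝓡∂ 4) ((𝓡∂ 2).prod (𝓡∂ 4)) ∞ (fun x : X => (y, x)) (f ⁻¹' P.base) :=
    contMDiffOn_const.prodMk contMDiffOn_id
  exact P.smooth.comp this fun x hx => ⟨hy, hx⟩

/-- Parallel transport of a parametrized fibre. -/
theorem IsFiberParam.transport {f : X → B} (hf : Continuous f) (P : FiberTransport f) {y y' : B}
    (hy : y ∈ P.base) (hy' : y' ∈ P.base) {k : S → X} (hk : IsFiberParam f y k) :
    IsFiberParam f y' (fun p => P.map y' (k p)) := by
  have hb : ∀ p, f (k p) ∈ P.base := fun p => by rwa [hk.apply_eq]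
  -- By flatness, transport back to `y` inverts transport to `y'`. Injectivity and the immersion
  -- property of the new parametrization follow from this.
  have hback : ∀ p, P.map y (P.map y' (k p)) = k p := fun p => by
    rw [P.map_map y hy y' hy' _ (hb p)]
    conv_lhs => rw [← hk.apply_eq p]
    exact P.map_apply _ (hb p)
  have ho : IsOpen (f ⁻¹' P.base) := P.isOpen_base.preimage hf
  have hs : ContMDiff (𝓡 2) (𝓡∂ 4) ∞ (fun p => P.map y' (k p)) := by
    rw [← contMDiffOn_univ]
    exact (P.contMDiff_map hy').comp hk.smooth.contMDiffOn fun p _ => hb p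
  refine ⟨hs, ?_, ?_, ?_⟩
  · intro p q hpq
    apply hk.injective
    rw [← hback p, ← hback q]
    exact congrArg (P.map y) hpq
  · ext x
    constructor
    · rintro ⟨p, rfl⟩
      exact P.apply_map y' hy' _ (hb p)
    · intro hx
      have hx' : f x = y' := hx
      have h1 : P.map y x ∈ range k := by
        rw [hk.range_eq]
        exact P.apply_map y hy _ (by rwa [hx'])
      obtain ⟨p, hp⟩ := h1
      refine ⟨p, ?_⟩
      change P.map y' (k p) = x
      rw [hp, P.map_map y' hy' y hy _ (by rwa [hx'])]
      conv_lhs => rw [← hx']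
      exact P.map_apply x (by rwa [hx'])
  · intro p
    have hx : f (P.map y' (k p)) ∈ P.base := by rwa [P.apply_map y' hy' _ (hb p)]
    have h1 : MDifferentiableAt (𝓡∂ 4) (𝓡∂ 4) (P.map y) (P.map y' (k p)) :=
      ((P.contMDiff_map hy).contMDiffAt (ho.mem_nhds hx)).mdifferentiableAt (by simp)
    have h2 := mfderiv_comp (I := 𝓡 2) (I' := 𝓡∂ 4) (I'' := 𝓡∂ 4) p (g := P.map y)
      (f := fun p => P.map y' (k p)) h1 (hs.mdifferentiableAt (by simp))
    have h3 : (P.map y ∘ fun p => P.map y' (k p)) = k := funext hback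
    have h4 := hk.immersion p
    rw [← h3, h2] at h4
    exact Function.Injective.of_comp (f := mfderiv (𝓡∂ 4) (𝓡∂ 4) (P.map y) (P.map y' (k p))) h4

/-- `f` admits a trivialization over `[0,s]` along the path `a`. -/
def HasTrivializationOn (f : X → B) (a : ℝ → B) (ι : S → X) (s : ℝ) : Prop :=
  ∃ F : ℝ → S → X, ContMDiffOn (𝓘(ℝ, ℝ).prod (𝓡 2)) (𝓡∂ 4) ∞ (fun q : ℝ × S => F q.1 q.2)
    (Icc 0 s ×ˢ univ) ∧ (∀ t ∈ Icc (0 : ℝ) s, IsFiberParam f (a t) (F t)) ∧ F 0 = ι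

/-- A smooth function which is the identity up to `(s₁ + s) / 2` and stays between `s₁` and `s`. -/
theorem exists_smooth_cutoff {s₁ s : ℝ} (h : s₁ < s) : ∃ χ : ℝ → ℝ, ContDiff ℝ ∞ χ ∧
    (∀ t ≤ (s₁ + s) / 2, χ t = t) ∧ ∀ t, s₁ ≤ t → χ t ∈ Icc s₁ s := by
  set c := (s₁ + s) / 2 with hc
  have h1 : s₁ < c := by linarith
  have h2 : c < s := by linarith
  -- From `c` on, the time is pulled back towards `c`, which it equals for `t ≥ s`.
  refine ⟨fun t => t + (c - t) * Real.smoothTransition ((t - c) / (s - c)), ?_, ?_, ?_⟩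
  · have : ContDiff ℝ ∞ fun t : ℝ => Real.smoothTransition ((t - c) / (s - c)) :=
      Real.smoothTransition.contDiff.comp ((contDiff_id.sub contDiff_const).div_const _)
    exact contDiff_id.add ((contDiff_const.sub contDiff_id).mul this)
  · intro t ht
    have : Real.smoothTransition ((t - c) / (s - c)) = 0 :=
      Real.smoothTransition.zero_of_nonpos (div_nonpos_of_nonpos_of_nonneg (by linarith) (by linarith))
    simp [this]
  · intro t ht
    have k0 := Real.smoothTransition.nonneg ((t - c) / (s - c))
    have k1 := Real.smoothTransition.le_one ((t - c) / (s - c))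
    rcases le_total s t with hst | hst
    · have : Real.smoothTransition ((t - c) / (s - c)) = 1 :=
        Real.smoothTransition.one_of_one_le (by rw [one_le_div (by linarith)]; linarith)
      simp only [this, mul_one]
      constructor <;> linarith
    · constructor
      · change s₁ ≤ t + (c - t) * _
        nlinarith
      · change t + (c - t) * _ ≤ s
        nlinarith

/-- The new family is `P.map (a t) (F (χ t) p)`, where the cutoff `χ` keeps the time of `F` inside
`[s₁, s]`. Up to the midpoint of `[s₁, s]` we have `χ t = t`, so transport does nothing and the new
family agrees with `F` on an interval; no derivatives have to be matched. For `s = 0` there is no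
room on the left, and the single fibre parametrization is transported. -/
theorem HasTrivializationOn.extend {f : X → B} (hf : Continuous f) {a : ℝ → B} {ι : S → X}
    (ha : ContMDiffOn 𝓘(ℝ, ℝ) (𝓡∂ 2) ∞ a (Icc 0 1)) (P : FiberTransport f) {s s' : ℝ}
    (hs0 : 0 ≤ s) (hss' : s ≤ s') (hs1 : s' ≤ 1) (hP : ∀ t ∈ Icc s s', a t ∈ P.base)
    (h : HasTrivializationOn f a ι s) : HasTrivializationOn f a ι s' := by
  obtain ⟨F, hF, hFp, hF0⟩ := h
  rcases hs0.eq_or_lt with rfl | hs0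
  · have h0 : a 0 ∈ P.base := hP 0 ⟨le_rfl, hss'⟩
    have hι : IsFiberParam f (a 0) ι := hF0 ▸ hFp 0 ⟨le_rfl, le_rfl⟩
    refine ⟨fun t p => P.map (a t) (ι p), ?_, fun t ht => hι.transport hf P h0 (hP t ht), ?_⟩
    · have h1 : ContMDiffOn (𝓘(ℝ, ℝ).prod (𝓡 2)) ((𝓡∂ 2).prod (𝓡∂ 4)) ∞
          (fun q : ℝ × S => (a q.1, ι q.2)) (Icc 0 s' ×ˢ univ) :=
        (ha.comp contMDiffOn_fst fun q hq => ⟨hq.1.1, hq.1.2.trans hs1⟩).prodMk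
          (hι.smooth.comp contMDiff_snd).contMDiffOn
      exact P.smooth.comp h1 fun q hq => ⟨hP _ hq.1, by
        change f (ι q.2) ∈ P.base
        rwa [hι.apply_eq]⟩
    · funext p
      change P.map (a 0) (ι p) = ι p
      conv_lhs => rw [← hι.apply_eq p]
      exact P.map_apply _ (by rwa [hι.apply_eq])
  · obtain ⟨s₁, hs₁0, hs₁, hPs₁⟩ : ∃ s₁, 0 ≤ s₁ ∧ s₁ < s ∧ ∀ t ∈ Icc s₁ s', a t ∈ P.base := by
      have h1 : ∀ᶠ t in 𝓝[Icc 0 1] s, a t ∈ P.base :=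
        (ha.continuousOn s ⟨hs0.le, hss'.trans hs1⟩).eventually
          (P.isOpen_base.mem_nhds (hP s ⟨le_rfl, hss'⟩))
      obtain ⟨ε, hε, hball⟩ := Metric.mem_nhdsWithin_iff.1 h1
      refine ⟨max 0 (s - ε / 2), le_max_left _ _, max_lt hs0 (by linarith), fun t ht => ?_⟩
      have hm1 := (le_max_left 0 (s - ε / 2)).trans ht.1
      have hm2 := (le_max_right 0 (s - ε / 2)).trans ht.1
      rcases le_total s t with hst | hst
      · exact hP t ⟨hst, ht.2⟩
      · refine hball ⟨?_, hm1, ht.2.trans hs1⟩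
        rw [Metric.mem_ball, Real.dist_eq, abs_lt]
        constructor <;> linarith
    obtain ⟨χ, hχs, hχid, hχ⟩ := exists_smooth_cutoff hs₁
    set c := (s₁ + s) / 2 with hc
    have hc1 : s₁ < c := by linarith
    have hc2 : c < s := by linarith
    have hFb : ∀ t ∈ Icc s₁ s', ∀ p, f (F (χ t) p) ∈ P.base := fun t ht p => by
      have hχt := hχ t ht.1
      rw [(hFp (χ t) ⟨hs₁0.trans hχt.1, hχt.2⟩).apply_eq]
      exact hPs₁ _ ⟨hχt.1, hχt.2.trans hss'⟩
    set F' : ℝ → S → X := fun t p => if t < c then F t p else P.map (a t) (F (χ t) p) with hF'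
    have e1 : ∀ t < c, F' t = F t := fun t ht => by
      funext p
      exact if_pos ht
    have e2 : ∀ t ∈ Icc s₁ s', F' t = fun p => P.map (a t) (F (χ t) p) := fun t ht => by
      funext p
      by_cases htc : t < c
      · rw [e1 t htc]
        have hb := hFb t ht p
        rw [hχid t htc.le] at hb ⊢
        conv_rhs => rw [← (hFp t ⟨hs₁0.trans ht.1, (htc.trans hc2).le⟩).apply_eq p]
        exact (P.map_apply _ hb).symm
      · exact if_neg htc
    refine ⟨F', ?_, ?_, ?_⟩
    · refine contMDiffOn_of_locally_contMDiffOn ?_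
      rintro ⟨t, p⟩ ⟨ht, -⟩
      rcases lt_or_ge t c with htc | htc
      · refine ⟨Iio c ×ˢ univ, isOpen_Iio.prod isOpen_univ, ⟨htc, mem_univ _⟩, ?_⟩
        refine (hF.mono ?_).congr ?_
        · rintro ⟨t', p'⟩ ⟨⟨h1, -⟩, h2, -⟩
          exact ⟨⟨h1.1, ((mem_Iio.1 h2).trans hc2).le⟩, mem_univ _⟩
        · rintro ⟨t', p'⟩ ⟨-, h2, -⟩
          exact congrFun (e1 t' h2) p'
      · refine ⟨Ioi s₁ ×ˢ univ, isOpen_Ioi.prod isOpen_univ, ⟨hc1.trans_le htc, mem_univ _⟩, ?_⟩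
        have hχm : ContMDiff 𝓘(ℝ, ℝ) 𝓘(ℝ, ℝ) ∞ χ := hχs.contMDiff
        have h1 : ContMDiffOn (𝓘(ℝ, ℝ).prod (𝓡 2)) (𝓡∂ 4) ∞ (fun q : ℝ × S => F (χ q.1) q.2)
            (Icc s₁ s' ×ˢ univ) :=
          ContMDiffOn.comp (t := Icc 0 s ×ˢ univ) hF (((hχm.comp contMDiff_fst).prodMk
            contMDiff_snd).contMDiffOn) fun q hq =>
              ⟨⟨hs₁0.trans (hχ _ hq.1.1).1, (hχ _ hq.1.1).2⟩, mem_univ _⟩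
        have h2 : ContMDiffOn (𝓘(ℝ, ℝ).prod (𝓡 2)) ((𝓡∂ 2).prod (𝓡∂ 4)) ∞
            (fun q : ℝ × S => (a q.1, F (χ q.1) q.2)) (Icc s₁ s' ×ˢ univ) :=
          (ha.comp contMDiffOn_fst fun q hq => ⟨hs₁0.trans hq.1.1, hq.1.2.trans hs1⟩).prodMk h1
        have h3 := P.smooth.comp h2 fun q hq => ⟨hPs₁ _ hq.1, hFb _ hq.1 _⟩
        have hsub : ∀ q : ℝ × S, q ∈ (Icc 0 s' ×ˢ univ) ∩ (Ioi s₁ ×ˢ univ) → q ∈ Icc s₁ s' ×ˢ univ :=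
          fun q hq => ⟨⟨(mem_Ioi.1 hq.2.1).le, hq.1.1.2⟩, mem_univ _⟩
        exact (h3.mono hsub).congr fun q hq => congrFun (e2 q.1 (hsub q hq).1) q.2
    · intro t ht
      rcases lt_or_ge t c with htc | htc
      · rw [e1 t htc]
        exact hFp t ⟨ht.1, (htc.trans hc2).le⟩
      · have ht' : t ∈ Icc s₁ s' := ⟨(hc1.trans_le htc).le, ht.2⟩
        have hχt := hχ t ht'.1
        rw [e2 t ht']
        exact (hFp (χ t) ⟨hs₁0.trans hχt.1, hχt.2⟩).transport hf P
          (hPs₁ _ ⟨hχt.1, hχt.2.trans hss'⟩) (hPs₁ t ht')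
    · rw [e1 0 (hs₁0.trans_lt hc1), hF0]

omit [TopologicalSpace B] [ChartedSpace (EuclideanHalfSpace 2) B] in
theorem HasTrivializationOn.mono {f : X → B} {a : ℝ → B} {ι : S → X} {s s' : ℝ} (h : s' ≤ s)
    (hs : HasTrivializationOn f a ι s) : HasTrivializationOn f a ι s' := by
  obtain ⟨F, hF, hFp, hF0⟩ := hs
  exact ⟨F, hF.mono (prod_mono (Icc_subset_Icc le_rfl h) subset_rfl),
    fun t ht => hFp t ⟨ht.1, ht.2.trans h⟩, hF0⟩

/-- Trivializations exist along every smooth path of regular values. -/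
theorem hasTrivializationOn_one {f : X → B} (hf : Continuous f) {a : ℝ → B} {ι : S → X}
    (ha : ContMDiffOn 𝓘(ℝ, ℝ) (𝓡∂ 2) ∞ a (Icc 0 1))
    (hP : ∀ t ∈ Icc (0 : ℝ) 1, ∃ P : FiberTransport f, a t ∈ P.base)
    (hι : IsFiberParam f (a 0) ι) : HasTrivializationOn f a ι 1 := by
  have h0 : HasTrivializationOn f a ι 0 := by
    refine ⟨fun _ => ι, (hι.smooth.comp contMDiff_snd).contMDiffOn, fun t ht => ?_, rfl⟩
    rwa [le_antisymm ht.2 ht.1]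
  -- Connectedness of `[0,1]` for the transitive relation "a trivialization up to `s` gives one up
  -- to `s'`", which holds both ways for nearby times.
  refine isPreconnected_Icc.induction₂' (s := Icc (0 : ℝ) 1)
    (fun s s' => HasTrivializationOn f a ι s → HasTrivializationOn f a ι s') ?_
    (fun _ _ _ _ _ _ h h' => h' ∘ h) (left_mem_Icc.2 zero_le_one) (right_mem_Icc.2 zero_le_one) h0
  intro t ht
  obtain ⟨P, hPt⟩ := hP t ht
  obtain ⟨ε, hε, hball⟩ := Metric.mem_nhdsWithin_iff.1
    ((ha.continuousOn t ht).eventually (P.isOpen_base.mem_nhds hPt))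
  have key : ∀ s ∈ Icc (0 : ℝ) 1, ∀ s' ∈ Icc (0 : ℝ) 1, s ∈ Metric.ball t ε → s' ∈ Metric.ball t ε →
      HasTrivializationOn f a ι s → HasTrivializationOn f a ι s' := by
    intro s hs s' hs' hsb hsb' h
    rcases le_total s' s with hle | hle
    · exact h.mono hle
    · refine h.extend hf ha P hs.1 hle hs'.2 fun u hu => hball ⟨?_, hs.1.trans hu.1, hu.2.trans hs'.2⟩
      exact (convex_ball t ε).ordConnected.out hsb hsb' hu
  filter_upwards [self_mem_nhdsWithin, nhdsWithin_le_nhds (Metric.ball_mem_nhds t hε)] with s hs hsb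
  exact ⟨key t ht s hs (Metric.mem_ball_self hε) hsb, key s hs t ht hsb (Metric.mem_ball_self hε)⟩

end PathTrivialization

end

noncomputable section
open Filter

/-! ### Smooth representatives of homotopy classes of paths -/

section SmoothLoops

/-- Every point of a manifold has arbitrarily small neighbourhoods in which any two points are
joined by a smooth path that is constant near its ends, and in which all paths with the same ends
are homotopic to it. -/
theorem exists_smooth_path_nhds {E H M : Type*} [NormedAddCommGroup E] [NormedSpace ℝ E]
    [TopologicalSpace H] (I : ModelWithCorners ℝ E H) [TopologicalSpace M] [ChartedSpace H M]
    [IsManifold I ∞ M] (p : M) {U : Set M} (hU : U ∈ 𝓝 p) :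
    ∃ W : Set M, IsOpen W ∧ p ∈ W ∧ W ⊆ U ∧ ∀ x ∈ W, ∀ y ∈ W, ∃ c : ℝ → M,
      ContMDiff 𝓘(ℝ, ℝ) I ∞ c ∧ (∀ t, c t ∈ W) ∧ (∀ t ≤ 1 / 3, c t = x) ∧ (∀ t ≥ 2 / 3, c t = y) ∧
      ∀ γ : unitInterval → M, Continuous γ → (∀ t, γ t ∈ W) → γ 0 = x → γ 1 = y →
        ∃ h : unitInterval × unitInterval → M, Continuous h ∧ (∀ q, h q ∈ W) ∧
          (∀ t, h (0, t) = γ t) ∧ (∀ t, h (1, t) = c t) ∧ (∀ s, h (s, 0) = x) ∧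
          ∀ s, h (s, 1) = y := by
  set φ := extChartAt I p with hφ
  have h1 : φ.target ∈ 𝓝[range I] (φ p) := extChartAt_target_mem_nhdsWithin p
  have h2 : φ.symm ⁻¹' U ∈ 𝓝[range I] (φ p) := by
    refine nhdsWithin_le_nhds ((continuousAt_extChartAt_symm p).preimage_mem_nhds ?_)
    rwa [extChartAt_to_inv p]
  obtain ⟨r, hr, hball⟩ := Metric.mem_nhdsWithin_iff.1 (inter_mem h1 h2)
  have hconv : Convex ℝ (Metric.ball (φ p) r ∩ range I) := (convex_ball _ _).inter I.convex_range
  set C := Metric.ball (φ p) r ∩ range I with hC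
  set W := φ.source ∩ φ ⁻¹' Metric.ball (φ p) r with hW
  have hCW : ∀ z ∈ C, φ.symm z ∈ W := fun z hz =>
    ⟨φ.map_target (hball hz).1, by rw [mem_preimage, φ.right_inv (hball hz).1]; exact hz.1⟩
  have hWC : ∀ x ∈ W, φ x ∈ C := fun x hx =>
    ⟨hx.2, extChartAt_target_subset_range p (φ.map_source hx.1)⟩
  have hsymm : ContMDiffOn 𝓘(ℝ, E) I ∞ φ.symm φ.target := contMDiffOn_extChartAt_symm p
  have hCt : C ⊆ φ.target := fun z hz => (hball hz).1
  refine ⟨W, (continuousOn_extChartAt p).isOpen_inter_preimage (isOpen_extChartAt_source p)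
    Metric.isOpen_ball, ⟨mem_extChartAt_source p, Metric.mem_ball_self hr⟩, ?_, ?_⟩
  · intro x hx
    have := (hball (hWC x hx)).2
    rwa [mem_preimage, φ.left_inv hx.1] at this
  intro x hx y hy
  -- `σ` is `0` up to `1/3` and `1` from `2/3` on, so the segment in the chart rests at its ends.
  set σ : ℝ → ℝ := fun t => Real.smoothTransition (3 * t - 1) with hσ
  have hσs : ContDiff ℝ ∞ σ :=
    Real.smoothTransition.contDiff.comp ((contDiff_const.mul contDiff_id).sub contDiff_const)
  set ℓ : ℝ → E := fun t => (1 - σ t) • φ x + σ t • φ y with hℓ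
  have hℓs : ContDiff ℝ ∞ ℓ :=
    ((contDiff_const.sub hσs).smul contDiff_const).add (hσs.smul contDiff_const)
  have hℓC : ∀ t, ℓ t ∈ C := fun t =>
    hconv (hWC x hx) (hWC y hy) (sub_nonneg.2 (Real.smoothTransition.le_one _))
      (Real.smoothTransition.nonneg _) (sub_add_cancel _ _)
  have hℓ0 : ∀ t ≤ 1 / 3, ℓ t = φ x := fun t ht => by
    have : σ t = 0 := Real.smoothTransition.zero_of_nonpos (by linarith)
    simp [hℓ, this]
  have hℓ1 : ∀ t ≥ 2 / 3, ℓ t = φ y := fun t ht => by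
    have : σ t = 1 := Real.smoothTransition.one_of_one_le (by linarith)
    simp [hℓ, this]
  refine ⟨fun t => φ.symm (ℓ t), ?_, fun t => hCW _ (hℓC t), fun t ht => ?_, fun t ht => ?_, ?_⟩
  · rw [← contMDiffOn_univ]
    exact hsymm.comp hℓs.contMDiff.contMDiffOn fun t _ => hCt (hℓC t)
  · exact (congrArg φ.symm (hℓ0 t ht)).trans (φ.left_inv hx.1)
  · exact (congrArg φ.symm (hℓ1 t ht)).trans (φ.left_inv hy.1)
  intro γ hγ hγW hγ0 hγ1
  -- The straight-line homotopy in the convex coordinate set `C`.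
  set k : unitInterval × unitInterval → E :=
    fun q => (1 - (q.1 : ℝ)) • φ (γ q.2) + (q.1 : ℝ) • ℓ q.2 with hk
  have hkC : ∀ q, k q ∈ C := fun q =>
    hconv (hWC _ (hγW q.2)) (hℓC q.2) (sub_nonneg.2 q.1.2.2) q.1.2.1 (sub_add_cancel _ _)
  have hkc : Continuous k := by
    have a1 : Continuous fun q : unitInterval × unitInterval => φ (γ q.2) :=
      ((continuousOn_extChartAt p).comp_continuous hγ fun t => (hγW t).1).comp continuous_snd
    have a2 : Continuous fun q : unitInterval × unitInterval => ℓ q.2 :=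
      hℓs.continuous.comp (continuous_subtype_val.comp continuous_snd)
    have a3 : Continuous fun q : unitInterval × unitInterval => (q.1 : ℝ) :=
      continuous_subtype_val.comp continuous_fst
    exact ((continuous_const.sub a3).smul a1).add (a3.smul a2)
  refine ⟨fun q => φ.symm (k q), ?_, fun q => hCW _ (hkC q), fun t => ?_, fun t => ?_, fun s => ?_,
    fun s => ?_⟩
  · exact hsymm.continuousOn.comp_continuous hkc fun q => hCt (hkC q)
  · simp [hk, φ.left_inv (hγW t).1]
  · simp [hk]
  · have : ℓ 0 = φ x := hℓ0 _ (by norm_num)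
    simp [hk, this, hγ0, ← add_smul, φ.left_inv hx.1]
  · have : ℓ 1 = φ y := hℓ1 _ (by norm_num)
    simp [hk, this, hγ1, ← add_smul, φ.left_inv hy.1]

variable {B : Type*} [TopologicalSpace B] [ChartedSpace (EuclideanHalfSpace 2) B] {D : Set B}

/-- A smooth path in the complement of `D` that is constant near both ends. -/
structure Path.IsSmoothFlat {x y : {z : B // z ∉ D}} (a : Path x y) : Prop where
  smooth : ContMDiff 𝓘(ℝ, ℝ) (𝓡∂ 2) ∞ (fun t : ℝ => (a.extend t : B))
  eq_left : ∀ᶠ t in 𝓝 (0 : ℝ), a.extend t = x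
  eq_right : ∀ᶠ t in 𝓝 (1 : ℝ), a.extend t = y

/-- Near the junction time `1/2` both halves are constant, so the concatenation is smooth there. -/
theorem Path.IsSmoothFlat.trans {x y z : {z : B // z ∉ D}} {a : Path x y} {b : Path y z}
    (ha : a.IsSmoothFlat) (hb : b.IsSmoothFlat) : (a.trans b).IsSmoothFlat := by
  have hs1 : ContMDiff 𝓘(ℝ, ℝ) (𝓡∂ 2) ∞ (fun t : ℝ => (a.extend (2 * t) : B)) :=
    ha.smooth.comp (contDiff_const.mul contDiff_id).contMDiff
  have hs2 : ContMDiff 𝓘(ℝ, ℝ) (𝓡∂ 2) ∞ (fun t : ℝ => (b.extend (2 * t - 1) : B)) :=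
    hb.smooth.comp ((contDiff_const.mul contDiff_id).sub contDiff_const).contMDiff
  have hc1 : ∀ c : ℝ, Tendsto (fun t : ℝ => 2 * t) (𝓝 c) (𝓝 (2 * c)) := fun c =>
    (continuous_const.mul continuous_id).tendsto c
  have hc2 : ∀ c : ℝ, Tendsto (fun t : ℝ => 2 * t - 1) (𝓝 c) (𝓝 (2 * c - 1)) := fun c =>
    ((continuous_const.mul continuous_id).sub continuous_const).tendsto c
  refine ⟨fun t => ?_, ?_, ?_⟩
  · rcases lt_trichotomy t (1 / 2) with ht | rfl | ht
    · refine (hs1 t).congr_of_eventuallyEq ?_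
      filter_upwards [Iio_mem_nhds ht] with s hs
      rw [Path.extend_trans_of_le_half _ _ (mem_Iio.1 hs).le]
    · have e1 : ∀ᶠ t in 𝓝 (1 / 2 : ℝ), a.extend (2 * t) = y := by
        have := hc1 (1 / 2)
        norm_num at this
        exact this.eventually ha.eq_right
      have e2 : ∀ᶠ t in 𝓝 (1 / 2 : ℝ), b.extend (2 * t - 1) = y := by
        have := hc2 (1 / 2)
        norm_num at this
        exact this.eventually hb.eq_left
      refine (contMDiffAt_const (c := (y : B))).congr_of_eventuallyEq ?_
      filter_upwards [e1, e2] with s h1 h2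
      rcases le_total s (1 / 2) with hs | hs
      · rw [Path.extend_trans_of_le_half _ _ hs, h1]
      · rw [Path.extend_trans_of_half_le _ _ hs, h2]
    · refine (hs2 t).congr_of_eventuallyEq ?_
      filter_upwards [Ioi_mem_nhds ht] with s hs
      rw [Path.extend_trans_of_half_le _ _ (mem_Ioi.1 hs).le]
  · have := hc1 0
    rw [mul_zero] at this
    filter_upwards [this.eventually ha.eq_left, Iio_mem_nhds (show (0 : ℝ) < 1 / 2 by norm_num)]
      with s h1 hs
    rw [Path.extend_trans_of_le_half _ _ (mem_Iio.1 hs).le, h1]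
  · have := hc2 1
    norm_num at this
    filter_upwards [this.eventually hb.eq_right, Ioi_mem_nhds (show (1 / 2 : ℝ) < 1 by norm_num)]
      with s h1 hs
    rw [Path.extend_trans_of_half_le _ _ (mem_Ioi.1 hs).le, h1]

/-- Every path in the complement of a closed set is homotopic to a smooth one that is constant near
its ends. -/
theorem Path.exists_isSmoothFlat_homotopic [IsManifold (𝓡∂ 2) ∞ B] (hD : IsClosed D)
    {x y : {z : B // z ∉ D}} (γ : Path x y) : ∃ a : Path x y, a.IsSmoothFlat ∧ a.Homotopic γ := by
  -- Connectedness of `[0,1]` applied to initial segments of `γ`: a smooth replacement up to `s`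
  -- gives one up to any nearby `s'`, by appending a short path in a chart that avoids `D`. If `s' <
  -- s`, that path runs backwards.
  have main : ∀ t : unitInterval, ∃ a : Path (γ 0) (γ t), a.IsSmoothFlat ∧
      a.Homotopic (γ.subpath 0 t) := by
    intro t
    refine PreconnectedSpace.induction₂' (fun s s' : unitInterval =>
      (∃ a : Path (γ 0) (γ s), a.IsSmoothFlat ∧ a.Homotopic (γ.subpath 0 s)) →
      ∃ a : Path (γ 0) (γ s'), a.IsSmoothFlat ∧ a.Homotopic (γ.subpath 0 s')) ?_
      ⟨fun _ _ _ h h' => h' ∘ h⟩ 0 t ?_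
    · intro t₀
      obtain ⟨W, hWo, hpW, hWU, hW⟩ := exists_smooth_path_nhds (𝓡∂ 2) (γ t₀ : B)
        (hD.isOpen_compl.mem_nhds (γ t₀).2)
      have hγc : Continuous fun s => (γ s : B) := continuous_subtype_val.comp γ.continuous
      obtain ⟨ε, hε, hball⟩ := Metric.mem_nhds_iff.1 (hγc.continuousAt.preimage_mem_nhds
        (hWo.mem_nhds hpW))
      have hord : ∀ s ∈ Metric.ball t₀ ε, ∀ s' ∈ Metric.ball t₀ ε, uIcc s s' ⊆ Metric.ball t₀ ε := by
        intro s hs s' hs' u hu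
        rw [Metric.mem_ball, Subtype.dist_eq] at *
        have : (u : ℝ) ∈ uIcc (s : ℝ) s' := by
          rw [mem_uIcc] at *
          exact hu
        exact (convex_ball (t₀ : ℝ) ε).ordConnected.uIcc_subset hs hs' this
      have key : ∀ s ∈ Metric.ball t₀ ε, ∀ s' ∈ Metric.ball t₀ ε,
          (∃ a : Path (γ 0) (γ s), a.IsSmoothFlat ∧ a.Homotopic (γ.subpath 0 s)) →
          ∃ a : Path (γ 0) (γ s'), a.IsSmoothFlat ∧ a.Homotopic (γ.subpath 0 s') := by
        rintro s hs s' hs' ⟨a, ha, hah⟩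
        obtain ⟨c, hcs, hcW, hc0, hc1, hch⟩ := hW _ (hball hs) _ (hball hs')
        have hsub : ∀ u, (γ.subpath s s' u : B) ∈ W := by
          intro u
          have : γ.subpath s s' u ∈ range (γ.subpath s s') := mem_range_self u
          rw [Path.range_subpath] at this
          obtain ⟨v, hv, hvu⟩ := this
          rw [← hvu]
          exact hball (hord s hs s' hs' hv)
        obtain ⟨h, hhc, hhW, hh0, hh1, hhx, hhy⟩ := hch (fun u => (γ.subpath s s' u : B))
          (continuous_subtype_val.comp (γ.subpath s s').continuous) hsub
          (congrArg Subtype.val (γ.subpath s s').source) (congrArg Subtype.val (γ.subpath s s').target)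
        let b : Path (γ s) (γ s') :=
          { toFun := fun u => ⟨c u, hWU (hcW u)⟩
            continuous_toFun := (hcs.continuous.comp continuous_subtype_val).subtype_mk _
            source' := Subtype.ext (hc0 _ (by norm_num))
            target' := Subtype.ext (hc1 _ (by norm_num)) }
        have hbe : ∀ t, (b.extend t : B) = c t := by
          intro t
          rcases le_total t 0 with h0 | h0
          · rw [b.extend_of_le_zero h0, hc0 t (by linarith)]
          rcases le_total 1 t with h1 | h1
          · rw [b.extend_of_one_le h1, hc1 t (by linarith)]
          · rw [b.extend_apply ⟨h0, h1⟩]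
            rfl
        have hb : b.IsSmoothFlat := by
          refine ⟨by simpa only [hbe] using hcs, ?_, ?_⟩
          · filter_upwards [Iio_mem_nhds (show (0 : ℝ) < 1 / 3 by norm_num)] with t ht
            exact Subtype.ext ((hbe t).trans (hc0 t (mem_Iio.1 ht).le))
          · filter_upwards [Ioi_mem_nhds (show (2 / 3 : ℝ) < 1 by norm_num)] with t ht
            exact Subtype.ext ((hbe t).trans (hc1 t (mem_Ioi.1 ht).le))
        have hbh : b.Homotopic (γ.subpath s s') := by
          refine Path.Homotopic.symm ⟨⟨⟨⟨fun q => ⟨h q, hWU (hhW q)⟩, hhc.subtype_mk _⟩, ?_, ?_⟩, ?_⟩⟩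
          · exact fun u => Subtype.ext (hh0 u)
          · exact fun u => Subtype.ext (hh1 u)
          · rintro u v (rfl | rfl)
            · exact (Subtype.ext (hhx u)).trans (γ.subpath s s').source.symm
            · exact (Subtype.ext (hhy u)).trans (γ.subpath s s').target.symm
        exact ⟨a.trans b, ha.trans hb, (hah.hcomp hbh).trans
          ⟨Path.Homotopy.subpathTransSubpath γ 0 s s'⟩⟩
      filter_upwards [Metric.ball_mem_nhds t₀ hε] with s hs
      exact ⟨key _ (Metric.mem_ball_self hε) _ hs, key _ hs _ (Metric.mem_ball_self hε)⟩
    · refine ⟨Path.refl _, ⟨contMDiff_const (c := (γ 0 : B)), ?_, ?_⟩, ?_⟩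
      · exact Eventually.of_forall fun t => rfl
      · exact Eventually.of_forall fun t => rfl
      · rw [Path.subpath_self]
  obtain ⟨a, ha, hah⟩ := main 1
  rw [Path.subpath_zero_one] at hah
  exact ⟨a.cast γ.source.symm γ.target.symm,
    ⟨ha.smooth, by simpa using ha.eq_left, by simpa using ha.eq_right⟩, hah.pathCast _ _⟩

theorem exists_isSmoothLoop [IsManifold (𝓡∂ 2) ∞ B] (hD : IsClosed D) {y : {z : B // z ∉ D}}
    (α : FundamentalGroup {z : B // z ∉ D} y) : ∃ a : Path y y, IsSmoothLoop a ∧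
      FundamentalGroup.fromPath (Path.Homotopic.Quotient.mk a) = α := by
  obtain ⟨γ, hγ⟩ := Path.Homotopic.Quotient.mk_surjective (FundamentalGroup.toPath α)
  obtain ⟨a, ha, hah⟩ := γ.exists_isSmoothFlat_homotopic hD
  refine ⟨a, ha.smooth.contMDiffOn, ?_⟩
  rw [Path.Homotopic.Quotient.eq.2 hah, hγ]

end SmoothLoops

end

noncomputable section
open Filter

/-! ### From a locally constant cocycle to a homomorphism of the fundamental group -/

section MonodromyOfCocycle

/-- The covering space associated with a locally constant cocycle. -/
def cocycleBundle {Y G : Type*} [TopologicalSpace Y] [Group G] [TopologicalSpace G]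
    [DiscreteTopology G] (V : Y → Set Y) (hVo : ∀ i, IsOpen (V i)) (hV : ∀ i, i ∈ V i)
    (c : Y → Y → Y → G) (hc1 : ∀ i, ∀ z ∈ V i, c i i z = 1)
    (hc : ∀ i j k z, z ∈ V i → z ∈ V j → z ∈ V k → c j k z * c i j z = c i k z)
    (hloc : ∀ i j z, z ∈ V i → z ∈ V j → ∀ᶠ z' in 𝓝 z, c i j z' = c i j z) :
    FiberBundleCore Y Y G where
  baseSet := V
  isOpen_baseSet := hVo
  indexAt := id
  mem_baseSet_at := hV
  coordChange i j z v := c i j z * v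
  coordChange_self i z hz v := by rw [hc1 i z hz, one_mul]
  continuousOn_coordChange i j := by
    rintro ⟨z, v⟩ ⟨⟨hi, hj⟩, -⟩
    refine (continuousAt_const (y := c i j z * v)).congr ?_ |>.continuousWithinAt
    have h1 : ∀ᶠ q : Y × G in 𝓝 (z, v), c i j q.1 = c i j z :=
      (continuous_fst.tendsto (z, v)).eventually (hloc i j z hi hj)
    have h2 : ∀ᶠ q : Y × G in 𝓝 (z, v), q.2 = v :=
      (continuous_snd.tendsto (z, v)).eventually (p := fun w => w = v) (by simp [nhds_discrete])
    filter_upwards [h1, h2] with q a1 a2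
    rw [a1, a2]
  coordChange_comp i j k z hz v := by rw [← mul_assoc, hc i j k z hz.1.1 hz.1.2 hz.2]

theorem IsCoveringMap.coe_monodromy_mk {E Y : Type*} [TopologicalSpace E] [TopologicalSpace Y]
    {p : E → Y} (cov : IsCoveringMap p) {x y : Y} (γ : Path x y) (e : p ⁻¹' {x})
    (Γ : C(unitInterval, E)) (hΓ : p ∘ Γ = γ) (h0 : Γ 0 = e) :
    (cov.monodromy (Path.Homotopic.Quotient.mk γ) e : E) = Γ 1 := by
  have h : γ.toContinuousMap 0 = p e := γ.source.trans e.2.symm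
  have := (cov.eq_liftPath_iff' h).2 ⟨hΓ, h0⟩
  rw [this]
  rfl

/-- The monodromy homomorphism of a locally constant cocycle. -/
theorem exists_hom_of_cocycle {Y G : Type*} [TopologicalSpace Y] [Group G] (V : Y → Set Y)
    (hVo : ∀ i, IsOpen (V i)) (hV : ∀ i, i ∈ V i) (c : Y → Y → Y → G)
    (hc1 : ∀ i, ∀ z ∈ V i, c i i z = 1)
    (hc : ∀ i j k z, z ∈ V i → z ∈ V j → z ∈ V k → c j k z * c i j z = c i k z)
    (hloc : ∀ i j z, z ∈ V i → z ∈ V j → ∀ᶠ z' in 𝓝 z, c i j z' = c i j z) (y : Y) :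
    ∃ ρ : FundamentalGroup Y y →* G, ∀ (a : Path y y) (s : unitInterval → Y → G),
      (∀ t i j, a t ∈ V i → a t ∈ V j → s t j = c i j (a t) * s t i) →
      (∀ t i, a t ∈ V i → ∀ᶠ t' in 𝓝 t, s t' i = s t i) → s 0 y = 1 →
      ρ (FundamentalGroup.fromPath (Path.Homotopic.Quotient.mk a)) = s 1 y := by
  -- With the discrete topology on `G` the bundle of the cocycle is a covering.
  let _ : TopologicalSpace G := ⊥
  have : DiscreteTopology G := ⟨rfl⟩
  set Z := cocycleBundle V hVo hV c hc1 hc hloc with hZ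
  have cov : IsCoveringMap Z.proj := FiberBundle.isCoveringMap
  let val : Z.TotalSpace → G := fun e => e.2
  -- continuity of lifts
  have hlift : ∀ {T : Type} [TopologicalSpace T] (a : T → Y) (ha : Continuous a) (s : T → Y → G),
      (∀ t i j, a t ∈ V i → a t ∈ V j → s t j = c i j (a t) * s t i) →
      (∀ t i, a t ∈ V i → ∀ᶠ t' in 𝓝 t, s t' i = s t i) →
      Continuous (fun t => (⟨a t, s t (a t)⟩ : Z.TotalSpace)) := by
    intro T _ a ha s h1 h2
    rw [continuous_iff_continuousAt]
    intro t
    have e1 : ∀ᶠ t' in 𝓝 t, a t' ∈ V (a t) := ha.continuousAt.eventually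
      ((hVo _).mem_nhds (hV _))
    have e2 : ContinuousAt (fun t' => (Z.localTriv (a t)).toOpenPartialHomeomorph.symm
        (a t', s t (a t))) t := by
      refine ContinuousAt.comp (f := fun t' => (a t', s t (a t))) ?_
        (ha.continuousAt.prodMk continuousAt_const)
      refine (Z.localTriv (a t)).toOpenPartialHomeomorph.symm.continuousAt ?_
      exact (Z.mem_localTriv_target (a t) (a t, s t (a t))).2 (hV _)
    refine e2.congr ?_
    filter_upwards [e1, h2 t (a t) (hV _)] with t' a1 a2
    refine (Z.localTriv_symm_apply (a t) _).trans ?_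
    change (⟨a t', c (a t) (a t') (a t') * s t (a t)⟩ : Z.TotalSpace) = ⟨a t', s t' (a t')⟩
    rw [h1 t' (a t) (a t') a1 (hV _), a2]
  -- right multiplication
  let R : G → Z.TotalSpace → Z.TotalSpace := fun g e => ⟨e.1, val e * g⟩
  have hR : ∀ g, Continuous (R g) := by
    intro g
    rw [continuous_iff_continuousAt]
    rintro ⟨x, v⟩
    set τ := Z.localTriv x with hτ
    have hsrc : (⟨x, v⟩ : Z.TotalSpace) ∈ τ.source := (Z.mem_localTriv_source x _).2 (hV x)
    have hτe : ∀ e : Z.TotalSpace, τ e = (e.1, c e.1 x e.1 * val e) := fun e => rfl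
    have e2 : ContinuousAt (fun e => τ.toOpenPartialHomeomorph.symm ((τ e).1, (τ e).2 * g))
        (⟨x, v⟩ : Z.TotalSpace) := by
      have hm : Continuous fun q : Y × G => (q.1, q.2 * g) :=
        continuous_fst.prodMk ((continuous_of_discreteTopology (f := fun w : G => w * g)).comp
          continuous_snd)
      refine ContinuousAt.comp (f := fun e => ((τ e).1, (τ e).2 * g)) ?_
        (hm.continuousAt.comp (τ.continuousOn.continuousAt (τ.open_source.mem_nhds hsrc)))
      refine τ.toOpenPartialHomeomorph.symm.continuousAt ?_
      exact (Z.mem_localTriv_target x _).2 (hV _)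
    refine e2.congr ?_
    filter_upwards [τ.open_source.mem_nhds hsrc] with e he
    have heV : e.1 ∈ V x := (Z.mem_localTriv_source x e).1 he
    refine (Z.localTriv_symm_apply x _).trans ?_
    rw [hτe]
    change (⟨e.1, c x e.1 e.1 * (c e.1 x e.1 * val e * g)⟩ : Z.TotalSpace) = ⟨e.1, val e * g⟩
    rw [mul_assoc, ← mul_assoc, hc _ _ _ _ (hV _) heV (hV _), hc1 _ _ (hV _), one_mul]
  let pt : G → Z.proj ⁻¹' {y} := fun g => ⟨⟨y, g⟩, rfl⟩
  have hpt : ∀ e : Z.proj ⁻¹' {y}, e = pt (val e.1) := by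
    rintro ⟨⟨x, v⟩, hx⟩
    have : x = y := hx
    subst this
    rfl
  -- The transition maps multiply on the left, so right multiplication `R g` is a well-defined map
  -- of the covering that takes lifts of paths to lifts. Hence monodromy is right equivariant and is
  -- determined by its value at `pt 1`.
  have hmono : ∀ (α : Path.Homotopic.Quotient y y) (g : G),
      val (cov.monodromy α (pt g)).1 = val (cov.monodromy α (pt 1)).1 * g := by
    intro α g
    obtain ⟨a, rfl⟩ := Path.Homotopic.Quotient.mk_surjective α
    have h : a.toContinuousMap 0 = Z.proj (pt 1).1 := a.source
    have hl := cov.liftPath_lifts a.toContinuousMap (pt 1).1 h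
    have h0 := cov.liftPath_zero a.toContinuousMap (pt 1).1 h
    set Γ := cov.liftPath a.toContinuousMap (pt 1).1 h
    rw [cov.coe_monodromy_mk a (pt 1) Γ hl h0,
      cov.coe_monodromy_mk a (pt g) ⟨fun t => R g (Γ t), (hR g).comp Γ.continuous⟩ hl]
    · rfl
    · change R g (Γ 0) = _
      rw [h0]
      exact congrArg (fun w : G => (⟨y, w⟩ : Z.TotalSpace)) (one_mul g)
  refine ⟨MonoidHom.mk' (fun α => val (cov.monodromy (FundamentalGroup.toPath α) (pt 1)).1) ?_, ?_⟩
  · intro α β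
    -- In the product `α * β` the loop `β` is run first, so the monodromy of `β` acts first and
    -- equivariance yields the product in the same order.
    refine (congrArg (fun e : Z.proj ⁻¹' {y} => val e.1) (cov.monodromy_trans_apply
      (FundamentalGroup.toPath β) (FundamentalGroup.toPath α) (pt 1))).trans ?_
    refine Eq.trans ?_ (hmono (FundamentalGroup.toPath α) _)
    exact congrArg (fun e => val (cov.monodromy (FundamentalGroup.toPath α) e).1) (hpt _)
  -- The values `s t i` are the coordinates of a lift of `a` that starts at `pt 1`; its end point is
  -- the monodromy.
  · intro a s h1 h2 h0
    refine (congrArg val (cov.coe_monodromy_mk a (pt 1)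
      ⟨_, hlift a a.continuous s h1 h2⟩ rfl ?_)).trans ?_
    · have : ∀ x, x = y → (⟨x, s 0 x⟩ : Z.TotalSpace) = (pt 1).1 := by
        rintro x rfl
        exact congrArg (fun w : G => (⟨x, w⟩ : Z.TotalSpace)) h0
      exact this _ a.source
    · change s 1 (a 1) = s 1 y
      rw [a.target]

end MonodromyOfCocycle

end

noncomputable section
open Filter

/-! ### Existence of the monodromy representation -/

section Monodromy

variable {X B : Type*} [TopologicalSpace X] [ChartedSpace (EuclideanHalfSpace 4) X]
  [TopologicalSpace B] [ChartedSpace (EuclideanHalfSpace 2) B]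
  {N : Type*} [TopologicalSpace N] [ChartedSpace (EuclideanSpace ℝ (Fin 2)) N]

open scoped Classical in
/-- The mapping class `[k⁻¹ ∘ k']` of two parametrizations of one fibre. -/
def fiberClass (k k' : N → X) : MappingClassGroup (⊤ : Subgroup (SurfaceDiffeo N)) :=
  if h : ∃ φ : SurfaceDiffeo N, ∀ p, k (φ p) = k' p then mappingClass ⟨h.choose, trivial⟩ else 1

omit [TopologicalSpace X] [ChartedSpace (EuclideanHalfSpace 4) X] in
theorem fiberClass_eq {k k' : N → X} (hk : Function.Injective k) (φ : SurfaceDiffeo N)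
    (h : ∀ p, k (φ p) = k' p) : fiberClass k k' =
      mappingClass (⟨φ, trivial⟩ : (⊤ : Subgroup (SurfaceDiffeo N))) := by
  have hex : ∃ φ : SurfaceDiffeo N, ∀ p, k (φ p) = k' p := ⟨φ, h⟩
  have : hex.choose = φ := Diffeomorph.ext fun p => hk ((hex.choose_spec p).trans (h p).symm)
  rw [fiberClass, dif_pos hex]
  congr 2

omit [TopologicalSpace X] [ChartedSpace (EuclideanHalfSpace 4) X] in
theorem fiberClass_self {k : N → X} (hk : Function.Injective k) : fiberClass k k = 1 :=
  fiberClass_eq hk 1 fun _ => rfl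

variable [CompactSpace N] [T2Space X]

omit [TopologicalSpace B] [ChartedSpace (EuclideanHalfSpace 2) B] in
theorem IsFiberParam.exists_family {f : X → B} {b : ℝ → B} {k k' : ℝ → N → X}
    (hks : ContMDiffOn (𝓘(ℝ, ℝ).prod (𝓡 2)) (𝓡∂ 4) ∞ (fun q : ℝ × N => k q.1 q.2) (Icc 0 1 ×ˢ univ))
    (hks' : ContMDiffOn (𝓘(ℝ, ℝ).prod (𝓡 2)) (𝓡∂ 4) ∞ (fun q : ℝ × N => k' q.1 q.2)
      (Icc 0 1 ×ˢ univ)) (hk : ∀ t ∈ Icc (0 : ℝ) 1, IsFiberParam f (b t) (k t))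
    (hk' : ∀ t ∈ Icc (0 : ℝ) 1, IsFiberParam f (b t) (k' t)) :
    ∃ h : ℝ → SurfaceDiffeo N, SmoothFamily (fun t p => h t p) ∧
      SmoothFamily (fun t p => (h t).symm p) ∧ ∀ t ∈ Icc (0 : ℝ) 1, ∀ p, k t (h t p) = k' t p :=
  exists_diffeo_family_comp_eq hks hks' (fun t ht => (hk t ht).injective)
    (fun t ht => (hk' t ht).injective) (fun t ht => (hk t ht).immersion)
    (fun t ht => (hk' t ht).immersion) fun t ht => (hk t ht).range_eq.trans (hk' t ht).range_eq.symm

omit [TopologicalSpace B] [ChartedSpace (EuclideanHalfSpace 2) B] in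
theorem IsFiberParam.exists_diffeo {f : X → B} {z : B} {k k' : N → X} (hk : IsFiberParam f z k)
    (hk' : IsFiberParam f z k') : ∃ φ : SurfaceDiffeo N, ∀ p, k (φ p) = k' p := by
  obtain ⟨h, -, -, hh⟩ := IsFiberParam.exists_family (f := f) (b := fun _ => z) (k := fun _ => k)
    (k' := fun _ => k') (hk.smooth.comp contMDiff_snd).contMDiffOn
    (hk'.smooth.comp contMDiff_snd).contMDiffOn (fun _ _ => hk) fun _ _ => hk'
  exact ⟨h 0, hh 0 (left_mem_Icc.2 zero_le_one)⟩

omit [TopologicalSpace B] [ChartedSpace (EuclideanHalfSpace 2) B] in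
theorem IsFiberParam.fiberClass_mul {f : X → B} {z : B} {k k' k'' : N → X}
    (hk : IsFiberParam f z k) (hk' : IsFiberParam f z k') (hk'' : IsFiberParam f z k'') :
    fiberClass k k' * fiberClass k' k'' = fiberClass k k'' := by
  obtain ⟨φ, hφ⟩ := hk.exists_diffeo hk'
  obtain ⟨ψ, hψ⟩ := hk'.exists_diffeo hk''
  rw [fiberClass_eq hk.injective φ hφ, fiberClass_eq hk'.injective ψ hψ,
    fiberClass_eq hk.injective (φ * ψ) fun p => by rw [SurfaceDiffeo.mul_apply, hφ, hψ]]
  rfl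

omit [TopologicalSpace B] [ChartedSpace (EuclideanHalfSpace 2) B] in
-- The diffeomorphisms comparing `k t` with `k' t` form an isotopy. This is the source of all local
-- constancy below.
theorem IsFiberParam.fiberClass_family {f : X → B} {b : ℝ → B} {k k' : ℝ → N → X}
    (hks : ContMDiffOn (𝓘(ℝ, ℝ).prod (𝓡 2)) (𝓡∂ 4) ∞ (fun q : ℝ × N => k q.1 q.2) (Icc 0 1 ×ˢ univ))
    (hks' : ContMDiffOn (𝓘(ℝ, ℝ).prod (𝓡 2)) (𝓡∂ 4) ∞ (fun q : ℝ × N => k' q.1 q.2)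
      (Icc 0 1 ×ˢ univ)) (hk : ∀ t ∈ Icc (0 : ℝ) 1, IsFiberParam f (b t) (k t))
    (hk' : ∀ t ∈ Icc (0 : ℝ) 1, IsFiberParam f (b t) (k' t)) :
    fiberClass (k 1) (k' 1) = fiberClass (k 0) (k' 0) := by
  obtain ⟨h, h1, h2, hh⟩ := IsFiberParam.exists_family hks hks' hk hk'
  have m0 := left_mem_Icc.2 (zero_le_one (α := ℝ))
  have m1 := right_mem_Icc.2 (zero_le_one (α := ℝ))
  rw [fiberClass_eq (hk 0 m0).injective (h 0) (hh 0 m0),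
    fiberClass_eq (hk 1 m1).injective (h 1) (hh 1 m1)]
  exact ((mappingClass_eq_iff _ _).2 ⟨h, h1, h2, rfl, rfl⟩).symm

omit [CompactSpace N] [T2Space X] in
theorem FiberTransport.contMDiffOn_family {f : X → B} (P : FiberTransport f) {b : ℝ → B}
    {s : Set ℝ} (hb : ContMDiffOn 𝓘(ℝ, ℝ) (𝓡∂ 2) ∞ b s) (hbP : ∀ t ∈ s, b t ∈ P.base) {z : B}
    (hz : z ∈ P.base) {k : N → X} (hk : IsFiberParam f z k) :
    ContMDiffOn (𝓘(ℝ, ℝ).prod (𝓡 2)) (𝓡∂ 4) ∞ (fun q : ℝ × N => P.map (b q.1) (k q.2))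
      (s ×ˢ univ) := by
  have h1 : ContMDiffOn (𝓘(ℝ, ℝ).prod (𝓡 2)) ((𝓡∂ 2).prod (𝓡∂ 4)) ∞
      (fun q : ℝ × N => (b q.1, k q.2)) (s ×ˢ univ) :=
    (hb.comp contMDiffOn_fst fun q hq => hq.1).prodMk (hk.smooth.comp contMDiff_snd).contMDiffOn
  exact P.smooth.comp h1 fun q hq => ⟨hbP _ hq.1, by
    change f (k q.2) ∈ P.base
    rwa [hk.apply_eq]⟩

variable [IsManifold (𝓡∂ 2) ∞ B]

/-- Over the base of each local transport `P i`, one parametrization `κ i` of the fibre over `i` is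
spread out to parametrizations `k i z`. Their comparison classes form a locally constant cocycle,
and along a loop the classes of a trivialization relative to `k i` form a lift to its covering. -/
theorem exists_isMonodromyRepresentation {f : X → B} (hf : Continuous f) {D : Set B}
    (hD : IsClosed D) (hP : ∀ z ∉ D, ∃ P : FiberTransport f, z ∈ P.base) (y : {z : B // z ∉ D})
    {ι : N → X} (hι : IsFiberParam f (y : B) ι) :
    ∃ ρ, IsMonodromyRepresentation f D y ι (⊤ : Subgroup (SurfaceDiffeo N)) ρ := by
  classical
  choose P hPz using fun z : {z : B // z ∉ D} => hP z z.2
  -- The complement of `D` is not assumed connected, so some regular fibres need not be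
  -- diffeomorphic to `N`. `Q` is locally constant by transport, and the cocycle is set to `1` where
  -- it fails.
  let Q : B → Prop := fun z => ∃ k : N → X, IsFiberParam f z k
  have hQ : ∀ i (z w : B), z ∈ (P i).base → w ∈ (P i).base → Q z → Q w := by
    rintro i z w hz hw ⟨k, hk⟩
    exact ⟨_, hk.transport hf (P i) hz hw⟩
  -- Taking `κ y = ι` makes the coordinate at the base point the class relative to `ι` itself.
  obtain ⟨κ, hκy, hκ⟩ : ∃ κ : {z : B // z ∉ D} → N → X, κ y = ι ∧
      ∀ z : {z : B // z ∉ D}, Q z → IsFiberParam f (z : B) (κ z) := by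
    refine ⟨fun z => if z = y then ι else if h : Q z then h.choose else ι, if_pos rfl, ?_⟩
    intro z hz
    by_cases hzy : z = y
    · simp only [if_pos hzy]
      rwa [hzy]
    · simp only [if_neg hzy, dif_pos hz]
      exact hz.choose_spec
  let V : {z : B // z ∉ D} → Set {z : B // z ∉ D} := fun i => Subtype.val ⁻¹' (P i).base
  let k : {z : B // z ∉ D} → B → N → X := fun i z p => (P i).map z (κ i p)
  have hκi : ∀ i (z : B), z ∈ (P i).base → Q z → IsFiberParam f (i : B) (κ i) := fun i z hz hq =>
    hκ i (hQ i z i hz (hPz i) hq)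
  have hk : ∀ i (z : B), z ∈ (P i).base → Q z → IsFiberParam f z (k i z) := fun i z hz hq =>
    (hκi i z hz hq).transport hf (P i) (hPz i) hz
  have hky : k y y = ι := by
    funext p
    change (P y).map y (κ y p) = ι p
    rw [hκy]
    conv_lhs => rw [← hι.apply_eq p]
    exact (P y).map_apply _ (by rw [hι.apply_eq]; exact hPz y)
  let c : {z : B // z ∉ D} → {z : B // z ∉ D} → {z : B // z ∉ D} →
      MappingClassGroup (⊤ : Subgroup (SurfaceDiffeo N)) :=
    fun i j z => if Q z then fiberClass (k j z) (k i z) else 1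
  obtain ⟨ρ, hρ⟩ := exists_hom_of_cocycle V
    (fun i => (P i).isOpen_base.preimage continuous_subtype_val) hPz c
    (fun i z hz => by
      by_cases hq : Q z
      · exact (if_pos hq).trans (fiberClass_self (hk i z hz hq).injective)
      · exact if_neg hq)
    (fun i j l z hi hj hl => by
      by_cases hq : Q z
      · simp only [c, if_pos hq]
        exact (hk l z hl hq).fiberClass_mul (hk j z hj hq) (hk i z hi hq)
      · simp only [c, if_neg hq, one_mul])
    (fun i j z hi hj => by
      -- Nearby points are joined by a smooth path inside the overlap; along it both transported
      -- parametrizations are smooth families, so their comparison class does not change.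
      obtain ⟨W, hWo, hzW, hWU, hW⟩ := exists_smooth_path_nhds (𝓡∂ 2) (z : B)
        (((P i).isOpen_base.inter (P j).isOpen_base).mem_nhds ⟨hi, hj⟩)
      filter_upwards [continuous_subtype_val.continuousAt.preimage_mem_nhds (hWo.mem_nhds hzW)]
        with w hw
      by_cases hq : Q z
      · have hq' : Q w := hQ i z w hi (hWU hw).1 hq
        simp only [c, if_pos hq, if_pos hq']
        obtain ⟨b, hb, hbW, hb0, hb1, -⟩ := hW z hzW w hw
        have hbi : ∀ t, b t ∈ (P i).base := fun t => (hWU (hbW t)).1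
        have hbj : ∀ t, b t ∈ (P j).base := fun t => (hWU (hbW t)).2
        have hbq : ∀ t, Q (b t) := fun t => hQ i z _ hi (hbi t) hq
        have := IsFiberParam.fiberClass_family (f := f) (b := b) (k := fun t => k j (b t))
          (k' := fun t => k i (b t))
          ((P j).contMDiffOn_family hb.contMDiffOn (fun t _ => hbj t) (hPz j) (hκi j z hj hq))
          ((P i).contMDiffOn_family hb.contMDiffOn (fun t _ => hbi t) (hPz i) (hκi i z hi hq))
          (fun t _ => hk j _ (hbj t) (hbq t)) (fun t _ => hk i _ (hbi t) (hbq t))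
        rwa [hb0 0 (by norm_num), hb1 1 (by norm_num)] at this
      · have hq' : ¬ Q w := fun h => hq (hQ i w z (hWU hw).1 hi h)
        simp only [c, if_neg hq, if_neg hq']) y
  refine ⟨ρ, exists_isSmoothLoop hD, ?_, ?_⟩
  · intro a ha
    obtain ⟨F, h1, h2, h3⟩ := hasTrivializationOn_one hf ha
      (fun t _ => hP _ (a.extend t).2) (ι := ι) (by rwa [a.extend_zero])
    exact ⟨F, h1, h2, h3⟩
  · intro a ha F hF
    have hFt : ∀ t : unitInterval, IsFiberParam f (a t : B) (F t) := fun t => by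
      have := hF.fiber t t.2
      rwa [a.extend_apply t.2] at this
    have hy0 : ((a 0 : {z : B // z ∉ D}) : B) = y := by rw [a.source]
    have hy1 : ((a 1 : {z : B // z ∉ D}) : B) = y := by rw [a.target]
    have hF0 : F (0 : unitInterval) = ι := hF.initial
    have hF1 : IsFiberParam f (y : B) (F 1) := by
      have := hFt 1
      rwa [hy1] at this
    obtain ⟨φ, hφ⟩ := hι.exists_diffeo hF1
    refine ⟨⟨φ, trivial⟩, hφ, ?_⟩
    -- The lift has coordinate `[(k i)⁻¹ ∘ F t]`: it is the identity at time `0` and `[ι⁻¹ ∘ F 1]`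
    -- at time `1`. It is locally constant in `t`, as one sees by joining nearby times by a segment.
    refine (hρ a (fun t i => fiberClass (k i (a t)) (F t)) ?_ ?_ ?_).trans ?_
    · intro t i j hi hj
      have hq : Q (a t) := ⟨_, hFt t⟩
      simp only [c, if_pos hq]
      exact ((hk j _ hj hq).fiberClass_mul (hk i _ hi hq) (hFt t)).symm
    · intro t i hi
      have hi' : (a.extend t : B) ∈ (P i).base := by rwa [a.extend_apply t.2]
      have h1 : ∀ᶠ t' in 𝓝[Icc 0 1] (t : ℝ), (a.extend t' : B) ∈ (P i).base :=
        (ha.continuousOn t t.2).eventually ((P i).isOpen_base.mem_nhds hi')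
      obtain ⟨ε, hε, hball⟩ := Metric.mem_nhdsWithin_iff.1 h1
      filter_upwards [Metric.ball_mem_nhds t hε] with t' ht'
      let r : ℝ → ℝ := fun u => (1 - u) * t + u * t'
      have hr : ∀ u ∈ Icc (0 : ℝ) 1, r u ∈ Metric.ball (t : ℝ) ε ∩ Icc 0 1 := fun u hu =>
        ((convex_ball (t : ℝ) ε).inter (convex_Icc 0 1)) ⟨Metric.mem_ball_self hε, t.2⟩
          ⟨ht', t'.2⟩ (sub_nonneg.2 hu.2) hu.1 (sub_add_cancel _ _)
      have hrs : ContDiff ℝ ∞ r :=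
        ((contDiff_const.sub contDiff_id).mul contDiff_const).add (contDiff_id.mul contDiff_const)
      have har : ContMDiffOn 𝓘(ℝ, ℝ) (𝓡∂ 2) ∞ (fun u => (a.extend (r u) : B)) (Icc 0 1) :=
        ha.comp hrs.contMDiff.contMDiffOn fun u hu => (hr u hu).2
      have hai : ∀ u ∈ Icc (0 : ℝ) 1, (a.extend (r u) : B) ∈ (P i).base := fun u hu =>
        hball (hr u hu)
      have hq : ∀ u ∈ Icc (0 : ℝ) 1, Q (a.extend (r u)) := fun u hu => ⟨_, hF.fiber _ (hr u hu).2⟩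
      have := IsFiberParam.fiberClass_family (f := f) (b := fun u => (a.extend (r u) : B))
        (k := fun u => k i (a.extend (r u))) (k' := fun u => F (r u))
        ((P i).contMDiffOn_family har hai (hPz i) (hκi i _ (hai 0 (by simp)) (hq 0 (by simp))))
        (ContMDiffOn.comp (t := Icc 0 1 ×ˢ univ) hF.smooth
          (((hrs.contMDiff.comp contMDiff_fst).prodMk contMDiff_snd).contMDiffOn)
            fun q hq => ⟨(hr _ hq.1).2, mem_univ _⟩)
        (fun u hu => hk i _ (hai u hu) (hq u hu)) (fun u hu => hF.fiber _ (hr u hu).2)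
      have e0 : r 0 = t := by simp [r]
      have e1 : r 1 = t' := by simp [r]
      simp only [e0, e1] at this
      rwa [a.extend_apply t.2, a.extend_apply t'.2] at this
    · rw [hy0, hky, hF0]
      exact fiberClass_self hι.injective
    · rw [hy1, hky]
      exact fiberClass_eq hι.injective φ hφ

end Monodromy

end

noncomputable section
open Filter

/-! ### Orientations of Euclidean space as signs -/

section OrientationSigns

variable {n : ℕ}

open scoped Classical in
/-- The sign of an orientation of `ℝⁿ` with respect to the standard one. -/
def orientationSign (o : Orientation ℝ (EuclideanSpace ℝ (Fin n)) (Fin n)) : SignType :=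
  if o = (EuclideanSpace.basisFun (Fin n) ℝ).toBasis.orientation then 1 else -1

theorem orientationSign_mul_self (o : Orientation ℝ (EuclideanSpace ℝ (Fin n)) (Fin n)) :
    orientationSign o * orientationSign o = 1 := by
  unfold orientationSign
  split_ifs <;> decide

theorem orientationSign_neg (o : Orientation ℝ (EuclideanSpace ℝ (Fin n)) (Fin n)) :
    orientationSign (-o) = -orientationSign o := by
  unfold orientationSign
  set s := (EuclideanSpace.basisFun (Fin n) ℝ).toBasis.orientation
  have h := o.eq_or_eq_neg s (by simp)
  by_cases h1 : o = s
  · have h2 : -o ≠ s := by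
      rw [h1]
      exact (Module.Ray.ne_neg_self s).symm
    rw [if_pos h1, if_neg h2]
  · have h2 : -o = s := by
      rw [h.resolve_left h1]
      exact neg_neg s
    rw [if_neg h1, if_pos h2, neg_neg]

theorem orientationSign_injective :
    Function.Injective (orientationSign : Orientation ℝ (EuclideanSpace ℝ (Fin n)) (Fin n) → _) := by
  intro o o' h
  refine (o.eq_or_eq_neg o' (by simp)).resolve_right fun h' => ?_
  rw [h', orientationSign_neg] at h
  have := orientationSign_mul_self o'
  revert h this
  generalize orientationSign o' = a
  revert a
  decide

/-- All orientation arguments are reduced to identities in `SignType` by this criterion. A singular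
`L` is excluded automatically: its determinant has sign `0`, and the sign of an orientation is `±1`.
-/
theorem mapsOrientation_iff (L : EuclideanSpace ℝ (Fin n) →L[ℝ] EuclideanSpace ℝ (Fin n))
    (o o' : Orientation ℝ (EuclideanSpace ℝ (Fin n)) (Fin n)) :
    MapsOrientation L o o' ↔ SignType.sign L.det * orientationSign o = orientationSign o' := by
  have key : ∀ e : EuclideanSpace ℝ (Fin n) ≃ₗ[ℝ] EuclideanSpace ℝ (Fin n),
      orientationSign (Orientation.map (Fin n) e o) =
        SignType.sign (LinearMap.det (e : EuclideanSpace ℝ (Fin n) →ₗ[ℝ] _)) *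
          orientationSign o := by
    intro e
    have hcard : Fintype.card (Fin n) = Module.finrank ℝ (EuclideanSpace ℝ (Fin n)) := by simp
    rcases lt_or_gt_of_ne e.isUnit_det'.ne_zero with hd | hd
    · rw [(o.map_eq_neg_iff_det_neg e hcard).2 hd, sign_neg hd, orientationSign_neg, neg_one_mul]
    · rw [(o.map_eq_iff_det_pos e hcard).2 hd, sign_pos hd, one_mul]
  constructor
  · rintro ⟨e, he, rfl⟩
    have hL : (e : EuclideanSpace ℝ (Fin n) →ₗ[ℝ] EuclideanSpace ℝ (Fin n)) = L :=
      LinearMap.ext he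
    rw [key, hL]
  · intro h
    have hd : LinearMap.det (L : EuclideanSpace ℝ (Fin n) →ₗ[ℝ] _) ≠ 0 := by
      intro h0
      have h1 : L.det = 0 := h0
      have := orientationSign_mul_self o'
      rw [← h, h1, sign_zero, zero_mul, zero_mul] at this
      exact zero_ne_one this
    refine ⟨LinearMap.equivOfDetNeZero _ hd, fun v => rfl, orientationSign_injective ?_⟩
    rw [key, ← h]
    rfl

end OrientationSigns

/-! ### Continuous orientations along a map -/

section SignsAlongMaps

variable {E : Type*} [NormedAddCommGroup E] [NormedSpace ℝ E]
  {E' : Type*} [NormedAddCommGroup E'] [NormedSpace ℝ E']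
  {E'' : Type*} [NormedAddCommGroup E''] [NormedSpace ℝ E'']
  {H : Type*} [TopologicalSpace H] {H' : Type*} [TopologicalSpace H'] {H'' : Type*}
  [TopologicalSpace H'']
  (I : ModelWithCorners ℝ E H) (I' : ModelWithCorners ℝ E' H') (I'' : ModelWithCorners ℝ E'' H'')
  {M : Type*} [TopologicalSpace M] [ChartedSpace H M]
  {M' : Type*} [TopologicalSpace M'] [ChartedSpace H' M']
  {M'' : Type*} [TopologicalSpace M''] [ChartedSpace H'' M'']
  {T : Type*} [TopologicalSpace T]

theorem ContinuousLinearMap.det_comp (L L' : E →L[ℝ] E) : (L.comp L').det = L.det * L'.det :=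
  LinearMap.det_comp (L : E →ₗ[ℝ] E) (L' : E →ₗ[ℝ] E)

/-- The derivative of `F` at `p`, as a linear map between the model spaces. -/
def modelDeriv (F : M → M') (p : M) : E →L[ℝ] E' := mfderiv I I' F p

variable {I I' I''}

theorem modelDeriv_comp {F : M' → M''} {G : M → M'} {p : M}
    (hF : MDifferentiableAt I' I'' F (G p)) (hG : MDifferentiableAt I I' G p) :
    modelDeriv I I'' (F ∘ G) p = (modelDeriv I' I'' F (G p)).comp (modelDeriv I I' G p) :=
  mfderiv_comp p hF hG

variable [IsManifold I 1 M] [IsManifold I' 1 M']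

variable (I) in
/-- The sign of the change of trivializations of the tangent bundle from the one centred at `x` to
the one centred at `x₀`. -/
def chartSign (x₀ x : M) : SignType := SignType.sign (tangentCoordChange I x x₀ x).det

theorem tangentCoordChange_self_eq (x : M) :
    tangentCoordChange I x x x = ContinuousLinearMap.id ℝ E := by
  ext v
  exact tangentCoordChange_self (mem_extChartAt_source x)

theorem tangentCoordChange_comp_symm {x₀ x : M} (h : x ∈ (extChartAt I x₀).source) :
    (tangentCoordChange I x₀ x x).comp (tangentCoordChange I x x₀ x) =
      ContinuousLinearMap.id ℝ E := by
  ext v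
  refine (tangentCoordChange_comp ⟨⟨mem_extChartAt_source x, h⟩, mem_extChartAt_source x⟩).trans ?_
  exact tangentCoordChange_self (mem_extChartAt_source x)

theorem chartSign_self (x : M) : chartSign I x x = 1 := by
  rw [chartSign, tangentCoordChange_self_eq]
  have : (ContinuousLinearMap.id ℝ E).det = 1 := LinearMap.det_id
  rw [this, sign_one]

theorem sign_det_tangentCoordChange_mul {x₀ x : M} (h : x ∈ (extChartAt I x₀).source) :
    SignType.sign (tangentCoordChange I x₀ x x).det * chartSign I x₀ x = 1 := by
  have h1 : (ContinuousLinearMap.id ℝ E).det = 1 := LinearMap.det_id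
  rw [chartSign, ← sign_mul, ← ContinuousLinearMap.det_comp, tangentCoordChange_comp_symm h, h1,
    sign_one]

theorem chartSign_mul_self {x₀ x : M} (h : x ∈ (extChartAt I x₀).source) :
    chartSign I x₀ x * chartSign I x₀ x = 1 := by
  have := sign_det_tangentCoordChange_mul h
  revert this
  generalize chartSign I x₀ x = a
  generalize SignType.sign (tangentCoordChange I x₀ x x).det = b
  revert a b
  decide

/-- The two coordinate changes are inverse to each other, and a nonzero sign is its own inverse. -/
theorem sign_det_tangentCoordChange {x₀ x : M} (h : x ∈ (extChartAt I x₀).source) :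
    SignType.sign (tangentCoordChange I x₀ x x).det = chartSign I x₀ x := by
  have := sign_det_tangentCoordChange_mul h
  revert this
  generalize chartSign I x₀ x = a
  generalize SignType.sign (tangentCoordChange I x₀ x x).det = b
  revert a b
  decide

variable (I) in
/-- `w t` is the sign of an orientation of the tangent space at `h t` that varies continuously. -/
def IsSignAlong (h : T → M) (w : T → SignType) : Prop :=
  ∀ t₀, ∀ᶠ t in 𝓝 t₀, w t * chartSign I (h t₀) (h t) = w t₀

theorem IsSignAlong.comp {T' : Type*} [TopologicalSpace T'] {h : T → M} {w : T → SignType}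
    (hw : IsSignAlong I h w) {g : T' → T} (hg : Continuous g) : IsSignAlong I (h ∘ g) (w ∘ g) :=
  fun t₀ => hg.continuousAt.eventually (hw (g t₀))

/-- Both signs change by the same chart sign, which cancels in the product. -/
theorem IsSignAlong.mul_eventuallyEq {h : T → M} (hh : Continuous h) {w w' : T → SignType}
    (hw : IsSignAlong I h w) (hw' : IsSignAlong I h w') (t₀ : T) :
    ∀ᶠ t in 𝓝 t₀, w t * w' t = w t₀ * w' t₀ := by
  filter_upwards [hw t₀, hw' t₀, hh.continuousAt.preimage_mem_nhds
    (extChartAt_source_mem_nhds (I := I) (h t₀))] with t h1 h2 h3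
  rw [← h1, ← h2, mul_mul_mul_comm, chartSign_mul_self h3, mul_one]

theorem IsSignAlong.const_mul {h : T → M} {w : T → SignType} (hw : IsSignAlong I h w)
    (κ : SignType) : IsSignAlong I h (fun t => κ * w t) := fun t₀ => by
  filter_upwards [hw t₀] with t ht
  rw [mul_assoc, ht]

/-- On a connected space, two continuous orientations agree everywhere or nowhere. -/
theorem IsSignAlong.mul_eq [PreconnectedSpace T] {h : T → M} (hh : Continuous h)
    {w w' : T → SignType} (hw : IsSignAlong I h w) (hw' : IsSignAlong I h w') (s t : T) :
    w s * w' s = w t * w' t := by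
  refine PreconnectedSpace.induction₂' (fun s t => w s * w' s = w t * w' t) (fun t₀ => ?_)
    ⟨fun _ _ _ h h' => h.trans h'⟩ s t
  filter_upwards [hw.mul_eventuallyEq hh hw' t₀] with t ht using ⟨ht.symm, ht⟩

/-- The derivative at `x` of the chart at `x₀` is the tangent coordinate change from `x` to `x₀`, so
local constancy in charts is exactly continuity of the sign. -/
theorem ManifoldOrientation.isSignAlong {n : ℕ} {H : Type*} [TopologicalSpace H]
    {I : ModelWithCorners ℝ (EuclideanSpace ℝ (Fin n)) H} {M : Type*} [TopologicalSpace M]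
    [ChartedSpace H M] [IsManifold I 1 M] (o : ManifoldOrientation I M) :
    IsSignAlong I id (fun x => orientationSign (o.atPoint x)) := by
  intro x₀
  obtain ⟨oE, hoE⟩ := o.locallyConstant x₀
  have key : ∀ x ∈ (chartAt H x₀).source,
      modelDeriv I 𝓘(ℝ, EuclideanSpace ℝ (Fin n)) (extChartAt I x₀) x =
        tangentCoordChange I x x₀ x := fun x hx =>
    (TangentBundle.continuousLinearMapAt_trivializationAt hx).symm.trans
      (TangentBundle.continuousLinearMapAt_trivializationAt_eq_core hx)
  have h2 : ∀ x ∈ (chartAt H x₀).source,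
      MapsOrientation (mfderiv I 𝓘(ℝ, EuclideanSpace ℝ (Fin n)) (extChartAt I x₀) x)
        (o.atPoint x) oE → orientationSign (o.atPoint x) * chartSign I x₀ x =
          orientationSign oE := by
    intro x hx h
    have h1 := (mapsOrientation_iff (modelDeriv I 𝓘(ℝ, EuclideanSpace ℝ (Fin n))
      (extChartAt I x₀) x) (o.atPoint x) oE).1 h
    rw [key x hx, mul_comm] at h1
    exact h1
  have h0 := h2 x₀ (mem_chart_source H x₀) hoE.self_of_nhds
  rw [chartSign_self, mul_one] at h0
  filter_upwards [hoE, chart_source_mem_nhds H x₀] with x hx hxs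
  exact (h2 x hxs hx).trans h0.symm

variable {F : Type*} [NormedAddCommGroup F] [NormedSpace ℝ F] {G : Type*} [TopologicalSpace G]
  {J : ModelWithCorners ℝ F G} [ChartedSpace G T] [IsManifold J 1 T]

/-- `modelDeriv` alone need not be continuous, since the preferred chart jumps with the point. It
becomes continuous when read in the tangent trivializations centred at `t₀`. -/
theorem ContMDiffAt.continuousAt_modelDeriv {t₀ : T} {f : T → M → M'} {g : T → M}
    (hf : ContMDiffAt (J.prod I) I' ∞ (Function.uncurry f) (t₀, g t₀))
    (hg : ContMDiffAt J I ∞ g t₀) :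
    ContinuousAt (fun t => (tangentCoordChange I' (f t (g t)) (f t₀ (g t₀)) (f t (g t))).comp
      ((modelDeriv I I' (f t) (g t)).comp (tangentCoordChange I (g t₀) (g t) (g t)))) t₀ := by
  have h := (ContMDiffAt.mfderiv f g hf (hg.of_le (show (0 : WithTop ℕ∞) ≤ ∞ by simp))
    (by simp)).continuousAt
  have hfg : ContinuousAt (fun t => f t (g t)) t₀ :=
    ContinuousAt.comp (f := fun t => (t, g t)) hf.continuousAt
      (continuousAt_id.prodMk hg.continuousAt)
  refine h.congr ?_
  filter_upwards [hg.continuousAt.preimage_mem_nhds (chart_source_mem_nhds H (g t₀)),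
    hfg.preimage_mem_nhds (chart_source_mem_nhds H' (f t₀ (g t₀)))] with t h1 h2
  exact inTangentCoordinates_eq g (fun t => f t (g t)) _ h1 h2

end SignsAlongMaps

/-! ### Transport of continuous orientations by local diffeomorphisms -/

section SignDeriv

variable {E : Type*} [NormedAddCommGroup E] [NormedSpace ℝ E]
  {H : Type*} [TopologicalSpace H] {H' : Type*} [TopologicalSpace H']
  {I : ModelWithCorners ℝ E H} {I' : ModelWithCorners ℝ E H'}
  {M : Type*} [TopologicalSpace M] [ChartedSpace H M] [IsManifold I 1 M]
  {M' : Type*} [TopologicalSpace M'] [ChartedSpace H' M'] [IsManifold I' 1 M']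
  {T : Type*} [TopologicalSpace T]
  {F : Type*} [NormedAddCommGroup F] [NormedSpace ℝ F] {G : Type*} [TopologicalSpace G]
  {J : ModelWithCorners ℝ F G} [ChartedSpace G T] [IsManifold J 1 T]

theorem ContinuousAt.sign_eventuallyEq {φ : T → ℝ} {t₀ : T} (h : ContinuousAt φ t₀)
    (h0 : φ t₀ ≠ 0) : ∀ᶠ t in 𝓝 t₀, SignType.sign (φ t) = SignType.sign (φ t₀) := by
  have := (continuousAt_sign_of_ne_zero h0).comp h
  exact this.eventually (p := fun s => s = SignType.sign (φ t₀)) (by simp [nhds_discrete])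

/-- Local diffeomorphisms carry continuous orientations to continuous orientations. -/
theorem IsSignAlong.map {f : T → M → M'} {g : T → M} {w : T → SignType}
    (hf : ∀ t, ContMDiffAt (J.prod I) I' ∞ (Function.uncurry f) (t, g t)) (hg : ContMDiff J I ∞ g)
    (hdet : ∀ t, (modelDeriv I I' (f t) (g t)).det ≠ 0) (hw : IsSignAlong I g w) :
    IsSignAlong I' (fun t => f t (g t))
      (fun t => SignType.sign (modelDeriv I I' (f t) (g t)).det * w t) := by
  intro t₀
  -- In the fixed trivializations the determinant is continuous and nonzero at `t₀`, so its sign is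
  -- locally constant. It differs from the sign of `modelDeriv` by the chart signs at the source and
  -- at the target.
  have h1 := ContinuousLinearMap.continuous_det.continuousAt.comp
    ((hf t₀).continuousAt_modelDeriv (hg t₀))
  have h2 := ContinuousAt.sign_eventuallyEq h1 (by
    simp only [Function.comp_apply, tangentCoordChange_self_eq, ContinuousLinearMap.comp_id,
      ContinuousLinearMap.id_comp]
    exact hdet t₀)
  filter_upwards [h2, hw t₀, hg.continuous.continuousAt.preimage_mem_nhds
    (extChartAt_source_mem_nhds (I := I) (g t₀))] with t a1 a2 a3
  simp only [Function.comp_apply, tangentCoordChange_self_eq, ContinuousLinearMap.comp_id,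
    ContinuousLinearMap.id_comp, ContinuousLinearMap.det_comp, sign_mul,
    sign_det_tangentCoordChange a3] at a1
  change chartSign I' (f t₀ (g t₀)) (f t (g t)) * _ = _ at a1
  have a4 := chartSign_mul_self a3
  rw [← a1, ← a2]
  revert a4
  generalize chartSign I (g t₀) (g t) = a
  generalize chartSign I' (f t₀ (g t₀)) (f t (g t)) = b
  generalize SignType.sign (modelDeriv I I' (f t) (g t)).det = c
  generalize w t = d
  revert a b c d
  decide

end SignDeriv

end

noncomputable section
open Filter

/-! ### Signs of short exact sequences `0 → ℝ² → ℝ⁴ → ℝ² → 0` -/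

section FrameSign

local notation "E2" => EuclideanSpace ℝ (Fin 2)
local notation "E4" => EuclideanSpace ℝ (Fin 4)

/-- The matrix of a linear map between Euclidean spaces. -/
def euclideanMatrix {m k : ℕ} (L : EuclideanSpace ℝ (Fin m) →L[ℝ] EuclideanSpace ℝ (Fin k)) :
    Matrix (Fin k) (Fin m) ℝ :=
  LinearMap.toMatrix (EuclideanSpace.basisFun (Fin m) ℝ).toBasis
    (EuclideanSpace.basisFun (Fin k) ℝ).toBasis L

theorem euclideanMatrix_comp {l m k : ℕ}
    (K : EuclideanSpace ℝ (Fin m) →L[ℝ] EuclideanSpace ℝ (Fin k))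
    (L : EuclideanSpace ℝ (Fin l) →L[ℝ] EuclideanSpace ℝ (Fin m)) :
    euclideanMatrix (K.comp L) = euclideanMatrix K * euclideanMatrix L :=
  LinearMap.toMatrix_comp _ _ _ (K : EuclideanSpace ℝ (Fin m) →ₗ[ℝ] EuclideanSpace ℝ (Fin k))
    (L : EuclideanSpace ℝ (Fin l) →ₗ[ℝ] EuclideanSpace ℝ (Fin m))

theorem det_euclideanMatrix {m : ℕ}
    (L : EuclideanSpace ℝ (Fin m) →L[ℝ] EuclideanSpace ℝ (Fin m)) :
    (euclideanMatrix L).det = L.det :=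
  LinearMap.det_toMatrix _ (L : EuclideanSpace ℝ (Fin m) →ₗ[ℝ] EuclideanSpace ℝ (Fin m))

theorem euclideanMatrix_zero {m k : ℕ} :
    euclideanMatrix (0 : EuclideanSpace ℝ (Fin m) →L[ℝ] EuclideanSpace ℝ (Fin k)) = 0 :=
  map_zero (LinearMap.toMatrix (EuclideanSpace.basisFun (Fin m) ℝ).toBasis
    (EuclideanSpace.basisFun (Fin k) ℝ).toBasis)

theorem continuous_euclideanMatrix {m k : ℕ} :
    Continuous (euclideanMatrix : (EuclideanSpace ℝ (Fin m) →L[ℝ] EuclideanSpace ℝ (Fin k)) → _) :=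
  LinearMap.continuous_of_finiteDimensional
    ((LinearMap.toMatrix (EuclideanSpace.basisFun (Fin m) ℝ).toBasis
      (EuclideanSpace.basisFun (Fin k) ℝ).toBasis).toLinearMap ∘ₗ
        ContinuousLinearMap.coeLM ℝ)

/-- The Gram matrix of linearly independent columns is positive definite. -/
theorem det_transpose_mul_euclideanMatrix_pos {m k : ℕ}
    {A : EuclideanSpace ℝ (Fin m) →L[ℝ] EuclideanSpace ℝ (Fin k)} (hA : Function.Injective A) :
    0 < ((euclideanMatrix A).transpose * euclideanMatrix A).det := by
  have hinj : Function.Injective (euclideanMatrix A).mulVec := by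
    intro v w hvw
    have key : ∀ v : Fin m → ℝ, (euclideanMatrix A).mulVec v = A (WithLp.toLp 2 v) := by
      intro v
      ext i
      have := LinearMap.toMatrix_mulVec_repr (EuclideanSpace.basisFun (Fin m) ℝ).toBasis
        (EuclideanSpace.basisFun (Fin k) ℝ).toBasis
        (A : EuclideanSpace ℝ (Fin m) →ₗ[ℝ] EuclideanSpace ℝ (Fin k)) (WithLp.toLp 2 v)
      exact congrFun this i
    rw [key, key] at hvw
    have := hA (WithLp.ofLp_injective 2 hvw)
    exact WithLp.toLp_injective 2 this
  have := (Matrix.PosDef.conjTranspose_mul_self _ hinj).det_pos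
  rwa [Matrix.conjTranspose_eq_transpose_of_trivial] at this

/-- The determinant of `(u, v) ↦ A u + S v`. -/
def colDet (A S : E2 →L[ℝ] E4) : ℝ :=
  ((Matrix.fromCols (euclideanMatrix A) (euclideanMatrix S)).submatrix id
    (finSumFinEquiv (m := 2) (n := 2)).symm).det

/-- The determinant of `x ↦ (Aᵀ x, C x)`. -/
def frameDet (A : E2 →L[ℝ] E4) (C : E4 →L[ℝ] E2) : ℝ :=
  ((Matrix.fromRows (euclideanMatrix A).transpose (euclideanMatrix C)).submatrix
    (finSumFinEquiv (m := 2) (n := 2)).symm id).det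

/-- The product of the block matrices with rows `Aᵀ, C` and columns `A, S` is block triangular with
diagonal `AᵀA, CS`, because `CA = 0`. -/
theorem frameDet_mul_colDet {A : E2 →L[ℝ] E4} {C : E4 →L[ℝ] E2} (h : C.comp A = 0)
    (S : E2 →L[ℝ] E4) : frameDet A C * colDet A S =
      ((euclideanMatrix A).transpose * euclideanMatrix A).det * (C.comp S).det := by
  have h0 : euclideanMatrix C * euclideanMatrix A = 0 := by
    rw [← euclideanMatrix_comp, h, euclideanMatrix_zero]
  rw [frameDet, colDet, ← Matrix.det_mul]
  have h1 := Matrix.submatrix_mul_equiv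
    (Matrix.fromRows (euclideanMatrix A).transpose (euclideanMatrix C))
    (Matrix.fromCols (euclideanMatrix A) (euclideanMatrix S))
    (finSumFinEquiv (m := 2) (n := 2)).symm (Equiv.refl (Fin 4))
    (finSumFinEquiv (m := 2) (n := 2)).symm
  rw [Equiv.coe_refl] at h1
  rw [h1, Matrix.det_submatrix_equiv_self, Matrix.fromRows_mul_fromCols, h0,
    Matrix.det_fromBlocks_zero₂₁, ← det_euclideanMatrix, euclideanMatrix_comp]

theorem colDet_comp_left (G : E4 →L[ℝ] E4) (A S : E2 →L[ℝ] E4) :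
    colDet (G.comp A) (G.comp S) = G.det * colDet A S := by
  rw [colDet, colDet, euclideanMatrix_comp, euclideanMatrix_comp, ← Matrix.mul_fromCols,
    ← det_euclideanMatrix, ← Matrix.det_mul]
  rfl

theorem colDet_comp_right (A S : E2 →L[ℝ] E4) (P : E2 →L[ℝ] E2) :
    colDet (A.comp P) S = colDet A S * P.det := by
  set K : Matrix (Fin 2 ⊕ Fin 2) (Fin 2 ⊕ Fin 2) ℝ := Matrix.fromBlocks (euclideanMatrix P) 0 0 1
    with hK
  have h2 : K.det = P.det := by
    rw [hK, Matrix.det_fromBlocks_zero₂₁, Matrix.det_one, mul_one, det_euclideanMatrix]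
  have h3 : Matrix.fromCols (euclideanMatrix (A.comp P)) (euclideanMatrix S) =
      Matrix.fromCols (euclideanMatrix A) (euclideanMatrix S) * K := by
    rw [hK, Matrix.fromCols_mul_fromBlocks, euclideanMatrix_comp]
    simp
  rw [colDet, h3, ← h2, ← Matrix.det_submatrix_equiv_self (finSumFinEquiv (m := 2) (n := 2)).symm
    K, colDet, ← Matrix.det_mul]
  exact congrArg Matrix.det (Matrix.submatrix_mul_equiv _ K _ _ _).symm

/-- For an exact sequence `0 → ℝ² → ℝ⁴ → ℝ² → 0` with maps `A` and `C`, the sign of the standard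
orientation of `ℝ⁴` with respect to those of the outer terms. -/
def frameSign (A : E2 →L[ℝ] E4) (C : E4 →L[ℝ] E2) : SignType := SignType.sign (frameDet A C)

/-- `frameDet` needs no splitting and is continuous in `(A, C)`; `colDet` behaves well under changes
of basis. For a splitting `S` of `C`, this identity says that they have the same sign. -/
theorem frameSign_mul_sign_colDet {A : E2 →L[ℝ] E4} {C : E4 →L[ℝ] E2}
    (hA : Function.Injective A) (h : C.comp A = 0) (S : E2 →L[ℝ] E4) :
    frameSign A C * SignType.sign (colDet A S) = SignType.sign (C.comp S).det := by
  rw [frameSign, ← sign_mul, frameDet_mul_colDet h, sign_mul,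
    sign_pos (det_transpose_mul_euclideanMatrix_pos hA), one_mul]

theorem frameSign_ne_zero {A : E2 →L[ℝ] E4} {C : E4 →L[ℝ] E2} (hA : Function.Injective A)
    (hC : Function.Surjective C) (h : C.comp A = 0) : frameSign A C ≠ 0 := by
  obtain ⟨S, hS⟩ := C.exists_rightInverse_of_surjective (LinearMap.range_eq_top.2 hC)
  intro h0
  have := frameSign_mul_sign_colDet hA h S
  have h1 : (ContinuousLinearMap.id ℝ E2).det = 1 := LinearMap.det_id
  rw [h0, hS, h1, sign_one, zero_mul] at this
  exact zero_ne_one this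

/-- If `S` splits `C`, then `G ∘ S` is a test map for the transformed sequence: its composition with
the new surjection is `M`. The block determinant changes by `det G * det P`. -/
theorem frameSign_comp {A : E2 →L[ℝ] E4} {C : E4 →L[ℝ] E2} (hA : Function.Injective A)
    (hC : Function.Surjective C) (h : C.comp A = 0) {G G' : E4 →L[ℝ] E4} {P M : E2 →L[ℝ] E2}
    (hG : G'.comp G = ContinuousLinearMap.id ℝ E4) (hP : P.det ≠ 0) :
    frameSign (G.comp (A.comp P)) (M.comp (C.comp G')) =
      SignType.sign G.det * SignType.sign P.det * SignType.sign M.det * frameSign A C := by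
  obtain ⟨S, hS⟩ := C.exists_rightInverse_of_surjective (LinearMap.range_eq_top.2 hC)
  have hG' : ∀ v, G' (G v) = v := fun v => congrArg (fun L => L v) hG
  have hGi : Function.Injective G := Function.LeftInverse.injective hG'
  have hPi : Function.Injective P :=
    (LinearMap.equivOfDetNeZero (P : E2 →ₗ[ℝ] E2) hP).injective
  have h1 := frameSign_mul_sign_colDet hA h S
  have h2 := frameSign_mul_sign_colDet (A := G.comp (A.comp P)) (C := M.comp (C.comp G'))
    (hGi.comp (hA.comp hPi)) (by
      ext1 v
      change M (C (G' (G (A (P v))))) = 0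
      rw [hG', show C (A (P v)) = 0 from congrArg (fun L => L (P v)) h, map_zero]) (G.comp S)
  have h3 : (M.comp (C.comp G')).comp (G.comp S) = M := by
    ext1 v
    change M (C (G' (G (S v)))) = M v
    rw [hG', show C (S v) = v from congrArg (fun L => L v) hS]
  have h4 : (ContinuousLinearMap.id ℝ E2).det = 1 := LinearMap.det_id
  have h5 : SignType.sign G.det ≠ 0 := by
    rw [Ne, sign_eq_zero_iff]
    intro h0
    have h6 : (ContinuousLinearMap.id ℝ E4).det = 1 := LinearMap.det_id
    rw [← hG, ContinuousLinearMap.det_comp, h0, mul_zero] at h6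
    exact zero_ne_one h6
  have h7 : SignType.sign P.det ≠ 0 := by rwa [Ne, sign_eq_zero_iff]
  rw [hS, h4, sign_one] at h1
  rw [h3, colDet_comp_left, colDet_comp_right, sign_mul, sign_mul] at h2
  rw [← h2]
  revert h1 h5 h7
  generalize frameSign A C = a
  generalize frameSign _ _ = b
  generalize SignType.sign (colDet A S) = c
  generalize SignType.sign G.det = d
  generalize SignType.sign P.det = e
  revert a b c d e
  decide

theorem continuous_frameDet :
    Continuous (fun q : (E2 →L[ℝ] E4) × (E4 →L[ℝ] E2) => frameDet q.1 q.2) := by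
  refine Continuous.matrix_det ?_
  have h1 : Continuous fun q : (E2 →L[ℝ] E4) × (E4 →L[ℝ] E2) => euclideanMatrix q.1 :=
    continuous_euclideanMatrix.comp continuous_fst
  have h2 : Continuous fun q : (E2 →L[ℝ] E4) × (E4 →L[ℝ] E2) => euclideanMatrix q.2 :=
    continuous_euclideanMatrix.comp continuous_snd
  refine Continuous.matrix_submatrix ?_ _ _
  refine continuous_matrix fun i j => ?_
  rcases i with i | i
  · exact h1.matrix_elem j i
  · exact h2.matrix_elem i j

end FrameSign

/-! ### Orientation of the total space from base and fibre -/

section FiberSign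

variable {H₂ H₄ H₂' : Type*} [TopologicalSpace H₂] [TopologicalSpace H₄] [TopologicalSpace H₂']
  {I : ModelWithCorners ℝ (EuclideanSpace ℝ (Fin 2)) H₂}
  {I₄ : ModelWithCorners ℝ (EuclideanSpace ℝ (Fin 4)) H₄}
  {I' : ModelWithCorners ℝ (EuclideanSpace ℝ (Fin 2)) H₂'}
  {N X B : Type*} [TopologicalSpace N] [ChartedSpace H₂ N] [IsManifold I 1 N]
  [TopologicalSpace X] [ChartedSpace H₄ X] [IsManifold I₄ 1 X]
  [TopologicalSpace B] [ChartedSpace H₂' B] [IsManifold I' 1 B]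
  {T : Type*} [TopologicalSpace T]
  {F : Type*} [NormedAddCommGroup F] [NormedSpace ℝ F] {G : Type*} [TopologicalSpace G]
  {J : ModelWithCorners ℝ F G} [ChartedSpace G T] [IsManifold J 1 T]

/-- Orientations of the base and of the fibre induce one of the total space. -/
theorem IsSignAlong.fiber {k : T → N → X} {g : T → N} {f : X → B} {w u : T → SignType}
    (hk : ContMDiff (J.prod I) I₄ ∞ (Function.uncurry k)) (hg : ContMDiff J I ∞ g)
    (hf : ContMDiff I₄ I' ∞ f)
    (hA : ∀ t, Function.Injective (modelDeriv I I₄ (k t) (g t)))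
    (hC : ∀ t, Function.Surjective (modelDeriv I₄ I' f (k t (g t))))
    (hCA : ∀ t, (modelDeriv I₄ I' f (k t (g t))).comp (modelDeriv I I₄ (k t) (g t)) = 0)
    (hw : IsSignAlong I g w) (hu : IsSignAlong I' (fun t => f (k t (g t))) u) :
    IsSignAlong I₄ (fun t => k t (g t)) (fun t =>
      frameSign (modelDeriv I I₄ (k t) (g t)) (modelDeriv I₄ I' f (k t (g t))) * w t * u t) := by
  intro t₀
  have hc : Continuous fun t => k t (g t) := hk.continuous.comp (continuous_id.prodMk hg.continuous)
  have h1 := ContMDiffAt.continuousAt_modelDeriv (hk (t₀, g t₀)) (hg t₀)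
  have h2 := ContMDiffAt.continuousAt_modelDeriv (J := I₄) (t₀ := k t₀ (g t₀)) (f := fun _ => f)
    (g := id) ((hf.comp contMDiff_snd) _) contMDiffAt_id
  have h3 := ContinuousAt.comp (f := fun t => k t (g t)) h2 hc.continuousAt
  have h4 := (continuous_frameDet.continuousAt.comp (h1.prodMk h3)).sign_eventuallyEq (by
    simp only [Function.comp_apply, tangentCoordChange_self_eq, ContinuousLinearMap.comp_id,
      ContinuousLinearMap.id_comp, id]
    rw [Ne, ← sign_eq_zero_iff]
    exact frameSign_ne_zero (hA t₀) (hC t₀) (hCA t₀))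
  filter_upwards [h4, hw t₀, hu t₀, hg.continuous.continuousAt.preimage_mem_nhds
      (extChartAt_source_mem_nhds (I := I) (g t₀)),
    hc.continuousAt.preimage_mem_nhds (extChartAt_source_mem_nhds (I := I₄) (k t₀ (g t₀))),
    (hf.continuous.comp hc).continuousAt.preimage_mem_nhds
      (extChartAt_source_mem_nhds (I := I') (f (k t₀ (g t₀))))] with t a1 a2 a3 b1 b2 b3
  simp only [Function.comp_apply, tangentCoordChange_self_eq, ContinuousLinearMap.comp_id,
      ContinuousLinearMap.id_comp, id] at a1
  have hP : (tangentCoordChange I (g t₀) (g t) (g t)).det ≠ 0 := by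
    rw [Ne, ← sign_eq_zero_iff]
    intro h0
    have := sign_det_tangentCoordChange_mul b1
    rw [h0, zero_mul] at this
    exact zero_ne_one this
  -- Passing to the trivializations at `t₀` changes bases in fibre, total space and base, so the
  -- frame sign changes by the three chart signs. Those of the fibre and the base cancel against `w`
  -- and `u`.
  have a4 := (frameSign_comp (hA t) (hC t) (hCA t) (tangentCoordChange_comp_symm b2) hP
    (M := tangentCoordChange I' (f (k t (g t))) (f (k t₀ (g t₀))) (f (k t (g t))))).symm.trans a1
  rw [sign_det_tangentCoordChange b1] at a4
  have c1 := chartSign_mul_self b1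
  have c2 := chartSign_mul_self b2
  have c3 : chartSign I' (f (k t₀ (g t₀))) (f (k t (g t))) *
      chartSign I' (f (k t₀ (g t₀))) (f (k t (g t))) = 1 := chartSign_mul_self b3
  change chartSign I₄ _ _ * _ * chartSign I' _ _ * _ = frameSign _ _ at a4
  rw [← a4, ← a2, ← a3]
  revert c1 c2 c3
  generalize frameSign _ _ = a
  generalize chartSign I (g t₀) (g t) = b
  generalize chartSign I₄ (k t₀ (g t₀)) (k t (g t)) = c
  generalize chartSign I' (f (k t₀ (g t₀))) (f (k t (g t))) = d
  generalize w t = e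
  generalize u t = v
  revert a b c d e v
  decide

end FiberSign

end

noncomputable section
open Filter

/-! ### Lifting maps to an orientation double cover by signs -/

section DoubleCover

variable {n : ℕ} {H : Type*} [TopologicalSpace H]
  {I : ModelWithCorners ℝ (EuclideanSpace ℝ (Fin n)) H}
  {M N : Type*} [TopologicalSpace M] [ChartedSpace H M] [TopologicalSpace N] [ChartedSpace H N]

theorem IsLocalDiffeomorph.det_modelDeriv_ne_zero {Θ : M → N} (hΘ : IsLocalDiffeomorph I I ∞ Θ)
    (m : M) : (modelDeriv I I Θ m).det ≠ 0 := by
  let e := hΘ.mfderivToContinuousLinearEquiv (by simp) m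
  let e' : EuclideanSpace ℝ (Fin n) ≃ₗ[ℝ] EuclideanSpace ℝ (Fin n) := e.toLinearEquiv
  exact e'.isUnit_det'.ne_zero

/-- The sign of the orientation of the tangent space at `Θ m` that `Θ` carries over from `m`. -/
def coverSign (o : ManifoldOrientation I M) (Θ : M → N) (m : M) : SignType :=
  SignType.sign (modelDeriv I I Θ m).det * orientationSign (o.atPoint m)

namespace IsOrientationDoubleCover

variable {o : ManifoldOrientation I M} {Θ : M → N}

theorem coverSign_mul_self (hΘ : IsOrientationDoubleCover o Θ) (m : M) :
    coverSign o Θ m * coverSign o Θ m = 1 := by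
  have h1 : SignType.sign (modelDeriv I I Θ m).det ≠ 0 := by
    rw [Ne, sign_eq_zero_iff]
    exact hΘ.localDiffeo.det_modelDeriv_ne_zero m
  have h2 : orientationSign (o.atPoint m) * orientationSign (o.atPoint m) = 1 :=
    orientationSign_mul_self _
  unfold coverSign
  revert h1 h2
  generalize SignType.sign (modelDeriv I I Θ m).det = a
  generalize orientationSign (o.atPoint m) = b
  revert a b
  decide

/-- With `L = (dΘ_{m₂})⁻¹ ∘ dΘ_{m₁}`, the sign of `det dΘ_{m₁}` is the product of those of `dΘ_{m₂}`
and `L`, and `L` reverses the orientation. -/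
theorem coverSign_eq_neg (hΘ : IsOrientationDoubleCover o Θ) {m₁ m₂ : M} (hne : m₁ ≠ m₂)
    (h : Θ m₁ = Θ m₂) : coverSign o Θ m₁ = -coverSign o Θ m₂ := by
  let e : EuclideanSpace ℝ (Fin n) ≃ₗ[ℝ] EuclideanSpace ℝ (Fin n) :=
    (hΘ.localDiffeo.mfderivToContinuousLinearEquiv (by simp) m₂).toLinearEquiv
  have he : ∀ v, modelDeriv I I Θ m₂ v = e v := fun v => rfl
  let L : EuclideanSpace ℝ (Fin n) →L[ℝ] EuclideanSpace ℝ (Fin n) :=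
    LinearMap.toContinuousLinearMap (e.symm.toLinearMap ∘ₗ (modelDeriv I I Θ m₁).toLinearMap)
  have hL : ∀ v, modelDeriv I I Θ m₂ (L v) = modelDeriv I I Θ m₁ v := fun v => by
    rw [he]
    exact e.apply_symm_apply _
  have hc : (modelDeriv I I Θ m₂).comp L = modelDeriv I I Θ m₁ := ContinuousLinearMap.ext hL
  have h1 := (mapsOrientation_iff L (o.atPoint m₁) (-(o.atPoint m₂))).1
    (hΘ.reversing m₁ m₂ hne h L hL)
  have h2 : orientationSign (-(o.atPoint m₂)) = -orientationSign (o.atPoint m₂) :=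
    orientationSign_neg _
  rw [h2] at h1
  unfold coverSign
  rw [← hc, ContinuousLinearMap.det_comp, sign_mul, mul_assoc, h1, mul_neg]

/-- Uniqueness of lifts: a sign, being nonzero, is not its own negative. -/
theorem eq_of_coverSign_eq (hΘ : IsOrientationDoubleCover o Θ) {m₁ m₂ : M} (h : Θ m₁ = Θ m₂)
    (hs : coverSign o Θ m₁ = coverSign o Θ m₂) : m₁ = m₂ := by
  by_contra hne
  have h1 := hΘ.coverSign_eq_neg hne h
  have h2 := hΘ.coverSign_mul_self m₂
  rw [hs] at h1
  revert h1 h2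
  generalize coverSign o Θ m₂ = a
  revert a
  decide

/-- The two points of the fibre have opposite signs, so both signs occur. -/
theorem exists_coverSign_eq (hΘ : IsOrientationDoubleCover o Θ) (q : N) {s : SignType}
    (hs : s * s = 1) : ∃ m, Θ m = q ∧ coverSign o Θ m = s := by
  obtain ⟨m₁, m₂, hne, hm⟩ := Set.ncard_eq_two.1 (hΘ.two_points q)
  have h1 : Θ m₁ = q := by
    have : m₁ ∈ Θ ⁻¹' {q} := by simp [hm]
    exact this
  have h2 : Θ m₂ = q := by
    have : m₂ ∈ Θ ⁻¹' {q} := by simp [hm]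
    exact this
  have h3 := hΘ.coverSign_eq_neg hne (h1.trans h2.symm)
  have h4 := hΘ.coverSign_mul_self m₂
  have : coverSign o Θ m₁ = s ∨ coverSign o Θ m₂ = s := by
    revert h3 h4 hs
    generalize coverSign o Θ m₁ = a
    generalize coverSign o Θ m₂ = b
    revert a b s
    decide
  rcases this with h | h
  · exact ⟨m₁, h1, h⟩
  · exact ⟨m₂, h2, h⟩

theorem surjective (hΘ : IsOrientationDoubleCover o Θ) : Function.Surjective Θ := fun q => by
  obtain ⟨m, hm, -⟩ := hΘ.exists_coverSign_eq q (one_mul 1)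
  exact ⟨m, hm⟩

variable [IsManifold I 1 M] [IsManifold I 1 N]

theorem isSignAlong (hΘ : IsOrientationDoubleCover o Θ) : IsSignAlong I Θ (coverSign o Θ) :=
  IsSignAlong.map (J := I) (I := I) (I' := I) (f := fun _ => Θ) (g := id)
    (fun _ => (hΘ.localDiffeo.contMDiff.comp contMDiff_snd) _) contMDiff_id
    (fun t => hΘ.localDiffeo.det_modelDeriv_ne_zero t) o.isSignAlong

variable {F : Type*} [NormedAddCommGroup F] [NormedSpace ℝ F] {G : Type*} [TopologicalSpace G]
  {J : ModelWithCorners ℝ F G} {T : Type*} [TopologicalSpace T] [ChartedSpace G T]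

/-- The lift of a smooth map that is determined by a continuous orientation along it is smooth. -/
theorem contMDiff_lift (hΘ : IsOrientationDoubleCover o Θ) {h : T → N} {h' : T → M}
    {w : T → SignType} (hh : ContMDiff J I ∞ h) (hw : IsSignAlong I h w)
    (h1 : ∀ t, Θ (h' t) = h t) (h2 : ∀ t, coverSign o Θ (h' t) = w t) : ContMDiff J I ∞ h' := by
  intro t₀
  -- The local inverse of `Θ` at `h' t₀` gives a smooth lift near `t₀`. Its sign is continuous and
  -- agrees with `w` at `t₀`, hence nearby, so it coincides with `h'`.
  obtain ⟨Φ, hΦ, hΘΦ⟩ := hΘ.localDiffeo (h' t₀)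
  have ht₀ : h t₀ ∈ Φ.target := by
    rw [← h1 t₀, hΘΦ hΦ]
    exact Φ.map_source hΦ
  have hinv : Φ.invFun (h t₀) = h' t₀ := by
    rw [← h1 t₀, hΘΦ hΦ]
    exact Φ.left_inv hΦ
  have hσ : ContMDiffAt J I ∞ (fun t => Φ.invFun (h t)) t₀ :=
    (Φ.contMDiffOn_invFun.contMDiffAt (Φ.open_target.mem_nhds ht₀)).comp t₀ (hh t₀)
  have hσt : Tendsto (fun t => Φ.invFun (h t)) (𝓝 t₀) (𝓝 (h' t₀)) := by
    have := hσ.continuousAt.tendsto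
    rwa [hinv] at this
  refine hσ.congr_of_eventuallyEq ?_
  filter_upwards [hσt.eventually (hΘ.isSignAlong (h' t₀)), hw t₀,
    hh.continuous.continuousAt.preimage_mem_nhds (Φ.open_target.mem_nhds ht₀),
    hh.continuous.continuousAt.preimage_mem_nhds (extChartAt_source_mem_nhds (I := I) (h t₀))]
    with t a1 a2 a3 a4
  have hm : Θ (Φ.invFun (h t)) = h t :=
    (hΘΦ (Φ.map_target a3)).trans (Φ.right_inv a3)
  refine hΘ.eq_of_coverSign_eq ((h1 t).trans hm.symm) ?_
  rw [hm, h1 t₀, h2 t₀] at a1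
  rw [h2 t]
  have a5 := chartSign_mul_self (I := I) a4
  rw [← a2] at a1
  revert a1 a5
  generalize chartSign I (h t₀) (h t) = a
  generalize w t = b
  generalize coverSign o Θ (Φ.invFun (h t)) = c
  revert a b c
  decide

end IsOrientationDoubleCover

end DoubleCover

/-! ### Orientation preserving lifts and the homomorphism `η` -/

section LiftingDiffeos

variable {N S : Type*} [TopologicalSpace N] [ChartedSpace (EuclideanSpace ℝ (Fin 2)) N]
  [TopologicalSpace S] [ChartedSpace (EuclideanSpace ℝ (Fin 2)) S]
  {o : ManifoldOrientation (𝓡 2) S} {J : S → N}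

/-- The sign of the Jacobian determinant of a diffeomorphism. -/
def jacobianSign (φ : SurfaceDiffeo N) (q : N) : SignType :=
  SignType.sign (modelDeriv (𝓡 2) (𝓡 2) φ q).det

theorem SurfaceDiffeo.det_modelDeriv_ne_zero (φ : SurfaceDiffeo N) (q : N) :
    (modelDeriv (𝓡 2) (𝓡 2) φ q).det ≠ 0 :=
  φ.isLocalDiffeomorph.det_modelDeriv_ne_zero q

theorem jacobianSign_mul (φ ψ : SurfaceDiffeo N) (q : N) :
    jacobianSign (φ * ψ) q = jacobianSign φ (ψ q) * jacobianSign ψ q := by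
  have : modelDeriv (𝓡 2) (𝓡 2) (φ * ψ : SurfaceDiffeo N) q =
      (modelDeriv (𝓡 2) (𝓡 2) φ (ψ q)).comp (modelDeriv (𝓡 2) (𝓡 2) ψ q) :=
    modelDeriv_comp (φ.mdifferentiable (by simp) _) (ψ.mdifferentiable (by simp) _)
  rw [jacobianSign, this, ContinuousLinearMap.det_comp, sign_mul]
  rfl

theorem jacobianSign_one (q : N) : jacobianSign (1 : SurfaceDiffeo N) q = 1 := by
  have h1 : modelDeriv (𝓡 2) (𝓡 2) (1 : SurfaceDiffeo N) q = ContinuousLinearMap.id ℝ _ :=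
    mfderiv_id
  have h2 : (ContinuousLinearMap.id ℝ (EuclideanSpace ℝ (Fin 2))).det = 1 := LinearMap.det_id
  rw [jacobianSign, h1, h2, sign_one]

theorem jacobianSign_mul_self (φ : SurfaceDiffeo N) (q : N) :
    jacobianSign φ q * jacobianSign φ q = 1 := by
  have : jacobianSign φ q ≠ 0 := by
    rw [jacobianSign, Ne, sign_eq_zero_iff]
    exact φ.det_modelDeriv_ne_zero q
  revert this
  generalize jacobianSign φ q = a
  revert a
  decide

theorem mem_orientationPreserving_iff (φ : SurfaceDiffeo S) : φ ∈ orientationPreserving o ↔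
    ∀ p, jacobianSign φ p * orientationSign (o.atPoint p) = orientationSign (o.atPoint (φ p)) :=
  forall_congr' fun p =>
    mapsOrientation_iff (modelDeriv (𝓡 2) (𝓡 2) φ p) (o.atPoint p) (o.atPoint (φ p))

/-- A lift of a diffeomorphism preserves the orientation if and only if it is compatible with the
signs of the covering. -/
theorem IsOrientationDoubleCover.mem_orientationPreserving_iff (hJ : IsOrientationDoubleCover o J)
    {φ : SurfaceDiffeo N} {φ' : SurfaceDiffeo S} (h : ∀ p, J (φ' p) = φ (J p)) :
    φ' ∈ orientationPreserving o ↔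
      ∀ p, coverSign o J (φ' p) = jacobianSign φ (J p) * coverSign o J p := by
  rw [_root_.mem_orientationPreserving_iff]
  refine forall_congr' fun p => ?_
  have hJd : ∀ p, MDifferentiableAt (𝓡 2) (𝓡 2) J p := fun p =>
    (hJ.localDiffeo.contMDiff p).mdifferentiableAt (by simp)
  have h1 := modelDeriv_comp (hJd (φ' p)) (φ'.mdifferentiable (by simp) p)
  have h2 := modelDeriv_comp (φ.mdifferentiable (by simp) (J p)) (hJd p)
  have h3 : J ∘ φ' = φ ∘ J := funext h
  have h4 := congrArg (fun L => SignType.sign (ContinuousLinearMap.det L))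
    (h1.symm.trans ((congrArg (fun G => modelDeriv (𝓡 2) (𝓡 2) G p) h3).trans h2))
  simp only [ContinuousLinearMap.det_comp, sign_mul] at h4
  change _ * jacobianSign φ' p = jacobianSign φ (J p) * _ at h4
  have h5 : SignType.sign (modelDeriv (𝓡 2) (𝓡 2) J (φ' p)).det ≠ 0 := by
    rw [Ne, sign_eq_zero_iff]
    exact hJ.localDiffeo.det_modelDeriv_ne_zero _
  unfold coverSign
  rw [← mul_assoc, ← h4, mul_assoc]
  constructor
  · intro h6
    rw [← h6]
  · intro h6
    exact (mul_left_cancel₀ h5 h6).symm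

namespace IsOrientationDoubleCover

/-- The orientation preserving lift of a diffeomorphism, as a map. -/
def liftFun (hJ : IsOrientationDoubleCover o J) (φ : SurfaceDiffeo N) (p : S) : S :=
  (hJ.exists_coverSign_eq (φ (J p)) (s := jacobianSign φ (J p) * coverSign o J p) (by
    rw [mul_mul_mul_comm, jacobianSign_mul_self, hJ.coverSign_mul_self, one_mul])).choose

theorem apply_liftFun (hJ : IsOrientationDoubleCover o J) (φ : SurfaceDiffeo N) (p : S) :
    J (hJ.liftFun φ p) = φ (J p) :=
  (hJ.exists_coverSign_eq (φ (J p)) (s := jacobianSign φ (J p) * coverSign o J p) (by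
    rw [mul_mul_mul_comm, jacobianSign_mul_self, hJ.coverSign_mul_self, one_mul])).choose_spec.1

theorem coverSign_liftFun (hJ : IsOrientationDoubleCover o J) (φ : SurfaceDiffeo N) (p : S) :
    coverSign o J (hJ.liftFun φ p) = jacobianSign φ (J p) * coverSign o J p :=
  (hJ.exists_coverSign_eq (φ (J p)) (s := jacobianSign φ (J p) * coverSign o J p) (by
    rw [mul_mul_mul_comm, jacobianSign_mul_self, hJ.coverSign_mul_self, one_mul])).choose_spec.2

/-- Uniqueness of the lift; multiplicativity and the comparison with arbitrary orientation
preserving lifts both come from it. -/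
theorem eq_liftFun (hJ : IsOrientationDoubleCover o J) {φ : SurfaceDiffeo N} {p m : S}
    (h1 : J m = φ (J p)) (h2 : coverSign o J m = jacobianSign φ (J p) * coverSign o J p) :
    m = hJ.liftFun φ p :=
  hJ.eq_of_coverSign_eq (h1.trans (hJ.apply_liftFun φ p).symm)
    (h2.trans (hJ.coverSign_liftFun φ p).symm)

theorem liftFun_one (hJ : IsOrientationDoubleCover o J) (p : S) : hJ.liftFun 1 p = p :=
  (hJ.eq_liftFun rfl (by rw [jacobianSign_one, one_mul])).symm

theorem liftFun_mul (hJ : IsOrientationDoubleCover o J) (φ ψ : SurfaceDiffeo N) (p : S) :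
    hJ.liftFun (φ * ψ) p = hJ.liftFun φ (hJ.liftFun ψ p) := by
  refine (hJ.eq_liftFun ?_ ?_).symm
  · rw [hJ.apply_liftFun, hJ.apply_liftFun]
    rfl
  · rw [hJ.coverSign_liftFun, hJ.coverSign_liftFun, hJ.apply_liftFun, jacobianSign_mul, mul_assoc]

variable [IsManifold (𝓡 2) ∞ N] [IsManifold (𝓡 2) ∞ S]

/-- The prescribed sign is that of `J` pushed forward by `h t`, hence continuous in both variables.
The parameter is included so that isotopies lift to isotopies. -/
theorem contMDiff_liftFun_family (hJ : IsOrientationDoubleCover o J) {F : Type*}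
    [NormedAddCommGroup F] [NormedSpace ℝ F] {G : Type*} [TopologicalSpace G]
    {K : ModelWithCorners ℝ F G} {T : Type*} [TopologicalSpace T] [ChartedSpace G T]
    [IsManifold K 1 T] {h : T → SurfaceDiffeo N}
    (hh : ContMDiff (K.prod (𝓡 2)) (𝓡 2) ∞ (fun q : T × N => h q.1 q.2)) :
    ContMDiff (K.prod (𝓡 2)) (𝓡 2) ∞ (fun q : T × S => hJ.liftFun (h q.1) q.2) := by
  have hJs := hJ.localDiffeo.contMDiff
  refine hJ.contMDiff_lift (h := fun q : T × S => h q.1 (J q.2))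
    (w := fun q : T × S => jacobianSign (h q.1) (J q.2) * coverSign o J q.2)
    (hh.comp (contMDiff_fst.prodMk (hJs.comp contMDiff_snd))) ?_
    (fun q => hJ.apply_liftFun _ _) fun q => hJ.coverSign_liftFun _ _
  refine IsSignAlong.map (J := K.prod (𝓡 2)) (I := 𝓡 2) (I' := 𝓡 2)
    (f := fun (q : T × S) (x : N) => h q.1 x) (g := fun q : T × S => J q.2) (fun q => ?_)
    (hJs.comp contMDiff_snd) (fun q => (h q.1).det_modelDeriv_ne_zero _)
    (hJ.isSignAlong.comp continuous_snd)
  exact (hh.comp ((contMDiff_fst.comp contMDiff_fst).prodMk contMDiff_snd)) _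

theorem contMDiff_liftFun (hJ : IsOrientationDoubleCover o J) (φ : SurfaceDiffeo N) :
    ContMDiff (𝓡 2) (𝓡 2) ∞ (hJ.liftFun φ) := by
  have := hJ.contMDiff_liftFun_family (K := 𝓘(ℝ, ℝ)) (h := fun _ : ℝ => φ)
    (φ.contMDiff.comp contMDiff_snd)
  exact this.comp ((contMDiff_const (c := (0 : ℝ))).prodMk contMDiff_id)

/-- The orientation preserving lift of a diffeomorphism. -/
def liftDiffeo (hJ : IsOrientationDoubleCover o J) : SurfaceDiffeo N →* orientationPreserving o :=
  MonoidHom.mk' (fun φ => ⟨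
    { toFun := hJ.liftFun φ
      invFun := hJ.liftFun φ⁻¹
      left_inv := fun p => by rw [← hJ.liftFun_mul, inv_mul_cancel, hJ.liftFun_one]
      right_inv := fun p => by rw [← hJ.liftFun_mul, mul_inv_cancel, hJ.liftFun_one]
      contMDiff_toFun := hJ.contMDiff_liftFun φ
      contMDiff_invFun := hJ.contMDiff_liftFun φ⁻¹ },
    (hJ.mem_orientationPreserving_iff (φ := φ) (fun p => hJ.apply_liftFun φ p)).2
      fun p => hJ.coverSign_liftFun φ p⟩)
    fun φ ψ => Subtype.ext (Diffeomorph.ext fun p => hJ.liftFun_mul φ ψ p)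

theorem eq_liftDiffeo (hJ : IsOrientationDoubleCover o J) {φ : SurfaceDiffeo N}
    {φ' : orientationPreserving o} (h : ∀ p, J ((φ' : SurfaceDiffeo S) p) = φ (J p)) :
    φ' = hJ.liftDiffeo φ :=
  Subtype.ext (Diffeomorph.ext fun p =>
    hJ.eq_liftFun (h p) ((hJ.mem_orientationPreserving_iff h).1 φ'.2 p))

theorem smoothFamily_liftFun (hJ : IsOrientationDoubleCover o J) {h : ℝ → SurfaceDiffeo N}
    (hh : SmoothFamily (fun t p => h t p)) : SmoothFamily (fun t p => hJ.liftFun (h t) p) := by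
  have h1 := (hJ.contMDiff_liftFun_family (K := 𝓡∂ 1) (h := fun t : Icc (0 : ℝ) 1 => h t)
    hh.comp_subtypeVal_Icc).comp_projIcc
  refine h1.congr fun q hq => ?_
  simp only [projIcc_of_mem zero_le_one hq.1]

theorem smoothlyIsotopic_liftDiffeo (hJ : IsOrientationDoubleCover o J) {φ ψ : SurfaceDiffeo N}
    (h : SmoothlyIsotopic φ ψ) : SmoothlyIsotopic (hJ.liftDiffeo φ : SurfaceDiffeo S)
      (hJ.liftDiffeo ψ) := by
  obtain ⟨h, h1, h2, rfl, rfl⟩ := h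
  exact ⟨fun t => hJ.liftDiffeo (h t), hJ.smoothFamily_liftFun h1, hJ.smoothFamily_liftFun h2,
    rfl, rfl⟩

/-- The homomorphism of mapping class groups given by orientation preserving lifts. -/
def liftingHom (hJ : IsOrientationDoubleCover o J) :
    MappingClassGroup (⊤ : Subgroup (SurfaceDiffeo N)) →*
      MappingClassGroup (orientationPreserving o) :=
  QuotientGroup.map _ _ (hJ.liftDiffeo.comp (⊤ : Subgroup (SurfaceDiffeo N)).subtype) fun φ hφ => by
    have h1 : SmoothlyIsotopic 1 (φ : SurfaceDiffeo N) := hφ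
    have h2 := hJ.smoothlyIsotopic_liftDiffeo h1
    rw [map_one] at h2
    exact h2

theorem isLiftingHom (hJ : IsOrientationDoubleCover o J) : IsLiftingHom o J hJ.liftingHom := by
  refine fun φ => ⟨⟨hJ.liftDiffeo φ, fun p => hJ.apply_liftFun _ p,
    fun φ' h => hJ.eq_liftDiffeo h⟩, fun φ' h => ?_⟩
  rw [hJ.eq_liftDiffeo h]
  rfl

end IsOrientationDoubleCover

end LiftingDiffeos

end

noncomputable section
open Filter

/-! ### Lifting fibres, trivializations and monodromy to the orientation cover -/

section LiftedFibrations

variable {X B X' : Type*} [TopologicalSpace X] [ChartedSpace (EuclideanHalfSpace 4) X]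
  [TopologicalSpace B] [ChartedSpace (EuclideanHalfSpace 2) B]
  [TopologicalSpace X'] [ChartedSpace (EuclideanHalfSpace 4) X']
  {oX' : ManifoldOrientation (𝓡∂ 4) X'} {π : X' → X} {f : X → B}

theorem IsOrientationDoubleCover.criticalPoints_comp (hπ : IsOrientationDoubleCover oX' π)
    (hf : ContMDiff (𝓡∂ 4) (𝓡∂ 2) ∞ f) : criticalPoints (f ∘ π) = π ⁻¹' criticalPoints f := by
  ext x
  have hd := mfderiv_comp (I := 𝓡∂ 4) (I' := 𝓡∂ 4) (I'' := 𝓡∂ 2) x (g := f) (f := π)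
    ((hf (π x)).mdifferentiableAt (by simp))
    ((hπ.localDiffeo.contMDiff x).mdifferentiableAt (by simp))
  have hsurj : Function.Surjective (mfderiv (𝓡∂ 4) (𝓡∂ 4) π x) :=
    (hπ.localDiffeo.mfderivToContinuousLinearEquiv (by simp) x).surjective
  refine not_congr ?_
  rw [hd]
  exact hsurj.of_comp_iff (mfderiv (𝓡∂ 4) (𝓡∂ 2) f (π x))

theorem IsOrientationDoubleCover.criticalValues_comp (hπ : IsOrientationDoubleCover oX' π)
    (hf : ContMDiff (𝓡∂ 4) (𝓡∂ 2) ∞ f) : criticalValues (f ∘ π) = criticalValues f := by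
  rw [criticalValues, hπ.criticalPoints_comp hf, image_comp,
    image_preimage_eq _ hπ.surjective, criticalValues]

variable {N S : Type*} [TopologicalSpace N] [ChartedSpace (EuclideanSpace ℝ (Fin 2)) N]
  [TopologicalSpace S] [ChartedSpace (EuclideanSpace ℝ (Fin 2)) S]

/-- The sign at `k (J p)` of the orientation of the total space that is induced by those of the base
and of `S`, where `k` parametrizes a fibre. -/
def inducedSign (f : X → B) (oB : ManifoldOrientation (𝓡∂ 2) B) (oS : ManifoldOrientation (𝓡 2) S)
    (J : S → N) (k : N → X) (p : S) : SignType :=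
  frameSign (modelDeriv (𝓡 2) (𝓡∂ 4) k (J p)) (modelDeriv (𝓡∂ 4) (𝓡∂ 2) f (k (J p))) *
    coverSign oS J p * orientationSign (oB.atPoint (f (k (J p))))

theorem surjective_modelDeriv {z : B} (hz : z ∉ criticalValues f) {x : X} (hx : f x = z) :
    Function.Surjective (modelDeriv (𝓡∂ 4) (𝓡∂ 2) f x) := by
  by_contra h
  exact hz ⟨x, h, hx⟩

theorem IsFiberParam.modelDeriv_comp {z : B} {k : N → X} (hk : IsFiberParam f z k)
    (hf : ContMDiff (𝓡∂ 4) (𝓡∂ 2) ∞ f) (q : N) :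
    (modelDeriv (𝓡∂ 4) (𝓡∂ 2) f (k q)).comp (modelDeriv (𝓡 2) (𝓡∂ 4) k q) = 0 := by
  rw [← _root_.modelDeriv_comp ((hf _).mdifferentiableAt (by simp))
    ((hk.smooth _).mdifferentiableAt (by simp))]
  have : f ∘ k = fun _ => z := funext hk.apply_eq
  rw [this]
  exact mfderiv_const

variable {oB : ManifoldOrientation (𝓡∂ 2) B} {oS : ManifoldOrientation (𝓡 2) S} {J : S → N}

theorem IsFiberParam.inducedSign_mul_self {z : B} {k : N → X} (hk : IsFiberParam f z k)
    (hf : ContMDiff (𝓡∂ 4) (𝓡∂ 2) ∞ f) (hz : z ∉ criticalValues f)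
    (hJ : IsOrientationDoubleCover oS J) (p : S) :
    inducedSign f oB oS J k p * inducedSign f oB oS J k p = 1 := by
  have h1 := frameSign_ne_zero (hk.immersion (J p)) (surjective_modelDeriv hz (hk.apply_eq (J p)))
    (hk.modelDeriv_comp hf (J p))
  have h2 := hJ.coverSign_mul_self p
  have h3 : orientationSign (oB.atPoint (f (k (J p)))) * orientationSign (oB.atPoint (f (k (J p)))) =
    1 := orientationSign_mul_self _
  unfold inducedSign
  change frameSign (modelDeriv (𝓡 2) (𝓡∂ 4) k (J p)) (modelDeriv (𝓡∂ 4) (𝓡∂ 2) f (k (J p))) ≠ 0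
    at h1
  revert h1 h2 h3
  generalize frameSign _ _ = a
  generalize coverSign oS J p = b
  generalize orientationSign (oB.atPoint (f (k (J p)))) = c
  revert a b c
  decide

/-- The two points of `S` over `q` stand for opposite orientations of the fibre, while the sequence
and the base orientation are the same. -/
theorem inducedSign_eq_neg (hJ : IsOrientationDoubleCover oS J) {k : N → X} {p p' : S}
    (hne : p ≠ p') (h : J p = J p') : inducedSign f oB oS J k p = -inducedSign f oB oS J k p' := by
  unfold inducedSign
  rw [hJ.coverSign_eq_neg hne h, h, mul_neg, neg_mul]

/-- Precomposing with `φ` multiplies the frame sign by the Jacobian sign of `φ`, which is the factor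
that `coverSign` gains under the orientation preserving lift. This identity brings `η` into the
monodromy of the cover. -/
theorem IsFiberParam.inducedSign_comp {z : B} {k : N → X} (hk : IsFiberParam f z k)
    (hf : ContMDiff (𝓡∂ 4) (𝓡∂ 2) ∞ f) (hz : z ∉ criticalValues f)
    (hJ : IsOrientationDoubleCover oS J) (φ : SurfaceDiffeo N) (p : S) :
    inducedSign f oB oS J (k ∘ φ) p = inducedSign f oB oS J k (hJ.liftFun φ p) := by
  unfold inducedSign
  rw [hJ.apply_liftFun, hJ.coverSign_liftFun, _root_.modelDeriv_comp
    ((hk.smooth _).mdifferentiableAt (by simp)) (φ.mdifferentiable (by simp) _)]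
  have h1 := frameSign_comp (hk.immersion (φ (J p)))
    (surjective_modelDeriv hz (hk.apply_eq (φ (J p)))) (hk.modelDeriv_comp hf (φ (J p)))
    (G := ContinuousLinearMap.id ℝ _) (G' := ContinuousLinearMap.id ℝ _)
    (M := ContinuousLinearMap.id ℝ _) rfl (φ.det_modelDeriv_ne_zero (J p))
  have h2 : (ContinuousLinearMap.id ℝ (EuclideanSpace ℝ (Fin 2))).det = 1 := LinearMap.det_id
  have h4 : (ContinuousLinearMap.id ℝ (EuclideanSpace ℝ (Fin 4))).det = 1 := LinearMap.det_id
  rw [h2, h4, sign_one, one_mul, mul_one] at h1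
  change frameSign ((modelDeriv (𝓡 2) (𝓡∂ 4) k (φ (J p))).comp (modelDeriv (𝓡 2) (𝓡 2) φ (J p)))
    (modelDeriv (𝓡∂ 4) (𝓡∂ 2) f (k (φ (J p)))) * _ * _ = _
  refine (congrArg (fun s => s * coverSign oS J p * orientationSign (oB.atPoint (f (k (φ (J p))))))
    h1).trans ?_
  change jacobianSign φ (J p) * _ * _ * _ = _
  generalize jacobianSign φ (J p) = a
  change a * frameSign (modelDeriv (𝓡 2) (𝓡∂ 4) k (φ (J p)))
    (modelDeriv (𝓡∂ 4) (𝓡∂ 2) f (k (φ (J p)))) * _ * _ = _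
  rw [mul_comm a, mul_assoc (frameSign _ _)]

/-- Over each point of the fibre of `f`, the two points of `S` and the two points of `X'` are
matched by their signs, so `ι'` is a bijection onto the preimage of that fibre. It is an immersion
because `π ∘ ι' = k ∘ J` is one. -/
theorem IsOrientationDoubleCover.isFiberParam_lift (hJ : IsOrientationDoubleCover oS J)
    (hπ : IsOrientationDoubleCover oX' π) (hf : ContMDiff (𝓡∂ 4) (𝓡∂ 2) ∞ f) {z : B}
    (hz : z ∉ criticalValues f) {k : N → X} (hk : IsFiberParam f z k) {κ : SignType} (hκ : κ * κ = 1)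
    {ι' : S → X'} (hs : ContMDiff (𝓡 2) (𝓡∂ 4) ∞ ι') (h1 : ∀ p, π (ι' p) = k (J p))
    (h2 : ∀ p, coverSign oX' π (ι' p) = κ * inducedSign f oB oS J k p) :
    IsFiberParam (f ∘ π) z ι' := by
  refine ⟨hs, ?_, ?_, ?_⟩
  · intro p p' hpp
    by_contra hne
    have a1 : J p = J p' := hk.injective (by rw [← h1, ← h1, hpp])
    have a2 := inducedSign_eq_neg (f := f) (oB := oB) (k := k) hJ hne a1
    have a3 := hk.inducedSign_mul_self (oB := oB) hf hz hJ p'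
    have a4 := h2 p
    rw [hpp, h2 p', a2] at a4
    clear h2
    revert a3 a4 hκ
    generalize inducedSign f oB oS J k p' = a
    revert a κ
    decide
  · ext x
    constructor
    · rintro ⟨p, rfl⟩
      change f (π (ι' p)) = z
      rw [h1, hk.apply_eq]
    · intro hx
      have : π x ∈ range k := by
        rw [hk.range_eq]
        exact hx
      obtain ⟨q, hq⟩ := this
      obtain ⟨p₀, hp₀⟩ := hJ.surjective q
      have b1 := hk.inducedSign_mul_self (oB := oB) hf hz hJ p₀
      have b2 := hJ.coverSign_mul_self p₀
      have b3 := hπ.coverSign_mul_self x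
      -- Over a fixed `q`, the induced sign is a constant multiple of `coverSign`; `p₀` serves to
      -- compute this constant, and `p` is the point over `q` whose induced sign is `κ` times the
      -- sign of `x`.
      obtain ⟨p, hp, hps⟩ := hJ.exists_coverSign_eq q
        (s := coverSign oX' π x * κ * inducedSign f oB oS J k p₀ * coverSign oS J p₀) (by
          clear h2
          revert b1 b2 b3 hκ
          generalize inducedSign f oB oS J k p₀ = a
          generalize coverSign oS J p₀ = b
          generalize coverSign oX' π x = c
          revert a b c κ
          decide)
      refine ⟨p, hπ.eq_of_coverSign_eq (by rw [h1, hp, hq]) ?_⟩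
      rw [h2]
      have b4 : inducedSign f oB oS J k p * coverSign oS J p₀ =
          inducedSign f oB oS J k p₀ * coverSign oS J p := by
        unfold inducedSign
        rw [hp, hp₀, mul_right_comm, mul_right_comm (frameSign _ _ * coverSign oS J p₀),
          mul_right_comm (frameSign _ _)]
      rw [hps] at b4
      clear h2 hps
      revert b1 b2 b3 b4 hκ
      generalize inducedSign f oB oS J k p₀ = a
      generalize coverSign oS J p₀ = b
      generalize coverSign oX' π x = c
      generalize inducedSign f oB oS J k p = d
      revert a b c d κ
      decide
  · intro p
    have a1 := _root_.modelDeriv_comp (I := 𝓡 2) (I' := 𝓡∂ 4) (I'' := 𝓡∂ 4) (p := p)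
      ((hπ.localDiffeo.contMDiff (ι' p)).mdifferentiableAt (by simp))
      ((hs p).mdifferentiableAt (by simp))
    have a2 := _root_.modelDeriv_comp (I := 𝓡 2) (I' := 𝓡 2) (I'' := 𝓡∂ 4) (p := p)
      ((hk.smooth (J p)).mdifferentiableAt (by simp))
      ((hJ.localDiffeo.contMDiff p).mdifferentiableAt (by simp))
    have a3 : π ∘ ι' = k ∘ J := funext h1
    rw [a3] at a1
    have a4 : Function.Injective ((modelDeriv (𝓡 2) (𝓡∂ 4) k (J p)).comp
        (modelDeriv (𝓡 2) (𝓡 2) J p)) :=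
      (hk.immersion (J p)).comp (hJ.localDiffeo.mfderivToContinuousLinearEquiv (by simp) p).injective
    rw [← a2, a1] at a4
    exact Function.Injective.of_comp (f := modelDeriv (𝓡∂ 4) (𝓡∂ 4) π (ι' p)) a4

variable [IsManifold (𝓡∂ 4) ∞ X] [IsManifold (𝓡∂ 2) ∞ B] [IsManifold (𝓡∂ 4) ∞ X']
  [IsManifold (𝓡 2) ∞ N] [IsManifold (𝓡 2) ∞ S]
  {F : Type*} [NormedAddCommGroup F] [NormedSpace ℝ F] {G : Type*} [TopologicalSpace G]
  {K : ModelWithCorners ℝ F G} {T : Type*} [TopologicalSpace T] [ChartedSpace G T]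
  [IsManifold K 1 T]

omit [TopologicalSpace X'] [ChartedSpace (EuclideanHalfSpace 4) X'] [IsManifold (𝓡∂ 4) ∞ X'] in
theorem isSignAlong_inducedSign (hJ : IsOrientationDoubleCover oS J)
    (hf : ContMDiff (𝓡∂ 4) (𝓡∂ 2) ∞ f) {k : T → N → X} {b : T → B}
    (hks : ContMDiff (K.prod (𝓡 2)) (𝓡∂ 4) ∞ (fun q : T × N => k q.1 q.2))
    (hk : ∀ t, IsFiberParam f (b t) (k t)) (hb : ∀ t, b t ∉ criticalValues f) :
    IsSignAlong (𝓡∂ 4) (fun q : T × S => k q.1 (J q.2))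
      (fun q : T × S => inducedSign f oB oS J (k q.1) q.2) := by
  have hJs := hJ.localDiffeo.contMDiff
  refine IsSignAlong.fiber (I := 𝓡 2) (I₄ := 𝓡∂ 4) (I' := 𝓡∂ 2) (J := K.prod (𝓡 2))
    (k := fun q : T × S => k q.1) (g := fun q : T × S => J q.2) (f := f)
    (hks.comp ((contMDiff_fst.comp contMDiff_fst).prodMk contMDiff_snd))
    (hJs.comp contMDiff_snd) hf (fun q => (hk q.1).immersion _)
    (fun q => surjective_modelDeriv (hb q.1) ((hk q.1).apply_eq _))
    (fun q => (hk q.1).modelDeriv_comp hf _) (hJ.isSignAlong.comp continuous_snd) ?_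
  exact oB.isSignAlong.comp (hf.continuous.comp (hks.continuous.comp
    (continuous_fst.prodMk (hJs.continuous.comp continuous_snd))))

/-- Families of parametrized regular fibres lift to the orientation covering. -/
theorem IsOrientationDoubleCover.exists_lift_family (hJ : IsOrientationDoubleCover oS J)
    (hπ : IsOrientationDoubleCover oX' π) (hf : ContMDiff (𝓡∂ 4) (𝓡∂ 2) ∞ f)
    (oB : ManifoldOrientation (𝓡∂ 2) B) {k : T → N → X} {b : T → B}
    (hks : ContMDiff (K.prod (𝓡 2)) (𝓡∂ 4) ∞ (fun q : T × N => k q.1 q.2))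
    (hk : ∀ t, IsFiberParam f (b t) (k t)) (hb : ∀ t, b t ∉ criticalValues f)
    {κ : SignType} (hκ : κ * κ = 1) :
    ∃ F : T → S → X', ContMDiff (K.prod (𝓡 2)) (𝓡∂ 4) ∞ (fun q : T × S => F q.1 q.2) ∧
      (∀ t p, π (F t p) = k t (J p)) ∧
      (∀ t p, coverSign oX' π (F t p) = κ * inducedSign f oB oS J (k t) p) ∧
      ∀ t, IsFiberParam (f ∘ π) (b t) (F t) := by
  have hex : ∀ t p, ∃ m, π m = k t (J p) ∧
      coverSign oX' π m = κ * inducedSign f oB oS J (k t) p := fun t p =>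
    hπ.exists_coverSign_eq _ (by
      rw [mul_mul_mul_comm, hκ, (hk t).inducedSign_mul_self hf (hb t) hJ, one_mul])
  choose F h1 h2 using hex
  have hFs : ContMDiff (K.prod (𝓡 2)) (𝓡∂ 4) ∞ (fun q : T × S => F q.1 q.2) :=
    hπ.contMDiff_lift (hks.comp (contMDiff_fst.prodMk
      (hJ.localDiffeo.contMDiff.comp contMDiff_snd)))
      ((isSignAlong_inducedSign (oB := oB) hJ hf hks hk hb).const_mul κ)
      (fun q => h1 q.1 q.2) fun q => h2 q.1 q.2
  refine ⟨F, hFs, h1, h2, fun t => ?_⟩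
  exact hJ.isFiberParam_lift hπ hf (hb t) (hk t) hκ
    (hFs.comp (contMDiff_const.prodMk contMDiff_id)) (h1 t) (h2 t)

theorem IsOrientationDoubleCover.exists_lift_fiberParam (hJ : IsOrientationDoubleCover oS J)
    (hπ : IsOrientationDoubleCover oX' π) (hf : ContMDiff (𝓡∂ 4) (𝓡∂ 2) ∞ f)
    (oB : ManifoldOrientation (𝓡∂ 2) B) {z : B} (hz : z ∉ criticalValues f) {ι : N → X}
    (hι : IsFiberParam f z ι) :
    ∃ ι' : S → X', IsFiberParam (f ∘ π) z ι' ∧ ∀ p, π (ι' p) = ι (J p) := by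
  obtain ⟨F, -, h1, -, h2⟩ := hJ.exists_lift_family hπ hf oB (K := 𝓘(ℝ, ℝ)) (T := ℝ)
    (k := fun _ => ι) (b := fun _ => z) (hι.smooth.comp contMDiff_snd) (fun _ => hι) (fun _ => hz)
    (one_mul 1)
  exact ⟨F 0, h2 0, h1 0⟩

/-- A lift of a parametrized fibre is compatible with the induced orientation up to a global
sign. -/
theorem IsOrientationDoubleCover.exists_sign [ConnectedSpace S] (hJ : IsOrientationDoubleCover oS J)
    (hπ : IsOrientationDoubleCover oX' π) (hf : ContMDiff (𝓡∂ 4) (𝓡∂ 2) ∞ f)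
    (oB : ManifoldOrientation (𝓡∂ 2) B) {z : B} (hz : z ∉ criticalValues f) {ι : N → X}
    (hι : IsFiberParam f z ι) {ι' : S → X'} (hι' : Continuous ι') (h : ∀ p, π (ι' p) = ι (J p)) :
    ∃ κ : SignType, κ * κ = 1 ∧ ∀ p, coverSign oX' π (ι' p) = κ * inducedSign f oB oS J ι p := by
  have h1 : IsSignAlong (𝓡∂ 4) (fun p => ι (J p)) (fun p => coverSign oX' π (ι' p)) := by
    have := hπ.isSignAlong.comp hι'
    rwa [show π ∘ ι' = fun p => ι (J p) from funext h] at this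
  have h2 : IsSignAlong (𝓡∂ 4) (fun p => ι (J p)) (inducedSign f oB oS J ι) :=
    (isSignAlong_inducedSign (K := 𝓘(ℝ, ℝ)) (T := ℝ) (oB := oB) hJ hf (k := fun _ => ι)
      (b := fun _ => z) (hι.smooth.comp contMDiff_snd) (fun _ => hι) (fun _ => hz)).comp
      (g := fun p : S => ((0 : ℝ), p)) (continuous_const.prodMk continuous_id)
  -- On the connected surface `S`, the product of two continuous signs along the same map is
  -- constant; `κ` is its value at `p₀`. Both values are possible, since a lift may be followed by
  -- the exchange of the sheets of `π`.
  obtain ⟨p₀⟩ : Nonempty S := inferInstance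
  have hc : Continuous fun p => ι (J p) :=
    hι.smooth.continuous.comp hJ.localDiffeo.contMDiff.continuous
  refine ⟨coverSign oX' π (ι' p₀) * inducedSign f oB oS J ι p₀, ?_, fun p => ?_⟩
  · rw [mul_mul_mul_comm, hπ.coverSign_mul_self, hι.inducedSign_mul_self hf hz hJ, one_mul]
  · rw [h1.mul_eq hc h2 p₀ p, mul_assoc, hι.inducedSign_mul_self hf hz hJ, mul_one]

/-- Trivializations along loops lift to the orientation covering. -/
theorem IsTrivializationAlong.exists_lift (hJ : IsOrientationDoubleCover oS J)
    (hπ : IsOrientationDoubleCover oX' π) (hf : ContMDiff (𝓡∂ 4) (𝓡∂ 2) ∞ f)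
    (oB : ManifoldOrientation (𝓡∂ 2) B) {y : {z : B // z ∉ criticalValues f}} {a : Path y y}
    {ι : N → X} {F : ℝ → N → X} (hF : IsTrivializationAlong f a ι F) {ι' : S → X'}
    (h : ∀ p, π (ι' p) = ι (J p)) {κ : SignType} (hκ : κ * κ = 1)
    (hs : ∀ p, coverSign oX' π (ι' p) = κ * inducedSign f oB oS J ι p) :
    ∃ F' : ℝ → S → X', IsTrivializationAlong (f ∘ π) a ι' F' ∧ ∀ t ∈ Icc (0 : ℝ) 1, ∀ p,
      π (F' t p) = F t (J p) ∧ coverSign oX' π (F' t p) = κ * inducedSign f oB oS J (F t) p := by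
  obtain ⟨F', h1, h2, h3, h4⟩ := hJ.exists_lift_family hπ hf oB (K := 𝓡∂ 1)
    (T := Icc (0 : ℝ) 1) (k := fun t => F t) (b := fun t => (a.extend t : B))
    hF.smooth.comp_subtypeVal_Icc (fun t => hF.fiber t t.2) (fun t => (a.extend t).2) hκ
  have e : ∀ t (ht : t ∈ Icc (0 : ℝ) 1), projIcc 0 1 zero_le_one t = ⟨t, ht⟩ := fun t ht =>
    projIcc_of_mem zero_le_one ht
  refine ⟨fun t => F' (projIcc 0 1 zero_le_one t), ⟨h1.comp_projIcc, fun t ht => ?_, ?_⟩,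
    fun t ht p => ?_⟩
  · rw [e t ht]
    exact h4 ⟨t, ht⟩
  · funext p
    have h0 : (0 : ℝ) ∈ Icc (0 : ℝ) 1 := left_mem_Icc.2 zero_le_one
    rw [e 0 h0]
    -- Using the sign `κ` of `ι'` for the whole family makes the lifted trivialization start at `ι'`
    -- itself.
    refine hπ.eq_of_coverSign_eq ?_ ?_
    · rw [h2, h, ← hF.initial]
    · rw [h3, hs, ← hF.initial]
  · beta_reduce
    rw [e t ht]
    exact ⟨h2 _ p, h3 _ p⟩

/-- A diffeomorphism isotopic to the identity preserves orientations. -/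
theorem SmoothFamily.mem_orientationPreserving {h : ℝ → SurfaceDiffeo S}
    (hh : SmoothFamily (fun t p => h t p)) (h0 : h 0 = 1) (o : ManifoldOrientation (𝓡 2) S) :
    h 1 ∈ orientationPreserving o := by
  rw [mem_orientationPreserving_iff]
  intro p
  have hs := hh.comp_subtypeVal_Icc
  have hi : Continuous fun t : Icc (0 : ℝ) 1 => (t, p) := continuous_id.prodMk continuous_const
  have h1 : IsSignAlong (𝓡 2) (fun q : Icc (0 : ℝ) 1 × S => h q.1 q.2)
      (fun q => jacobianSign (h q.1) q.2 * orientationSign (o.atPoint q.2)) :=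
    IsSignAlong.map (J := (𝓡∂ 1).prod (𝓡 2)) (I := 𝓡 2) (I' := 𝓡 2)
      (f := fun (q : Icc (0 : ℝ) 1 × S) (x : S) => h q.1 x) (g := fun q => q.2)
      (fun q => (hs.comp ((contMDiff_fst.comp contMDiff_fst).prodMk contMDiff_snd)) _)
      contMDiff_snd (fun q => (h q.1).det_modelDeriv_ne_zero _)
      (o.isSignAlong.comp continuous_snd)
  have h2 : IsSignAlong (𝓡 2) (fun q : Icc (0 : ℝ) 1 × S => h q.1 q.2)
      (fun q => orientationSign (o.atPoint (h q.1 q.2))) := o.isSignAlong.comp hs.continuous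
  -- Along the path `t ↦ h t p`, the orientation transported from `p` and the given one are both
  -- continuous and agree at time `0`.
  have h3 := (h1.comp hi).mul_eq (hs.continuous.comp hi) (h2.comp hi)
    ⟨0, left_mem_Icc.2 zero_le_one⟩ ⟨1, right_mem_Icc.2 zero_le_one⟩
  have e0 : jacobianSign (h 0) p * orientationSign (o.atPoint p) *
      orientationSign (o.atPoint (h 0 p)) = 1 := by
    rw [h0, jacobianSign_one, one_mul]
    exact orientationSign_mul_self _
  have h4 : jacobianSign (h 1) p * orientationSign (o.atPoint p) *
      orientationSign (o.atPoint (h 1 p)) = 1 := h3.symm.trans e0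
  have h5 : orientationSign (o.atPoint (h 1 p)) * orientationSign (o.atPoint (h 1 p)) = 1 :=
    orientationSign_mul_self _
  revert h4 h5
  generalize jacobianSign (h 1) p * orientationSign (o.atPoint p) = a
  generalize orientationSign (o.atPoint (h 1 p)) = b
  revert a b
  decide

/-- The monodromy of the lifted fibration is the lift of the monodromy. -/
theorem IsMonodromyRepresentation.lift [CompactSpace S] [ConnectedSpace S] [T2Space X']
    (hJ : IsOrientationDoubleCover oS J) (hπ : IsOrientationDoubleCover oX' π)
    (hf : ContMDiff (𝓡∂ 4) (𝓡∂ 2) ∞ f) (oB : ManifoldOrientation (𝓡∂ 2) B)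
    {y : {z : B // z ∉ criticalValues f}} {ι : N → X} (hι : IsFiberParam f (y : B) ι)
    {ρ : FundamentalGroup {z : B // z ∉ criticalValues f} y →*
      MappingClassGroup (⊤ : Subgroup (SurfaceDiffeo N))}
    (hρ : IsMonodromyRepresentation f (criticalValues f) y ι ⊤ ρ) {ι' : S → X'}
    (hι' : IsFiberParam (f ∘ π) (y : B) ι') (h : ∀ p, π (ι' p) = ι (J p)) :
    IsMonodromyRepresentation (f ∘ π) (criticalValues f) y ι' (orientationPreserving oS)
      (hJ.liftingHom.comp ρ) := by
  obtain ⟨κ, hκ, hs⟩ := hJ.exists_sign hπ hf oB y.2 hι hι'.smooth.continuous h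
  refine ⟨hρ.exists_loop, fun a ha => ?_, fun a ha F' hF' => ?_⟩
  · obtain ⟨F, hF⟩ := hρ.exists_trivialization a ha
    obtain ⟨F', hF', -⟩ := hF.exists_lift hJ hπ hf oB h hκ hs
    exact ⟨F', hF'⟩
  · obtain ⟨F, hF⟩ := hρ.exists_trivialization a ha
    obtain ⟨L, hL, hLs⟩ := hF.exists_lift hJ hπ hf oB h hκ hs
    obtain ⟨φ, hφ, hρφ⟩ := hρ.eq_class a ha F hF
    -- The given `F'` need not be the lift `L` of `F`. The two differ by a smooth family of
    -- diffeomorphisms starting at the identity, so `i 1` preserves the orientation and does not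
    -- affect the mapping class.
    obtain ⟨i, hi1, hi2, hi⟩ := IsFiberParam.exists_family hL.smooth hF'.smooth hL.fiber hF'.fiber
    have m0 : (0 : ℝ) ∈ Icc (0 : ℝ) 1 := left_mem_Icc.2 zero_le_one
    have m1 : (1 : ℝ) ∈ Icc (0 : ℝ) 1 := right_mem_Icc.2 zero_le_one
    have hi0 : i 0 = 1 := Diffeomorph.ext fun p => by
      have := hi 0 m0 p
      rw [hL.initial, hF'.initial] at this
      exact hι'.injective this
    -- Both sides lie over `ι (φ (J p))`, and by `inducedSign_comp` they have the same sign.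
    have hL1 : ∀ p, L 1 p = ι' (hJ.liftFun φ p) := fun p => by
      refine hπ.eq_of_coverSign_eq ?_ ?_
      · rw [(hLs 1 m1 p).1, h, hJ.apply_liftFun, hφ]
      · have hF1 : F 1 = ι ∘ (φ : SurfaceDiffeo N) := funext fun q => (hφ q).symm
        rw [(hLs 1 m1 p).2, hs, hF1, hι.inducedSign_comp hf y.2 hJ]
    refine ⟨hJ.liftDiffeo φ * ⟨i 1, hi1.mem_orientationPreserving hi0 oS⟩, fun p => ?_, ?_⟩
    · rw [← hi 1 m1 p, hL1]
      rfl
    · have h1 : SmoothlyIsotopic (1 : SurfaceDiffeo S) (i 1) := ⟨i, hi1, hi2, hi0, rfl⟩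
      have h2 := (SmoothlyIsotopic.refl (hJ.liftDiffeo φ : SurfaceDiffeo S)).mul h1
      rw [mul_one] at h2
      refine Eq.trans ?_ ((mappingClass_eq_iff _ _).2 h2)
      rw [MonoidHom.comp_apply, hρφ]
      exact (hJ.isLiftingHom φ).2 _ fun p => hJ.apply_liftFun φ p

end LiftedFibrations

end

theorem proposition4p2
    -- the genus and the closed surfaces `N = N_g`, `S = Σ_{g-1}` with the covering `J : S → N`
    (g : ℕ) (hg : 3 ≤ g)
    {N : Type*} [TopologicalSpace N] [ChartedSpace (EuclideanSpace ℝ (Fin 2)) N]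
    [IsManifold (𝓡 2) ∞ N] [T2Space N] [CompactSpace N] [ConnectedSpace N]
    (hN : ¬ IsOrientableManifold (𝓡 2) N) (hNg : HasGenus N g)
    {S : Type*} [TopologicalSpace S] [ChartedSpace (EuclideanSpace ℝ (Fin 2)) S]
    [IsManifold (𝓡 2) ∞ S] [T2Space S] [CompactSpace S] [ConnectedSpace S]
    (oS : ManifoldOrientation (𝓡 2) S) (hSg : HasGenus S (g - 1))
    (J : S → N) (hJ : IsOrientationDoubleCover oS J)
    -- the total space, the base and the non-orientable Lefschetz fibration `f`
    {X : Type*} [TopologicalSpace X] [ChartedSpace (EuclideanHalfSpace 4) X]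
    [IsManifold (𝓡∂ 4) ∞ X] [T2Space X] [CompactSpace X] [ConnectedSpace X]
    (hX : ¬ IsOrientableManifold (𝓡∂ 4) X)
    {B : Type*} [TopologicalSpace B] [ChartedSpace (EuclideanHalfSpace 2) B]
    [IsManifold (𝓡∂ 2) ∞ B] [T2Space B] [CompactSpace B] [ConnectedSpace B]
    (hB : IsOrientableManifold (𝓡∂ 2) B)
    (f : X → B) (hf : IsLefschetzFibration f)
    -- the orientation double covering `π : X' → X`
    {X' : Type*} [TopologicalSpace X'] [ChartedSpace (EuclideanHalfSpace 4) X']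
    [IsManifold (𝓡∂ 4) ∞ X'] [T2Space X']
    (oX' : ManifoldOrientation (𝓡∂ 4) X') (π : X' → X) (hπ : IsOrientationDoubleCover oX' π)
    -- a regular value `y` and the inverse `ι` of a diffeomorphism `Ξ : f⁻¹(y) → N`
    (y : {z : B // z ∉ criticalValues f}) (ι : N → X) (hι : IsFiberParam f (y : B) ι) :
    criticalValues (f ∘ π) = criticalValues f ∧
    (∃ ι' : S → X', IsFiberParam (f ∘ π) (y : B) ι' ∧ ∀ p, π (ι' p) = ι (J p)) ∧
    ∃ (η : MappingClassGroup (⊤ : Subgroup (SurfaceDiffeo N)) →*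
          MappingClassGroup (orientationPreserving oS))
      (ρ : FundamentalGroup {z : B // z ∉ criticalValues f} y →*
          MappingClassGroup (⊤ : Subgroup (SurfaceDiffeo N))),
      IsLiftingHom oS J η ∧
      IsMonodromyRepresentation f (criticalValues f) y ι ⊤ ρ ∧
      -- for every lift `Ξ'` of `Ξ`, with inverse `ι'`
      ∀ ι' : S → X', IsFiberParam (f ∘ π) (y : B) ι' → (∀ p, π (ι' p) = ι (J p)) →
        ∃ ρ' : FundamentalGroup {z : B // z ∉ criticalValues f} y →*
            MappingClassGroup (orientationPreserving oS),
          IsMonodromyRepresentation (f ∘ π) (criticalValues f) y ι' (orientationPreserving oS) ρ' ∧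
          ρ' = η.comp ρ := by
  -- Either orientation of the base serves: it enters only the auxiliary induced signs, and not `η`
  -- or `ρ`.
  obtain ⟨oB⟩ := hB
  have hP : ∀ z ∉ criticalValues f, ∃ P : FiberTransport f, z ∈ P.base := fun z hz =>
    exists_fiberTransport hf.smooth hf.boundary_eq fun x hx => by
      by_contra h
      exact hz ⟨x, h, hx⟩
  obtain ⟨ρ, hρ⟩ := exists_isMonodromyRepresentation hf.smooth.continuous
    (isClosed_criticalValues hf) hP y hι
  exact ⟨hπ.criticalValues_comp hf.smooth, hJ.exists_lift_fiberParam hπ hf.smooth oB y.2 hι,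
    hJ.liftingHom, ρ, hJ.isLiftingHom, hρ, fun ι' hι' h =>
      ⟨_, IsMonodromyRepresentation.lift hJ hπ hf.smooth oB hι hρ hι' h, rfl⟩⟩
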